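/- **Notation.** Powers $z^w=e^{w\log z}$ use the principal logarithm ($\arg z\in(-\pi,\pi]$), $\{x\}$ is the fractional part of $x\in\mathbb R$, $\operatorname{sgn}a=\pm1$ is the sign of $a\neq0$, $1_A$ is an indicator function, $\psi$ is the digamma function, $\gamma$ is the Euler–Mascheroni constant. $\zeta(s,x)$, $x>0$, is the Hurwitz zeta function, i.e. the meromorphic continuation of $\sum_{k\ge0}(k+x)^{-s}$. Write $${}_1F_2(\alpha;\beta,\gamma;z)=\sum_{n\ge0}\frac{(\alpha)_n}{(\beta)_n(\gamma)_n}\frac{z^n}{n!},$$ and let ${}_2F_1$ be the principal branch of the Gauss function, holomorphic on $\mathbb C\setminus[1,\infty)$ and extended to real $z>1$ by its boundary value from below, $\lim_{\epsilon\downarrow0}{}_2F_1(\ldots;z-i\epsilon)$. Sums over $k\in\mathbb Z$ are taken in the order of increasing $|k|$, the summands for $k$ and $-k$ being added together, and "absolute convergence" of such a sum refers to the resulting series over $|k|=0,1,2,\dots$. A series "converges absolutely and uniformly" if the series of absolute values converges uniformly. Let $a\in\mathbb R\setminus\{0\}$, $b\in\mathbb R$, $d>0$, and let $n\in\mathbb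 Z$ be minimal such that $n\ge|a|d+b\operatorname{sgn}a$. Set $$\begin{aligned}H_{a,b,d}(s)={}&\frac{\log2}{sd^s}+1_{\mathbb R\setminus\mathbb Z}(ad+b)\frac{\log(\sin(\pi(ad+b))^2)}{2sd^s}+1_{\mathbb Z}(b)\frac1{s^2d^s}\\&+\frac1{sd^s}1_{\mathbb Z}(ad+b)\Big(-\psi(1-s)-\gamma+\tfrac12\log((\pi ad)^2)\Big)\\&-\frac1{d^s}\sum_{k\in\mathbb Z,\ k\notin\{b,ad+b\}}\frac{ad}{b-k}\,\frac{{}_2F_1\big(1,1-s;2-s;-\frac{ad}{b-k}\big)}{s(1-s)}\\&+i\frac{\pi|a|^s}{s}\Big(\zeta(s,1-\{b\operatorname{sgn}a\})-\zeta(s,n-b\operatorname{sgn}a)\Big)\end{aligned}$$ and, for $k\ge1$, $$f_k(s)=\frac{\cos(2\pi bk)}{d^ssk}{}_1F_2\Big(-\frac s2;\frac12,1-\frac s2;-\pi^2a^2d^2k^2\Big)+\frac{2\pi ad^{1-s}\sin(2\pi bk)}{1-s}{}_1F_2\Big(\frac{1-s}2;\frac32,1+\frac{1-s}2;-\pi^2a^2d^2k^2\Big),$$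 $$g_k(s)=k^{s-1}(2\pi)^s\Gamma(-s)\,\tfrac12\Big((-ia)^se^{2\pi ibk}+(ia)^se^{-2\pi ibk}\Big).$$ **Theorem.** 1. *Principal identity.* For $\Re s>1$, $$H_{a,b,d}(s)+\frac{\pi|a|^s}{s}\Big(\frac{\zeta(s,1-\{-b\operatorname{sgn}a\})}{\sin\pi s}+\frac{\zeta(s,1-\{b\operatorname{sgn}a\})}{\tan\pi s}\Big)=-\sum_{k=1}^\infty\big(f_k(s)+g_k(s)\big),$$ where at the integers $s\ge2$ the left-hand side is understood as a limit and each $f_k+g_k$ by removing its singularity. 2. *Right-hand side.* Each $f_k+g_k$ extends to an entire function of $s$ (its singularities, at $s\in\{0,1,2,\dots\}$, are removable), and with these extensions $\sum_k(f_k+g_k)$ converges absolutely for every $s\in\mathbb C$ to an entire function. For all $\epsilon,\delta,B>0$ the series $\sum_kd^s(f_k(s)+g_k(s))$ converges absolutely and uniformly in $\Re s>-\epsilon$, $|\Im s|<\epsilon$, $b\in\mathbb R$, $\delta\le|a|\le B$, $\delta\le d\le B$; so does $\sum_k(f_k(s)+g_k(s))$ when moreover $d\ge1$ or $\Re s\le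 B$. 3. *Left-hand side.* The sum $\sum_{k\notin\{b,ad+b\}}\frac{ad}{b-k}\,{}_2F_1\big(1,1-s;2-s;-\frac{ad}{b-k}\big)$ converges absolutely for every $s\in\mathbb C\setminus\{2,3,\dots\}$ to a function that is meromorphic on $\mathbb C$ with all its poles in $\{2,3,\dots\}$. For all $\epsilon,\delta,B>0$ the sum in $H_{a,b,d}$ (this sum, divided by $s(1-s)$) converges absolutely and uniformly in $s,a,b,d$ subject to $\Re s<\epsilon$, $|s-m|\ge\delta$ for all integers $0\le m\le\epsilon$, $|b|\le B$, $\operatorname{dist}(b,\mathbb Z)\ge\delta$, $\operatorname{dist}(ad+b,\mathbb Z)\ge\delta$, $|ad|\le B$. 4. *Second identity.* If $s\ne0$ and either $\Re s<1$, $b\notin\mathbb Z$, or $\Re s<0$, $b\in\mathbb Z$, then the following series converges and $$\sum_{k=1}^\infty\bigg(\frac{2\pi a\sin(2\pi bk)}{1-s}{}_1F_2\Big(\frac{1-s}2;\frac32,1+\frac{1-s}2;-\pi^2a^2k^2\Big)+\frac{\cos(2\pi bk)}{sk}{}_1F_2\Big(-\frac s2;\frac12,1-\frac s2;-\pi^2a^2k^2\Big)\bigg)=-H_{a,b,1}(s).$$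 -/

import Mathlib

/-- The series `₁F₂(α; β, γ; z) = ∑ (α)ₙ / ((β)ₙ (γ)ₙ) zⁿ / n!`
(used only for `β, γ ∉ {0, -1, -2, …}`, where it converges for every `z`). -/
noncomputable def hyp1F2 (α β γ z : ℂ) : ℂ :=
  ∑' n : ℕ, (ascPochhammer ℂ n).eval α /
    ((ascPochhammer ℂ n).eval β * (ascPochhammer ℂ n).eval γ) * (z ^ n / (n.factorial : ℂ))

/-- `f` is the principal branch of the Gauss function `₂F₁(α, β; γ; ·)` on `ℂ \ {1}`:
it is holomorphic on the plane cut along `[1, ∞)`, it is given by the Gauss series in the unit disc,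
and on the cut it takes the boundary value from below. This is the choice that goes with
`arg ∈ (-π, π]`: if `z = x > 1` is approached from below then `1 - z` approaches `1 - x < 0`
from above. -/
def IsPrincipalGauss (α β γ : ℂ) (f : ℂ → ℂ) : Prop :=
  DifferentiableOn ℂ f {z | 1 - z ∈ Complex.slitPlane} ∧
  (∀ z : ℂ, ‖z‖ < 1 → f z = ordinaryHypergeometric α β γ z) ∧
  ∀ x : ℝ, 1 < x →
    Filter.Tendsto f (nhdsWithin (x : ℂ) {z : ℂ | z.im < 0}) (nhds (f (x : ℂ)))

open Classical in
/-- The principal branch of `₂F₁(α, β; γ; z)` for `z ≠ 1` and `γ ∉ {0, -1, -2, …}`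
(where `IsPrincipalGauss` determines it). -/
noncomputable def gauss2F1 (α β γ z : ℂ) : ℂ :=
  if h : ∃ f : ℂ → ℂ, IsPrincipalGauss α β γ f then h.choose z else 0

theorem isPrincipalGauss_unique {α β γ : ℂ} {f g : ℂ → ℂ} (hf : IsPrincipalGauss α β γ f)
    (hg : IsPrincipalGauss α β γ g) {z : ℂ} (hz : z ≠ 1) : f z = g z := by
  have hopen : IsOpen {z : ℂ | 1 - z ∈ Complex.slitPlane} :=
    Complex.isOpen_slitPlane.preimage (continuous_const.sub continuous_id)
  have hconn : IsPreconnected {z : ℂ | 1 - z ∈ Complex.slitPlane} := by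
    have h1 : IsPreconnected Complex.slitPlane :=
      (Complex.starConvex_one_slitPlane.isPathConnected
        Complex.one_mem_slitPlane).isConnected.isPreconnected
    have h2 := h1.image (fun w : ℂ => 1 - w) (continuous_const.sub continuous_id).continuousOn
    convert h2 using 1
    ext w
    constructor
    · intro hw
      exact ⟨1 - w, hw, by ring⟩
    · rintro ⟨v, hv, rfl⟩
      simpa using hv
  have hcut : ∀ w : ℂ, 1 - w ∈ Complex.slitPlane → f w = g w := by
    have h0 : (0 : ℂ) ∈ {z : ℂ | 1 - z ∈ Complex.slitPlane} := by simp
    have he := (hf.1.analyticOnNhd hopen).eqOn_of_preconnected_of_eventuallyEq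
      (hg.1.analyticOnNhd hopen) hconn h0 (by
        filter_upwards [Metric.ball_mem_nhds (0 : ℂ) one_pos] with w hw
        have hw' : ‖w‖ < 1 := by simpa using hw
        rw [hf.2.1 w hw', hg.2.1 w hw'])
    exact fun w hw => he hw
  by_cases h : 1 - z ∈ Complex.slitPlane
  · exact hcut z h
  · have hre : z.im = 0 ∧ 1 ≤ z.re := by
      rw [Complex.mem_slitPlane_iff] at h
      push Not at h
      simpa [and_comm] using h
    have hx : z = (z.re : ℂ) := Complex.ext (by simp) (by simp [hre.1])
    have hlt : 1 < z.re := lt_of_le_of_ne hre.2 fun h1 => hz (by rw [hx, ← h1]; simp)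
    have hne : (nhdsWithin ((z.re : ℝ) : ℂ) {z : ℂ | z.im < 0}).NeBot := by
      rw [← mem_closure_iff_nhdsWithin_neBot, Complex.closure_setOfPred_im_lt]
      simp
    rw [hx]
    refine tendsto_nhds_unique ((hf.2.2 z.re hlt).congr' ?_) (hg.2.2 z.re hlt)
    filter_upwards [self_mem_nhdsWithin] with w hw
    refine hcut w (Or.inr ?_)
    simpa using hw.ne

/-- The Hurwitz zeta function `ζ(s, x)`, `x > 0`, continued to `s ∈ ℂ \ {1}`. With
`x = x₀ + m`, `x₀ ∈ (0, 1]`, Mathlib's function gives `ζ(s, x₀)`, from which the first `m` terms are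
removed (see `hasSum_hurwitzZetaAt` and `differentiableAt_hurwitzZetaAt`). -/
noncomputable def hurwitzZetaAt (s : ℂ) (x : ℝ) : ℂ :=
  HurwitzZeta.hurwitzZeta (x : UnitAddCircle) s -
    ∑ j ∈ Finset.range (⌈x⌉₊ - 1), ((x - (j + 1) : ℝ) : ℂ) ^ (-s)

theorem hasSum_hurwitzZetaAt {x : ℝ} (hx : 0 < x) {s : ℂ} (hs : 1 < s.re) :
    HasSum (fun k : ℕ => ((k + x : ℝ) : ℂ) ^ (-s)) (hurwitzZetaAt s x) := by
  obtain ⟨m, hm⟩ : ∃ m : ℕ, ⌈x⌉₊ = m + 1 :=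
    Nat.exists_eq_succ_of_ne_zero (Nat.ceil_pos.mpr hx).ne'
  have h1 : x ≤ m + 1 := by
    have := Nat.le_ceil x
    rw [hm] at this
    exact_mod_cast this
  have h2 : (m : ℝ) < x := Nat.lt_ceil.mp (by omega)
  have hmem : x - m ∈ Set.Icc (0 : ℝ) 1 := ⟨by linarith, by linarith⟩
  have hsum := HurwitzZeta.hasSum_hurwitzZeta_of_one_lt_re hmem hs
  have hcoe : ((x - m : ℝ) : UnitAddCircle) = (x : UnitAddCircle) := by
    rw [AddCircle.coe_sub]
    have : ((m : ℝ) : UnitAddCircle) = 0 := by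
      rw [AddCircle.coe_eq_zero_iff]
      exact ⟨m, by simp⟩
    rw [this, sub_zero]
  rw [hcoe] at hsum
  have h3 := (hasSum_nat_add_iff' m).mpr hsum
  unfold hurwitzZetaAt
  have hf : (fun k : ℕ => ((k + x : ℝ) : ℂ) ^ (-s)) =
      fun k : ℕ => 1 / (((k + m : ℕ) : ℂ) + ((x - m : ℝ) : ℂ)) ^ s := by
    funext k
    rw [Complex.cpow_neg, one_div]
    congr 2
    push_cast
    ring
  have hg : ∑ j ∈ Finset.range (⌈x⌉₊ - 1), ((x - (j + 1) : ℝ) : ℂ) ^ (-s) =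
      ∑ j ∈ Finset.range m, 1 / ((j : ℂ) + ((x - m : ℝ) : ℂ)) ^ s := by
    rw [hm, Nat.add_sub_cancel, ← Finset.sum_range_reflect]
    refine Finset.sum_congr rfl fun j hj => ?_
    have hj' : j < m := Finset.mem_range.mp hj
    rw [Complex.cpow_neg, one_div]
    congr 2
    have : ((m - 1 - j : ℕ) : ℝ) = m - 1 - j := by
      rw [Nat.cast_sub (by omega), Nat.cast_sub (by omega)]
      simp
    rw [this]
    push_cast
    ring
  rw [hf, hg]
  exact h3

theorem differentiableAt_hurwitzZetaAt (x : ℝ) {s : ℂ} (hs : s ≠ 1) :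
    DifferentiableAt ℂ (fun z => hurwitzZetaAt z x) s := by
  unfold hurwitzZetaAt
  refine (HurwitzZeta.differentiableAt_hurwitzZeta _ hs).sub ?_
  refine DifferentiableAt.fun_sum fun j hj => ?_
  have hj' : j + 1 < ⌈x⌉₊ := by
    have := Finset.mem_range.mp hj
    omega
  have hlt : ((j + 1 : ℕ) : ℝ) < x := Nat.lt_ceil.mp hj'
  push_cast at hlt
  have hne : ((x - (j + 1) : ℝ) : ℂ) ≠ 0 := by
    exact_mod_cast (sub_pos.mpr hlt).ne'
  exact differentiableAt_id.neg.const_cpow (Or.inl hne)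

open Classical in
/-- The summand `ad/(b-k) · ₂F₁(1, 1-s; 2-s; -ad/(b-k))`, with the indices `k = b` and `k = ad + b`
left out. -/
noncomputable def gaussTerm (a b d : ℝ) (s : ℂ) (k : ℤ) : ℂ :=
  if (k : ℝ) = b ∨ (k : ℝ) = a * d + b then 0
  else ((a * d / (b - k) : ℝ) : ℂ) *
    gauss2F1 1 (1 - s) (2 - s) ((-(a * d / (b - k)) : ℝ) : ℂ)

/-- The summands with `|k| = K` taken together (one summand for `K = 0`, two for `K ≥ 1`), so that
`∑' K` is the sum over `k ∈ ℤ` in the order of increasing `|k|`. -/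
noncomputable def gaussShell (a b d : ℝ) (s : ℂ) (K : ℕ) : ℂ :=
  ∑ k ∈ ({(K : ℤ), -(K : ℤ)} : Finset ℤ), gaussTerm a b d s k

open Classical in
/-- The function `H_{a,b,d}(s)`. The integer `⌈|a| d + b sgn a⌉` is the least `n` with
`n ≥ |a| d + b sgn a`. -/
noncomputable def logSineH (a b d : ℝ) (s : ℂ) : ℂ :=
  (Real.log 2 : ℂ) / (s * (d : ℂ) ^ s)
  + (if ∃ m : ℤ, a * d + b = m then 0
      else (Real.log (Real.sin (Real.pi * (a * d + b)) ^ 2) : ℂ) / (2 * s * (d : ℂ) ^ s))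
  + (if ∃ m : ℤ, b = m then 1 / (s ^ 2 * (d : ℂ) ^ s) else 0)
  + (if ∃ m : ℤ, a * d + b = m then
      1 / (s * (d : ℂ) ^ s) *
        (-Complex.digamma (1 - s) - (Real.eulerMascheroniConstant : ℂ)
          + (Real.log ((Real.pi * a * d) ^ 2) : ℂ) / 2)
      else 0)
  - 1 / (d : ℂ) ^ s * ∑' K : ℕ, gaussShell a b d s K / (s * (1 - s))
  + Complex.I * ((Real.pi : ℂ) * ((|a| : ℝ) : ℂ) ^ s / s) *
      (hurwitzZetaAt s (1 - Int.fract (b * Real.sign a))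
        - hurwitzZetaAt s ((⌈|a| * d + b * Real.sign a⌉ : ℝ) - b * Real.sign a))

/-- The left-hand side of the principal identity. -/
noncomputable def logSineLHS (a b d : ℝ) (s : ℂ) : ℂ :=
  logSineH a b d s + (Real.pi : ℂ) * ((|a| : ℝ) : ℂ) ^ s / s *
    (hurwitzZetaAt s (1 - Int.fract (-(b * Real.sign a))) / Complex.sin (Real.pi * s)
      + hurwitzZetaAt s (1 - Int.fract (b * Real.sign a)) / Complex.tan (Real.pi * s))

/-- The part of the `k`-th summand on the right-hand side that consists of the two `₁F₂` terms. -/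
noncomputable def hypTerm (a b d : ℝ) (k : ℕ) (s : ℂ) : ℂ :=
  (Real.cos (2 * Real.pi * b * k) : ℂ) / ((d : ℂ) ^ s * s * k) *
      hyp1F2 (-s / 2) (1 / 2) (1 - s / 2) ((-(Real.pi ^ 2 * a ^ 2 * d ^ 2 * k ^ 2) : ℝ) : ℂ)
  + 2 * (Real.pi : ℂ) * a * (d : ℂ) ^ (1 - s) * (Real.sin (2 * Real.pi * b * k) : ℂ) / (1 - s) *
      hyp1F2 ((1 - s) / 2) (3 / 2) (1 + (1 - s) / 2)
        ((-(Real.pi ^ 2 * a ^ 2 * d ^ 2 * k ^ 2) : ℝ) : ℂ)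

/-- The part of the `k`-th summand on the right-hand side that contains the Gamma function. -/
noncomputable def gammaTerm (a b : ℝ) (k : ℕ) (s : ℂ) : ℂ :=
  (k : ℂ) ^ (s - 1) * (2 * (Real.pi : ℂ)) ^ s * Complex.Gamma (-s) * (1 / 2) *
    ((-Complex.I * a) ^ s * Complex.exp (2 * Real.pi * b * k * Complex.I)
      + (Complex.I * a) ^ s * Complex.exp (-(2 * Real.pi * b * k * Complex.I)))

/-- The series `∑ₖ f k p` converges absolutely for every `p ∈ A`, and `∑ₖ |f k p|` converges
uniformly on `A`. -/
def AbsUniformlyConvergesOn {P : Type*} (f : ℕ → P → ℂ) (A : Set P) : Prop :=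
  (∀ p ∈ A, Summable fun k => ‖f k p‖) ∧
  TendstoUniformlyOn (fun N p => ∑ k ∈ Finset.range N, ‖f k p‖) (fun p => ∑' k, ‖f k p‖)
    Filter.atTop A

section

open Filter Topology MeasureTheory Set

/-! Take `d = 1`. Up to the factor `-1/(2k)`, the two ₁F₂ terms of the `k`-th summand are a
combination, with coefficients `exp(±2πibk)`, of the functions `x^s γ(-s, x)` at `x = ∓2πika`. The
Gamma term is the same combination of `x^s Γ(-s)`, with the opposite sign. Their sum is therefore a
combination of `x^s Γ(-s, x)`, and on the closed right half plane this function is a Laplace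
integral that is entire in `s` and `O(1/|x|)`. With the factor `1/k` this gives entire summands of
size `O(1/k²)` (`scaledLowerGamma_add_upper`, `entireTerm_eq`, `norm_entireTerm_le`).

By the identity theorem it is enough to evaluate the sum for `re s < -2`, where the two parts
converge separately. The Gamma parts add up to periodic zeta functions (`gammaSum`); for `re s > 1`
Hurwitz's formula turns these into the Hurwitz zeta values on the left-hand side
(`neg_gammaSum_eq`). The ₁F₂ parts are `-∫₀¹ cos(2πk(at+b))/k · t^(-s-1) dt`, so the Fourier series
of `log|2 sin πy|` sums them to the logarithmic sine integral `∫₀¹ log|2 sin π(at+b)| t^(-s-1) dt`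
(`hasSum_hypTerm`).

The same integral can be computed from Euler's sine product (`logSineH_eq_integral_of_pos`). The
logarithm of each linear factor is integrated on its own. A factor whose zero is not an endpoint of
the path from `b` to `a + b` gives a Gauss function (`integral_latticeLog_of_ne`); a zero at the
start gives `1/s²` and a zero at the end gives the digamma term. For zeros strictly inside, the
Gauss function sits on its cut and has a spurious imaginary part; these finitely many corrections
form the difference of Hurwitz zeta values in `logSineH`.

Scaling by `d` and the reflection `(a, b) ↦ (-a, -b)` reduce everything to `d = 1`, `a > 0`. The
Gauss series converges because its first-order terms cancel between `k` and `-k`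
(`norm_shell_node_le`), and its continuation in `s` is read off from the explicit form `gaussForm`.
The second identity subtracts the Gamma series from the full one; for non-integral `b` that series
still converges in `re s < 1`, by partial summation (`tendsto_expZeta`). -/

/-! ### Parameter integrals, sums of simple poles, and the identity theorem off the natural numbers.
-/

/-- Holomorphy of a parameter integral under domination on an open set. -/
theorem differentiableOn_integral_of_dominated {α : Type*} [MeasurableSpace α] {μ : Measure α}
    {F : ℂ → α → ℂ} {U : Set ℂ} (hU : IsOpen U) {bound : α → ℝ}
    (hmeas : ∀ z ∈ U, AEStronglyMeasurable (F z) μ)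
    (hdiff : ∀ᵐ t ∂μ, DifferentiableOn ℂ (fun z => F z t) U)
    (hb : ∀ᵐ t ∂μ, ∀ z ∈ U, ‖F z t‖ ≤ bound t) (hint : Integrable bound μ) :
    DifferentiableOn ℂ (fun z => ∫ t, F z t ∂μ) U := by
  intro z₀ hz₀
  obtain ⟨r, hr, hball⟩ := Metric.isOpen_iff.mp hU z₀ hz₀
  have hr2 : 0 < r / 2 := by positivity
  have hsub : ∀ z ∈ Metric.ball z₀ (r / 2), Metric.closedBall z (r / 4) ⊆ U := by
    intro z hz w hw
    apply hball
    rw [Metric.mem_ball] at hz ⊢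
    rw [Metric.mem_closedBall] at hw
    linarith [dist_triangle w z z₀]
  have hball2 : Metric.ball z₀ (r / 2) ⊆ U :=
    (Metric.ball_subset_ball (by linarith)).trans hball
  -- Cauchy's estimate on circles of radius `r / 4` dominates the derivative in `z`, so a bound for
  -- `F` alone is enough.
  refine (hasDerivAt_integral_of_dominated_loc_of_deriv_le (μ := μ) (𝕜 := ℂ)
    (bound := fun t => bound t / (r / 4)) (s := Metric.ball z₀ (r / 2))
    (F' := fun z t => deriv (fun w => F w t) z)
    (Metric.ball_mem_nhds _ hr2) ?_ ?_ ?_ ?_ ?_ ?_).2.differentiableAt.differentiableWithinAt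
  · filter_upwards [hU.mem_nhds hz₀] with z hz using hmeas z hz
  · exact hint.mono' (hmeas z₀ hz₀) (hb.mono fun t ht => ht z₀ hz₀)
  -- The derivative at `z₀` is measurable in `t` as an almost everywhere limit of difference
  -- quotients along this sequence.
  · have hu : ∀ n : ℕ, z₀ + (r / 2 / (n + 2) : ℝ) ∈ U := by
      intro n
      apply hball2
      rw [Metric.mem_ball, dist_eq_norm, add_sub_cancel_left, Complex.norm_real,
        Real.norm_of_nonneg (by positivity)]
      rw [div_lt_iff₀ (by positivity)]
      nlinarith [(Nat.cast_nonneg n : (0 : ℝ) ≤ n)]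
    refine aestronglyMeasurable_of_tendsto_ae (u := atTop)
      (f := fun (n : ℕ) t => ((r / 2 / (n + 2) : ℝ) : ℂ)⁻¹ •
        (F (z₀ + (r / 2 / (n + 2) : ℝ)) t - F z₀ t)) ?_ ?_
    · intro n
      exact ((hmeas _ (hu n)).sub (hmeas _ hz₀)).const_smul (((r / 2 / (n + 2) : ℝ) : ℂ)⁻¹)
    · filter_upwards [hdiff] with t ht
      have hd := ((ht z₀ hz₀).differentiableAt (hU.mem_nhds hz₀)).hasDerivAt
      refine (hd.tendsto_slope_zero).comp
        (g := fun h : ℂ => h⁻¹ • (F (z₀ + h) t - F z₀ t)) ?_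
      refine tendsto_nhdsWithin_iff.mpr ⟨?_, Eventually.of_forall fun n => ?_⟩
      · have h : Tendsto (fun n : ℕ => r / 2 / ((n : ℝ) + 2)) atTop (𝓝 0) :=
          tendsto_const_nhds.div_atTop
            (tendsto_natCast_atTop_atTop.atTop_add tendsto_const_nhds)
        have := (Complex.continuous_ofReal.tendsto (0 : ℝ)).comp h
        simpa only [Complex.ofReal_zero, Function.comp_def] using this
      · have : r / 2 / ((n : ℝ) + 2) ≠ 0 := by positivity
        simpa only [mem_compl_iff, mem_singleton_iff, Complex.ofReal_eq_zero] using this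
  · filter_upwards [hdiff, hb] with t hd ht z hz
    refine Complex.norm_deriv_le_of_forall_mem_sphere_norm_le (by positivity) ?_ ?_
    · apply DifferentiableOn.diffContOnCl
      rw [closure_ball _ (by positivity)]
      exact hd.mono (hsub z hz)
    · intro w hw
      exact ht w (hsub z hz (Metric.sphere_subset_closedBall hw))
  · exact hint.div_const _
  · filter_upwards [hdiff] with t ht z hz
    exact ((ht z (hball2 hz)).differentiableAt (hU.mem_nhds (hball2 hz))).hasDerivAt

theorem integrableOn_cpow_unit {w : ℂ} (hw : 0 < w.re) :
    IntegrableOn (fun t : ℝ => (t : ℂ) ^ (w - 1)) (Ioc 0 1) := by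
  have := intervalIntegral.intervalIntegrable_cpow' (a := 0) (b := 1) (r := w - 1) (by simpa using hw)
  rwa [intervalIntegrable_iff_integrableOn_Ioc_of_le zero_le_one] at this

theorem integral_cpow_unit {w : ℂ} (hw : 0 < w.re) :
    ∫ t : ℝ in Ioc 0 1, (t : ℂ) ^ (w - 1) = 1 / w := by
  rw [← intervalIntegral.integral_of_le zero_le_one, integral_cpow (Or.inl (by simpa using hw))]
  have : w ≠ 0 := by rintro rfl; simp at hw
  simp [Complex.zero_cpow this]

/-- The Mellin-type transform on `(0, 1]` of an absolutely convergent power series. -/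
theorem hasSum_integral_powerSeries {c : ℕ → ℂ} (hc : Summable fun n => ‖c n‖) {w : ℂ}
    (hw : 0 < w.re) :
    HasSum (fun n : ℕ => c n / (n + w))
      (∫ t : ℝ in Ioc 0 1, (∑' n : ℕ, c n * (t : ℂ) ^ n) * (t : ℂ) ^ (w - 1)) := by
  have hre : ∀ n : ℕ, 0 < ((n : ℂ) + w).re := fun n => by
    simp only [Complex.add_re, Complex.natCast_re]; positivity
  have heq : ∀ n : ℕ, EqOn (fun t : ℝ => c n * (t : ℂ) ^ n * (t : ℂ) ^ (w - 1))
      (fun t : ℝ => c n * (t : ℂ) ^ ((n : ℂ) + w - 1)) (Ioc 0 1) := by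
    intro n t ht
    have ht0 : (t : ℂ) ≠ 0 := by exact_mod_cast ht.1.ne'
    simp only
    rw [add_sub_assoc, Complex.cpow_add _ _ ht0, Complex.cpow_natCast, mul_assoc]
  have hint : ∀ n : ℕ, IntegrableOn (fun t : ℝ => c n * (t : ℂ) ^ n * (t : ℂ) ^ (w - 1))
      (Ioc 0 1) := fun n =>
    IntegrableOn.congr_fun ((integrableOn_cpow_unit (hre n)).const_mul (c n)) (heq n).symm
      measurableSet_Ioc
  have hbound : ∀ n : ℕ, ∫ t : ℝ in Ioc 0 1, ‖c n * (t : ℂ) ^ n * (t : ℂ) ^ (w - 1)‖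
      ≤ ‖c n‖ * ∫ t : ℝ in Ioc 0 1, ‖(t : ℂ) ^ (w - 1)‖ := by
    intro n
    rw [← integral_const_mul]
    refine setIntegral_mono_on (hint n).norm ((integrableOn_cpow_unit hw).norm.const_mul _)
      measurableSet_Ioc fun t ht => ?_
    rw [norm_mul, norm_mul]
    gcongr
    have : ‖(t : ℂ) ^ n‖ ≤ 1 := by
      rw [norm_pow, Complex.norm_real, Real.norm_of_nonneg ht.1.le]
      exact pow_le_one₀ ht.1.le ht.2
    nlinarith [norm_nonneg (c n)]
  have h := hasSum_integral_of_summable_integral_norm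
    (F := fun (n : ℕ) (t : ℝ) => c n * (t : ℂ) ^ n * (t : ℂ) ^ (w - 1)) hint
    (Summable.of_nonneg_of_le (fun n => integral_nonneg fun t => norm_nonneg _) hbound
      (hc.mul_right _))
  convert! h using 1
  · funext n
    rw [setIntegral_congr_fun measurableSet_Ioc (heq n), integral_const_mul,
      integral_cpow_unit (hre n), mul_one_div]
  · simp_rw [tsum_mul_right]

theorem isClosed_range_natCast_complex : IsClosed (range ((↑) : ℕ → ℂ)) :=
  Complex.isometry_ofReal.isClosedEmbedding.isClosedMap.comp
    Nat.isClosedEmbedding_coe_real.isClosedMap |>.isClosed_range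

/-- A sum of simple poles at the natural numbers is holomorphic elsewhere. -/
theorem differentiableOn_tsum_div_sub {c : ℕ → ℂ} (hc : Summable fun n => ‖c n‖) :
    DifferentiableOn ℂ (fun s => ∑' n : ℕ, c n / (n - s)) (range ((↑) : ℕ → ℂ))ᶜ := by
  intro s₀ hs₀
  obtain ⟨r, hr, hball⟩ := Metric.isOpen_iff.mp isClosed_range_natCast_complex.isOpen_compl s₀ hs₀
  have hlow : ∀ s ∈ Metric.ball s₀ (r / 2), ∀ n : ℕ, r / 2 ≤ ‖(n : ℂ) - s‖ := by
    intro s hs n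
    by_contra! h
    refine hball (a := (n : ℂ)) ?_ ⟨n, rfl⟩
    rw [Metric.mem_ball, dist_eq_norm] at hs ⊢
    calc ‖(n : ℂ) - s₀‖ = ‖((n : ℂ) - s) + (s - s₀)‖ := by ring_nf
      _ ≤ _ := norm_add_le _ _
      _ < r := by linarith
  refine ((Complex.differentiableOn_tsum_of_summable_norm (u := fun n => ‖c n‖ / (r / 2))
    (hc.div_const _) (fun n => ?_) Metric.isOpen_ball ?_).differentiableAt
      (Metric.ball_mem_nhds s₀ (half_pos hr))).differentiableWithinAt
  · refine (differentiableOn_const _).div (by fun_prop) fun s hs h => ?_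
    have := hlow s hs n
    rw [h, norm_zero] at this
    linarith
  · intro n s hs
    rw [norm_div]
    have := hlow s hs n
    gcongr

theorem isPreconnected_compl_of_countable {A : Set ℂ} (hA : A.Countable) : IsPreconnected Aᶜ :=
  (hA.isConnected_compl_of_one_lt_rank (by simp [Complex.rank_real_complex])).isPreconnected

/-- Identity theorem off the natural numbers. -/
theorem eqOn_compl_natCast {f g : ℂ → ℂ} (hf : DifferentiableOn ℂ f (range ((↑) : ℕ → ℂ))ᶜ)
    (hg : DifferentiableOn ℂ g (range ((↑) : ℕ → ℂ))ᶜ) {V : Set ℂ} (hV : IsOpen V)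
    {s₀ : ℂ} (hs₀ : s₀ ∈ V) (hs₀' : ∀ n : ℕ, s₀ ≠ n) (h : ∀ s ∈ V, f s = g s) :
    ∀ s : ℂ, (∀ n : ℕ, s ≠ n) → f s = g s := by
  have hopen := isClosed_range_natCast_complex.isOpen_compl
  have := (hf.analyticOnNhd hopen).eqOn_of_preconnected_of_eventuallyEq (hg.analyticOnNhd hopen)
    (isPreconnected_compl_of_countable (countable_range _)) (z₀ := s₀)
    (by rintro ⟨n, hn⟩; exact hs₀' n hn.symm)
    (by filter_upwards [hV.mem_nhds hs₀] with s hs using h s hs)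
  intro s hs
  exact this (by rintro ⟨n, hn⟩; exact hs n hn.symm)

/-- Only the tail of a series matters for uniform convergence. -/
theorem absUniformlyConvergesOn_of_eventually_le {P : Type*} {f : ℕ → P → ℂ} {A : Set P}
    {u : ℕ → ℝ} (hu : Summable u) (K₀ : ℕ) (h : ∀ k, K₀ ≤ k → ∀ p ∈ A, ‖f k p‖ ≤ u k) :
    AbsUniformlyConvergesOn f A := by
  have hs : ∀ p ∈ A, Summable fun k => ‖f k p‖ := by
    intro p hp
    refine (summable_nat_add_iff K₀).mp ?_
    refine Summable.of_nonneg_of_le (fun k => norm_nonneg _) (fun k => h _ (by omega) p hp)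
      ((summable_nat_add_iff K₀).mpr hu)
  refine ⟨hs, ?_⟩
  rw [Metric.tendstoUniformlyOn_iff]
  intro ε hε
  have htail := (tendsto_sum_nat_add u).eventually (gt_mem_nhds hε)
  filter_upwards [htail, eventually_ge_atTop K₀] with N hN hK p hp
  rw [← (hs p hp).sum_add_tsum_nat_add N, Real.dist_eq, add_sub_cancel_left,
    abs_of_nonneg (tsum_nonneg fun k => norm_nonneg _)]
  refine lt_of_le_of_lt (Summable.tsum_le_tsum (fun k => h _ (by omega) p hp)
    ((summable_nat_add_iff N).mpr (hs p hp)) ((summable_nat_add_iff N).mpr hu)) hN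

/-! ### Incomplete Gamma functions on the closed right half plane. -/

/-- `x ^ (-s) * Γ(-s, x)` written as a Laplace integral. -/
noncomputable def scaledUpperGamma (s x : ℂ) : ℂ :=
  Complex.exp (-x) / x * ∫ u : ℝ in Ioi 0, Complex.exp (-u) * (1 + u / x) ^ (-s - 1)

/-- `x ^ (-s) * γ(-s, x)` as a power series in `x`. -/
noncomputable def scaledLowerGamma (s x : ℂ) : ℂ :=
  ∑' n : ℕ, (-x) ^ n / n.factorial / (n - s)

/-- The real part of `u / x` is `u · re x / |x|²`. Hence the base of the power stays off the cut
even for `x` on the imaginary axis, which is where the theorem needs it. -/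
theorem one_le_re_one_add_div {x : ℂ} (hx : 0 ≤ x.re) {u : ℝ} (hu : 0 ≤ u) :
    1 ≤ (1 + u / x : ℂ).re := by
  have : 0 ≤ ((u : ℂ) / x).re := by
    rw [Complex.div_re]
    simp only [Complex.ofReal_re, Complex.ofReal_im, zero_mul, zero_div, add_zero]
    have := Complex.normSq_nonneg x
    positivity
  simpa using this

/-- The modulus is `|v| ^ (-re s - 1) · exp(arg v · im s)` for `v = 1 + u / x`. As `|v| ≥ 1`, the
exponent may be raised to a natural number `M`, which makes the bound uniform in `s` and `x`. -/
theorem norm_one_add_div_cpow_le {x s : ℂ} (hx : 0 ≤ x.re) {r S : ℝ} (hr : 0 < r) (hxr : r ≤ ‖x‖)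
    {M : ℕ} (hM : -s.re - 1 ≤ M) (hS : |s.im| ≤ S) {u : ℝ} (hu : 0 ≤ u) :
    ‖(1 + u / x : ℂ) ^ (-s - 1)‖ ≤ Real.exp (Real.pi * S) * (1 + u / r) ^ M := by
  have hv := one_le_re_one_add_div hx hu
  set v : ℂ := 1 + u / x with hvdef
  have hv1 : 1 ≤ ‖v‖ := hv.trans (Complex.re_le_norm v)
  have hv0 : v ≠ 0 := by
    intro h; rw [h] at hv; simp at hv; linarith
  have hv2 : ‖v‖ ≤ 1 + u / r := by
    refine (norm_add_le _ _).trans ?_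
    rw [norm_one, norm_div, Complex.norm_real, Real.norm_of_nonneg hu]
    gcongr
  rw [Complex.norm_cpow_of_ne_zero hv0, div_eq_mul_inv, ← Real.exp_neg, mul_comm]
  have h1 : ‖v‖ ^ (-s - 1).re ≤ (1 + u / r) ^ M := by
    calc ‖v‖ ^ (-s - 1).re ≤ ‖v‖ ^ (M : ℝ) :=
          Real.rpow_le_rpow_of_exponent_le hv1 (by simpa using hM)
      _ = ‖v‖ ^ M := Real.rpow_natCast _ _
      _ ≤ _ := by gcongr
  have h2 : -(v.arg * (-s - 1).im) ≤ Real.pi * S := by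
    have e : -(v.arg * (-s - 1).im) = v.arg * s.im := by simp
    rw [e]
    calc v.arg * s.im ≤ |v.arg| * |s.im| := by rw [← abs_mul]; exact le_abs_self _
      _ ≤ _ := by
        have := Complex.abs_arg_le_pi v
        gcongr
  gcongr

theorem integrableOn_exp_neg_mul_pow (r : ℝ) (M : ℕ) :
    IntegrableOn (fun u : ℝ => Real.exp (-u) * (1 + u / r) ^ M) (Ioi 0) := by
  have h : ∀ k : ℕ, IntegrableOn (fun u : ℝ => Real.exp (-u) * u ^ k) (Ioi 0) := by
    intro k
    have := Real.GammaIntegral_convergent (s := k + 1) (by positivity)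
    simpa using this
  have e : (fun u : ℝ => Real.exp (-u) * (1 + u / r) ^ M) = fun u =>
      ∑ k ∈ Finset.range (M + 1), ((M.choose k : ℝ) / r ^ k) * (Real.exp (-u) * u ^ k) := by
    funext u
    rw [add_comm (1 : ℝ), add_pow, Finset.mul_sum]
    refine Finset.sum_congr rfl fun k _ => ?_
    rw [one_pow, div_pow]
    ring
  rw [e]
  exact integrable_finsetSum _ fun k _ => (h k).const_mul _

theorem norm_exp_neg_ofReal (u : ℝ) : ‖Complex.exp (-(u : ℂ))‖ = Real.exp (-u) := by
  rw [Complex.norm_exp]; simp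

/-- The dominating function for the Laplace integrand. -/
noncomputable def laplaceBound (S r : ℝ) (M : ℕ) (u : ℝ) : ℝ :=
  Real.exp (Real.pi * S) * (Real.exp (-u) * (1 + u / r) ^ M)

theorem integrableOn_laplaceBound (S r : ℝ) (M : ℕ) :
    IntegrableOn (laplaceBound S r M) (Ioi 0) :=
  (integrableOn_exp_neg_mul_pow r M).const_mul _

theorem norm_laplace_le {x s : ℂ} (hx : 0 ≤ x.re) {r S : ℝ} (hr : 0 < r) (hxr : r ≤ ‖x‖)
    {M : ℕ} (hM : -s.re - 1 ≤ M) (hS : |s.im| ≤ S) {u : ℝ} (hu : 0 ≤ u) :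
    ‖Complex.exp (-u) * (1 + u / x : ℂ) ^ (-s - 1)‖ ≤ laplaceBound S r M u := by
  rw [norm_mul, norm_exp_neg_ofReal, laplaceBound, mul_left_comm]
  exact mul_le_mul_of_nonneg_left (norm_one_add_div_cpow_le hx hr hxr hM hS hu)
    (Real.exp_nonneg _)

theorem one_add_div_mem_slitPlane {x : ℂ} (hx : 0 ≤ x.re) {u : ℝ} (hu : 0 ≤ u) :
    (1 + u / x : ℂ) ∈ Complex.slitPlane :=
  Or.inl (lt_of_lt_of_le one_pos (one_le_re_one_add_div hx hu))

theorem continuousOn_laplace {x : ℂ} (hx : 0 ≤ x.re) (s : ℂ) :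
    ContinuousOn (fun u : ℝ => Complex.exp (-u) * (1 + u / x : ℂ) ^ (-s - 1)) (Ioi 0) := by
  refine ContinuousOn.mul (by fun_prop) (ContinuousOn.cpow (by fun_prop) (by fun_prop) ?_)
  exact fun u hu => one_add_div_mem_slitPlane hx (le_of_lt hu)

theorem aestronglyMeasurable_laplace {x : ℂ} (hx : 0 ≤ x.re) (s : ℂ) :
    AEStronglyMeasurable (fun u : ℝ => Complex.exp (-u) * (1 + u / x : ℂ) ^ (-s - 1))
      (volume.restrict (Ioi 0)) :=
  (continuousOn_laplace hx s).aestronglyMeasurable measurableSet_Ioi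

/-- `exp (-x)` has modulus at most one in the half plane, so only the prefactor `1 / x` matters.
This decay supplies the second factor `1/k` in the estimate of the summands. -/
theorem norm_scaledUpperGamma_le {x s : ℂ} (hx : 0 ≤ x.re) {r S : ℝ} (hr : 0 < r) (hxr : r ≤ ‖x‖)
    {M : ℕ} (hM : -s.re - 1 ≤ M) (hS : |s.im| ≤ S) :
    ‖scaledUpperGamma s x‖ ≤ ‖x‖⁻¹ * ∫ u in Ioi 0, laplaceBound S r M u := by
  rw [scaledUpperGamma, norm_mul, norm_div, Complex.norm_exp]
  have h1 : Real.exp (-x).re / ‖x‖ ≤ ‖x‖⁻¹ := by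
    rw [div_eq_mul_inv]
    refine mul_le_of_le_one_left (by positivity) (Real.exp_le_one_iff.mpr (by simpa using hx))
  have h2 : ‖∫ u : ℝ in Ioi 0, Complex.exp (-u) * (1 + u / x : ℂ) ^ (-s - 1)‖ ≤
      ∫ u in Ioi 0, laplaceBound S r M u := by
    refine norm_integral_le_of_norm_le (integrableOn_laplaceBound S r M) ?_
    filter_upwards [ae_restrict_mem measurableSet_Ioi] with u hu
    exact norm_laplace_le hx hr hxr hM hS (le_of_lt hu)
  gcongr

/-- Every `s` has a neighbourhood on which a single `laplaceBound` serves as dominating function. -/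
theorem exists_nat_bound_region (s : ℂ) : ∃ (S : ℝ) (M : ℕ),
    s ∈ {z : ℂ | -z.re - 1 < M ∧ |z.im| < S} ∧ IsOpen {z : ℂ | -z.re - 1 < M ∧ |z.im| < S} := by
  obtain ⟨M, hM⟩ := exists_nat_gt (-s.re - 1)
  refine ⟨|s.im| + 1, M, ⟨hM, by linarith⟩, ?_⟩
  exact (isOpen_lt (by fun_prop) (by fun_prop)).and (isOpen_lt (by fun_prop) (by fun_prop))

/-- The Laplace integral converges for every `s`, without poles; the singularities of the summands
are removable for this reason. -/
theorem differentiable_scaledUpperGamma {x : ℂ} (hx : 0 ≤ x.re) (hx0 : x ≠ 0) :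
    Differentiable ℂ fun s => scaledUpperGamma s x := by
  intro s₀
  refine DifferentiableAt.const_mul ?_ _
  obtain ⟨S, M, hs, hopen⟩ := exists_nat_bound_region s₀
  refine (differentiableOn_integral_of_dominated hopen (bound := laplaceBound S ‖x‖ M)
    (fun z _ => aestronglyMeasurable_laplace hx z) ?_ ?_
    (integrableOn_laplaceBound _ _ _)).differentiableAt (hopen.mem_nhds hs)
  · filter_upwards [ae_restrict_mem measurableSet_Ioi] with u hu z _
    have := Complex.slitPlane_ne_zero (one_add_div_mem_slitPlane hx (le_of_lt hu))
    refine DifferentiableAt.differentiableWithinAt ?_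
    exact (DifferentiableAt.const_cpow (by fun_prop) (Or.inl this)).const_mul _
  · filter_upwards [ae_restrict_mem measurableSet_Ioi] with u hu z hz
    exact norm_laplace_le hx (norm_pos_iff.mpr hx0) le_rfl hz.1.le hz.2.le (le_of_lt hu)

/-- Continuity up to the imaginary axis allows identities to pass from the open half plane to its
boundary. -/
theorem continuousOn_scaledUpperGamma (s : ℂ) :
    ContinuousOn (fun x => scaledUpperGamma s x) {x | 0 ≤ x.re ∧ x ≠ 0} := by
  refine ContinuousOn.mul (ContinuousOn.div (by fun_prop) (by fun_prop) fun x hx => hx.2) ?_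
  intro x₀ hx₀
  have hr : 0 < ‖x₀‖ / 2 := by have := norm_pos_iff.mpr hx₀.2; positivity
  obtain ⟨M, hM⟩ := exists_nat_ge (-s.re - 1)
  refine continuousWithinAt_of_dominated (bound := laplaceBound |s.im| (‖x₀‖ / 2) M) ?_ ?_
    (integrableOn_laplaceBound _ _ _) ?_
  · filter_upwards [self_mem_nhdsWithin] with x hx using aestronglyMeasurable_laplace hx.1 s
  · have hev : ∀ᶠ x in 𝓝[{x : ℂ | 0 ≤ x.re ∧ x ≠ 0}] x₀, ‖x₀‖ / 2 < ‖x‖ :=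
      (continuous_norm.tendsto x₀).eventually (lt_mem_nhds (by linarith)) |>.filter_mono
        nhdsWithin_le_nhds
    filter_upwards [self_mem_nhdsWithin, hev] with x hx hxr
    filter_upwards [ae_restrict_mem measurableSet_Ioi] with u hu
    exact norm_laplace_le hx.1 hr hxr.le hM le_rfl (le_of_lt hu)
  · filter_upwards [ae_restrict_mem measurableSet_Ioi] with u hu
    refine ContinuousAt.continuousWithinAt ?_
    refine continuousAt_const.mul (ContinuousAt.cpow ?_ continuousAt_const
      (one_add_div_mem_slitPlane hx₀.1 (le_of_lt hu)))
    exact continuousAt_const.add (continuousAt_const.div continuousAt_id hx₀.2)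

theorem differentiableOn_scaledUpperGamma_right (s : ℂ) :
    DifferentiableOn ℂ (fun x => scaledUpperGamma s x) {x | 0 < x.re} := by
  intro x₀ hx₀
  have hne : ∀ x : ℂ, 0 < x.re → x ≠ 0 := by rintro x hx rfl; simp at hx
  have hr : 0 < ‖x₀‖ / 2 := by have := norm_pos_iff.mpr (hne x₀ hx₀); positivity
  obtain ⟨M, hM⟩ := exists_nat_ge (-s.re - 1)
  have hopen : IsOpen {x : ℂ | 0 < x.re ∧ ‖x₀‖ / 2 < ‖x‖} :=
    (isOpen_lt (by fun_prop) (by fun_prop)).and (isOpen_lt (by fun_prop) (by fun_prop))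
  have hmem : x₀ ∈ {x : ℂ | 0 < x.re ∧ ‖x₀‖ / 2 < ‖x‖} := ⟨hx₀, by linarith⟩
  refine DifferentiableAt.differentiableWithinAt ?_
  refine DifferentiableAt.mul (DifferentiableAt.div (by fun_prop) (by fun_prop) (hne _ hx₀)) ?_
  refine (differentiableOn_integral_of_dominated hopen
    (bound := laplaceBound |s.im| (‖x₀‖ / 2) M)
    (fun x hx => aestronglyMeasurable_laplace hx.1.le s) ?_ ?_
    (integrableOn_laplaceBound _ _ _)).differentiableAt (hopen.mem_nhds hmem)
  · filter_upwards [ae_restrict_mem measurableSet_Ioi] with u hu x hx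
    refine DifferentiableAt.differentiableWithinAt ?_
    refine (DifferentiableAt.cpow (f := fun x : ℂ => 1 + u / x) ?_ (differentiableAt_const _)
      (one_add_div_mem_slitPlane (le_of_lt hx.1) (le_of_lt hu))).const_mul _
    exact (differentiableAt_const _).add
      ((differentiableAt_const _).div differentiableAt_id (hne _ hx.1))
  · filter_upwards [ae_restrict_mem measurableSet_Ioi] with u hu x hx
    exact norm_laplace_le hx.1.le hr hx.2.le hM le_rfl (le_of_lt hu)

theorem summable_norm_exp_coeff (x : ℂ) : Summable fun n : ℕ => ‖(-x) ^ n / n.factorial‖ := by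
  have := Real.summable_pow_div_factorial ‖x‖
  simpa using this

theorem differentiableOn_scaledLowerGamma (x : ℂ) :
    DifferentiableOn ℂ (fun s => scaledLowerGamma s x) (range ((↑) : ℕ → ℂ))ᶜ :=
  differentiableOn_tsum_div_sub (summable_norm_exp_coeff x)

theorem scaledLowerGamma_eq_integral {s : ℂ} (hs : s.re < 0) (x : ℂ) :
    scaledLowerGamma s x = ∫ t : ℝ in Ioc 0 1, Complex.exp (-x * t) * (t : ℂ) ^ (-s - 1) := by
  have h := (hasSum_integral_powerSeries (summable_norm_exp_coeff x) (w := -s)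
    (by simpa using hs)).tsum_eq
  simp only [← sub_eq_add_neg] at h
  rw [scaledLowerGamma, h]
  refine setIntegral_congr_fun measurableSet_Ioc fun t _ => ?_
  congr 1
  rw [Complex.exp_eq_exp_ℂ, NormedSpace.exp_eq_tsum_div]
  refine tsum_congr fun n => ?_
  rw [mul_pow]
  ring

theorem differentiableOn_scaledLowerGamma_right {s : ℂ} (hs : s.re < 0) :
    DifferentiableOn ℂ (fun x => scaledLowerGamma s x) univ := by
  simp_rw [scaledLowerGamma_eq_integral hs]
  intro x₀ _
  have hw := integrableOn_cpow_unit (w := -s) (by simpa using hs)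
  have hmem : x₀ ∈ Metric.ball (0 : ℂ) (‖x₀‖ + 1) := by simp
  refine DifferentiableAt.differentiableWithinAt ?_
  refine (differentiableOn_integral_of_dominated (Metric.isOpen_ball (x := (0 : ℂ))
    (ε := ‖x₀‖ + 1)) (bound := fun t : ℝ => Real.exp (‖x₀‖ + 1) * ‖(t : ℂ) ^ (-s - 1)‖)
    (fun x _ => ?_) ?_ ?_ (hw.norm.const_mul _)).differentiableAt
      (Metric.isOpen_ball.mem_nhds hmem)
  · exact AEStronglyMeasurable.mul
      (Continuous.aestronglyMeasurable (by fun_prop)) hw.aestronglyMeasurable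
  · exact Eventually.of_forall fun t => by fun_prop
  · filter_upwards [ae_restrict_mem measurableSet_Ioc] with t ht x hx
    rw [norm_mul, Complex.norm_exp]
    have hx' : ‖x‖ < ‖x₀‖ + 1 := by simpa using hx
    have : (-x * t).re ≤ ‖x₀‖ + 1 := by
      refine (Complex.re_le_norm _).trans ?_
      rw [norm_mul, norm_neg, Complex.norm_real, Real.norm_of_nonneg ht.1.le]
      nlinarith [ht.1, ht.2, norm_nonneg x]
    gcongr

/-- The substitution `u = x (t - 1)`. The resulting integral over `(1, ∞)` complements the one over
`(0, 1]` for `scaledLowerGamma`. -/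
theorem scaledUpperGamma_ofReal (s : ℂ) {x : ℝ} (hx : 0 < x) :
    scaledUpperGamma s x = ∫ t : ℝ in Ioi 1, Complex.exp (-x * t) * (t : ℂ) ^ (-s - 1) := by
  have h1 := integral_comp_mul_left_Ioi
    (fun u : ℝ => Complex.exp (-u) * (1 + u / (x : ℂ)) ^ (-s - 1)) 0 hx
  have h2 : ∫ t : ℝ in Ioi 1, Complex.exp (-x * t) * (t : ℂ) ^ (-s - 1) =
      ∫ t : ℝ in Ioi 0, Complex.exp (-x * (t + 1 : ℝ)) * ((t + 1 : ℝ) : ℂ) ^ (-s - 1) := by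
    have h := (measurePreserving_add_right volume (1 : ℝ)).setIntegral_preimage_emb
      (measurableEmbedding_addRight 1)
      (fun t : ℝ => Complex.exp (-x * t) * (t : ℂ) ^ (-s - 1)) (Ioi 1)
    rw [← h, preimage_add_const_Ioi, sub_self]
  rw [h2, scaledUpperGamma]
  rw [mul_zero] at h1
  have hx' : (x : ℂ) ≠ 0 := by exact_mod_cast hx.ne'
  have h3 : ∫ u : ℝ in Ioi 0, Complex.exp (-u) * (1 + u / (x : ℂ)) ^ (-s - 1) =
      x * ∫ u : ℝ in Ioi 0, Complex.exp (-(x * u : ℝ)) *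
        (1 + (x * u : ℝ) / (x : ℂ)) ^ (-s - 1) := by
    rw [h1, Complex.real_smul, Complex.ofReal_inv, mul_inv_cancel_left₀ hx']
  rw [h3, ← mul_assoc, div_mul_cancel₀ _ hx', ← integral_const_mul]
  refine setIntegral_congr_fun measurableSet_Ioi fun t _ => ?_
  rw [← mul_assoc, ← Complex.exp_add]
  congr 2
  · push_cast; ring
  · push_cast; field_simp; ring

theorem scaledLowerGamma_add_upper_ofReal {s : ℂ} (hs : s.re < 0) {x : ℝ} (hx : 0 < x) :
    scaledLowerGamma s x + scaledUpperGamma s x = Complex.Gamma (-s) * (x : ℂ) ^ s := by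
  have hx' : (x : ℂ) ≠ 0 := by exact_mod_cast hx.ne'
  have h := Complex.integral_cpow_mul_exp_neg_mul_Ioi (a := -s) (r := x)
    (by simpa using hs) (by simpa using hx)
  -- Integrability comes for free: the integral of a non-integrable function is zero by convention,
  -- but this one has a nonzero value.
  have hint : IntegrableOn (fun t : ℝ => (t : ℂ) ^ (-s - 1) * Complex.exp (-(x * t))) (Ioi 0) := by
    by_contra hcon
    rw [integral_undef hcon] at h
    refine (mul_ne_zero ?_ (Complex.Gamma_ne_zero_of_re_pos (by simpa using hs))) h.symm
    rw [Complex.cpow_ne_zero_iff]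
    exact Or.inl (one_div_ne_zero hx')
  rw [scaledLowerGamma_eq_integral hs, scaledUpperGamma_ofReal s hx,
    ← setIntegral_union (Ioc_disjoint_Ioi le_rfl) measurableSet_Ioi, Ioc_union_Ioi_eq_Ioi zero_le_one]
  · have e : (1 / (x : ℂ)) ^ (-s) = (x : ℂ) ^ s := by
      rw [one_div, Complex.inv_cpow, ← Complex.cpow_neg, neg_neg]
      rw [Complex.arg_ofReal_of_nonneg hx.le]
      exact Real.pi_pos.ne
    rw [← e, mul_comm (Complex.Gamma _), ← h]
    refine setIntegral_congr_fun measurableSet_Ioi fun t _ => ?_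
    rw [mul_comm, neg_mul]
  · refine (hint.mono_set Ioc_subset_Ioi_self).congr_fun (fun t _ => ?_) measurableSet_Ioc
    simp only
    rw [mul_comm, neg_mul]
  · refine (hint.mono_set (Ioi_subset_Ioi zero_le_one)).congr_fun (fun t _ => ?_)
      measurableSet_Ioi
    simp only
    rw [mul_comm, neg_mul]

/-- Both sides are holomorphic in `x`, and they agree on the positive reals, which accumulate at
`1`. -/
theorem scaledLowerGamma_add_upper_of_re_pos {s : ℂ} (hs : s.re < 0) {x : ℂ} (hx : 0 < x.re) :
    scaledLowerGamma s x + scaledUpperGamma s x = Complex.Gamma (-s) * x ^ s := by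
  have hopen : IsOpen {x : ℂ | 0 < x.re} := isOpen_lt (by fun_prop) (by fun_prop)
  have hL : DifferentiableOn ℂ (fun x => scaledLowerGamma s x + scaledUpperGamma s x)
      {x : ℂ | 0 < x.re} :=
    ((differentiableOn_scaledLowerGamma_right hs).mono (subset_univ _)).add
      (differentiableOn_scaledUpperGamma_right s)
  have hR : DifferentiableOn ℂ (fun x : ℂ => Complex.Gamma (-s) * x ^ s) {x : ℂ | 0 < x.re} := by
    intro x hx
    exact ((differentiableAt_id.cpow (differentiableAt_const s)
      (Or.inl hx)).const_mul _).differentiableWithinAt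
  refine (hL.analyticOnNhd hopen).eqOn_of_preconnected_of_frequently_eq (hR.analyticOnNhd hopen)
    (convex_halfSpace_re_gt 0).isPreconnected (z₀ := 1) (by simp) ?_ hx
  have ht : Tendsto (fun n : ℕ => ((1 + 1 / ((n : ℝ) + 1) : ℝ) : ℂ)) atTop (𝓝[≠] 1) := by
    refine tendsto_nhdsWithin_iff.mpr ⟨?_, Eventually.of_forall fun n => ?_⟩
    · have := tendsto_one_div_add_atTop_nhds_zero_nat.const_add (1 : ℝ)
      have := (Complex.continuous_ofReal.tendsto _).comp this
      simpa [Function.comp_def] using this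
    · rw [mem_compl_iff, mem_singleton_iff, ← Complex.ofReal_one, Complex.ofReal_inj]
      have : 0 < 1 / ((n : ℝ) + 1) := by positivity
      linarith
  refine ht.frequently (Frequently.of_forall fun n => ?_)
  exact scaledLowerGamma_add_upper_ofReal hs (by positivity)

/-- `Γ(-s) = γ(-s, x) + Γ(-s, x)` in the closed right half plane. -/
theorem scaledLowerGamma_add_upper {s : ℂ} (hs : ∀ n : ℕ, s ≠ n) {x : ℂ} (hx : 0 ≤ x.re)
    (hx0 : x ≠ 0) :
    scaledLowerGamma s x + scaledUpperGamma s x = Complex.Gamma (-s) * x ^ s := by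
  have hslit : x ∈ Complex.slitPlane := by
    rcases hx.lt_or_eq with h | h
    · exact Or.inl h
    · refine Or.inr fun h' => hx0 (Complex.ext h.symm h')
  have hG : DifferentiableOn ℂ (fun s => Complex.Gamma (-s) * x ^ s) (range ((↑) : ℕ → ℂ))ᶜ := by
    intro s hs
    refine DifferentiableAt.differentiableWithinAt (DifferentiableAt.mul ?_ ?_)
    · refine DifferentiableAt.comp (g := Complex.Gamma) s
        (Complex.differentiableAt_Gamma _ fun m h => hs ⟨m, ?_⟩) differentiableAt_id.neg
      simpa using (neg_injective h).symm
    · exact DifferentiableAt.const_cpow differentiableAt_id (Or.inl hx0)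
  -- With `x` fixed, the identity is continued in `s` from `re s < 0`; there, continuity in `x`
  -- covers the boundary of the half plane.
  refine eqOn_compl_natCast ((differentiableOn_scaledLowerGamma x).add
    (differentiable_scaledUpperGamma hx hx0).differentiableOn) hG (V := {s : ℂ | s.re < 0})
    (isOpen_lt (by fun_prop) (by fun_prop)) (s₀ := -1) (by simp) (fun n h => ?_) ?_ s hs
  · have := congrArg Complex.re h
    simp at this
    linarith [(Nat.cast_nonneg n : (0 : ℝ) ≤ n)]
  · intro s hs
    set A : Set ℂ := {x : ℂ | 0 ≤ x.re ∧ x ≠ 0}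
    have hL : ContinuousWithinAt (fun x => scaledLowerGamma s x + scaledUpperGamma s x) A x :=
      (((differentiableOn_scaledLowerGamma_right hs).continuousOn.mono (subset_univ _)).add
        (continuousOn_scaledUpperGamma s)) x ⟨hx, hx0⟩
    have hR : ContinuousWithinAt (fun x : ℂ => Complex.Gamma (-s) * x ^ s) A x :=
      (continuousAt_const.mul (continuousAt_id.cpow continuousAt_const hslit)).continuousWithinAt
    have hB : {x : ℂ | 0 < x.re} ⊆ A := fun y hy =>
      ⟨le_of_lt hy, by rintro rfl; simp at hy⟩
    have : (𝓝[{x : ℂ | 0 < x.re}] x).NeBot := by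
      rw [← mem_closure_iff_nhdsWithin_neBot, Complex.closure_setOfPred_lt_re]
      exact hx
    refine tendsto_nhds_unique (hL.mono hB) ((hR.mono hB).congr' ?_)
    filter_upwards [self_mem_nhdsWithin] with y hy
    exact (scaledLowerGamma_add_upper_of_re_pos hs hy).symm

/-! ### The ₁F₂ terms as lower incomplete Gamma functions. -/

theorem ascPochhammer_eval_mul_add (α : ℂ) (m : ℕ) :
    (ascPochhammer ℂ m).eval α * (α + m) = α * (ascPochhammer ℂ m).eval (α + 1) := by
  induction m with
  | zero => simp
  | succ m ih =>
    rw [ascPochhammer_succ_eval, ascPochhammer_succ_eval]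
    push_cast
    linear_combination (α + (m + 1)) * ih

theorem ascPochhammer_eval_ne_zero {α : ℂ} (h : ∀ n : ℕ, α ≠ -n) (m : ℕ) :
    (ascPochhammer ℂ m).eval α ≠ 0 := by
  induction m with
  | zero => simp
  | succ m ih =>
    rw [ascPochhammer_succ_eval]
    refine mul_ne_zero ih fun h' => h m ?_
    linear_combination h'

/-- Consecutive parameters telescope. In the ₁F₂ series this leaves one simple pole per coefficient.
-/
theorem ascPochhammer_eval_div {α : ℂ} (h : ∀ n : ℕ, α ≠ -n) (m : ℕ) :
    (ascPochhammer ℂ m).eval α / (ascPochhammer ℂ m).eval (α + 1) = α / (α + m) := by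
  have h1 : (ascPochhammer ℂ m).eval (α + 1) ≠ 0 := by
    refine ascPochhammer_eval_ne_zero (fun n hn => h (n + 1) ?_) m
    push_cast
    linear_combination hn
  have h2 : α + m ≠ 0 := fun h' => h m (by linear_combination h')
  rw [div_eq_div_iff h1 h2]
  exact ascPochhammer_eval_mul_add α m

theorem ascPochhammer_eval_half (m : ℕ) :
    (ascPochhammer ℂ m).eval (1 / 2) * m.factorial * 4 ^ m = (2 * m).factorial := by
  induction m with
  | zero => simp
  | succ m ih =>
    rw [ascPochhammer_succ_eval, show 2 * (m + 1) = 2 * m + 1 + 1 by ring, Nat.factorial_succ (2 * m + 1),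
      Nat.factorial_succ (2 * m), Nat.factorial_succ m]
    push_cast
    rw [← ih]
    ring

theorem ascPochhammer_eval_three_half (m : ℕ) :
    (ascPochhammer ℂ m).eval (3 / 2) * m.factorial * 4 ^ m = (2 * m + 1).factorial := by
  induction m with
  | zero => simp
  | succ m ih =>
    rw [ascPochhammer_succ_eval, show 2 * (m + 1) + 1 = 2 * m + 1 + 1 + 1 by ring,
      Nat.factorial_succ (2 * m + 1 + 1), Nat.factorial_succ (2 * m + 1), Nat.factorial_succ m]
    push_cast
    rw [← ih]
    ring

theorem summable_scaledLowerGamma (s x : ℂ) :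
    Summable fun n : ℕ => (-x) ^ n / n.factorial / (n - s) := by
  obtain ⟨N, hN⟩ := exists_nat_ge (‖s‖ + 1)
  refine Summable.of_norm_bounded_eventually_nat (summable_norm_exp_coeff x) ?_
  filter_upwards [eventually_ge_atTop N] with n hn
  rw [norm_div]
  refine div_le_self (norm_nonneg _) ?_
  have h1 : ‖(n : ℂ)‖ - ‖s‖ ≤ ‖(n : ℂ) - s‖ := norm_sub_norm_le _ _
  rw [Complex.norm_natCast] at h1
  have : (N : ℝ) ≤ n := by exact_mod_cast hn
  linarith

/-- The even part of the power series of the lower incomplete Gamma function on the imaginary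
axis. -/
noncomputable def cosSeries (s l : ℂ) : ℂ :=
  ∑' m : ℕ, (-l ^ 2) ^ m / (2 * m).factorial / (2 * m - s)

/-- The odd part of the power series of the lower incomplete Gamma function on the imaginary
axis. -/
noncomputable def sinSeries (s l : ℂ) : ℂ :=
  ∑' m : ℕ, l * (-l ^ 2) ^ m / (2 * m + 1).factorial / (2 * m + 1 - s)

/-- The power series is split by the parity of the index, with `I² = -1`. -/
theorem scaledLowerGamma_imaginary (s l : ℂ) :
    scaledLowerGamma s (-(Complex.I * l)) = cosSeries s l + Complex.I * sinSeries s l := by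
  have hs := summable_scaledLowerGamma s (-(Complex.I * l))
  simp only [neg_neg] at hs
  have he : ∀ m : ℕ, (Complex.I * l) ^ (2 * m) / (2 * m).factorial / ((2 * m : ℕ) - s) =
      (-l ^ 2) ^ m / (2 * m).factorial / (2 * m - s) := by
    intro m
    rw [pow_mul, mul_pow, Complex.I_sq, neg_one_mul, Nat.cast_mul, Nat.cast_ofNat]
  have ho : ∀ m : ℕ, (Complex.I * l) ^ (2 * m + 1) / (2 * m + 1).factorial /
      ((2 * m + 1 : ℕ) - s) =
      Complex.I * (l * (-l ^ 2) ^ m / (2 * m + 1).factorial / (2 * m + 1 - s)) := by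
    intro m
    rw [pow_succ, pow_mul, mul_pow, Complex.I_sq, neg_one_mul, Nat.cast_add, Nat.cast_mul,
      Nat.cast_ofNat, Nat.cast_one]
    ring
  have h1 : Summable fun m : ℕ => (Complex.I * l) ^ (2 * m) / (2 * m).factorial /
      ((2 * m : ℕ) - s) := hs.comp_injective (i := fun m => 2 * m) fun a b h => by simpa using h
  have h2 : Summable fun m : ℕ => (Complex.I * l) ^ (2 * m + 1) / (2 * m + 1).factorial /
      ((2 * m + 1 : ℕ) - s) :=
    hs.comp_injective (i := fun m => 2 * m + 1) fun a b h => by simpa using h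
  have h := tsum_even_add_odd (f := fun n : ℕ => (Complex.I * l) ^ n / n.factorial / (n - s)) h1 h2
  rw [scaledLowerGamma, cosSeries, sinSeries, ← tsum_mul_left]
  simp only [neg_neg]
  rw [← h, tsum_congr he, tsum_congr ho]

theorem scaledLowerGamma_imaginary' (s l : ℂ) :
    scaledLowerGamma s (Complex.I * l) = cosSeries s l - Complex.I * sinSeries s l := by
  have h := scaledLowerGamma_imaginary s (-l)
  have h1 : cosSeries s (-l) = cosSeries s l := by simp [cosSeries]
  have h2 : sinSeries s (-l) = -sinSeries s l := by
    rw [sinSeries, sinSeries, ← tsum_neg]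
    refine tsum_congr fun m => ?_
    rw [neg_sq]
    ring
  rw [h1, h2] at h
  rw [mul_neg, neg_neg] at h
  rw [h]
  ring

/-- The parameters `-s/2` and `1 - s/2` differ by one, so their symbols leave the quotient `-s / (2m
- s)`. The identity `(1/2)_m · m! · 4^m = (2m)!` turns the rest into cosine coefficients. -/
theorem hyp1F2_eq_cosSeries {s : ℂ} (hs : ∀ n : ℕ, s ≠ n) (l : ℂ) :
    hyp1F2 (-s / 2) (1 / 2) (1 - s / 2) (-(l / 2) ^ 2) = -s * cosSeries s l := by
  rw [hyp1F2, cosSeries, ← tsum_mul_left]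
  refine tsum_congr fun m => ?_
  have hα : ∀ n : ℕ, -s / 2 ≠ -n := fun n h => hs (2 * n) (by push_cast; linear_combination -2 * h)
  have h1 := ascPochhammer_eval_div hα m
  rw [show -s / 2 + 1 = 1 - s / 2 by ring] at h1
  have h2 := ascPochhammer_eval_half m
  have h3 : (m.factorial : ℂ) ≠ 0 := by exact_mod_cast m.factorial_ne_zero
  have h4 : (ascPochhammer ℂ m).eval (1 / 2 : ℂ) ≠ 0 := by
    intro h; rw [h, zero_mul, zero_mul] at h2
    exact (2 * m).factorial_ne_zero (by exact_mod_cast h2.symm)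
  have h5 : (2 * m - s : ℂ) ≠ 0 := fun h => hs (2 * m) (by push_cast; linear_combination -h)
  rw [mul_comm (Polynomial.eval (1 / 2) _) (Polynomial.eval _ _), ← div_div, h1, ← h2]
  have h6 : -s / 2 + (m : ℂ) = (2 * m - s) / 2 := by ring
  have h7 : (-(l / 2) ^ 2) ^ m = (-l ^ 2) ^ m / 4 ^ m := by
    rw [← div_pow]; congr 1; ring
  rw [h6, h7]
  field_simp

theorem hyp1F2_eq_sinSeries {s : ℂ} (hs : ∀ n : ℕ, s ≠ n) (l : ℂ) :
    l * hyp1F2 ((1 - s) / 2) (3 / 2) (1 + (1 - s) / 2) (-(l / 2) ^ 2) =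
      (1 - s) * sinSeries s l := by
  rw [hyp1F2, sinSeries, ← tsum_mul_left, ← tsum_mul_left]
  refine tsum_congr fun m => ?_
  have hα : ∀ n : ℕ, (1 - s) / 2 ≠ -n := fun n h =>
    hs (2 * n + 1) (by push_cast; linear_combination -2 * h)
  have h1 := ascPochhammer_eval_div hα m
  rw [show (1 - s) / 2 + 1 = 1 + (1 - s) / 2 by ring] at h1
  have h2 := ascPochhammer_eval_three_half m
  have h3 : (m.factorial : ℂ) ≠ 0 := by exact_mod_cast m.factorial_ne_zero
  have h4 : (ascPochhammer ℂ m).eval (3 / 2 : ℂ) ≠ 0 := by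
    intro h; rw [h, zero_mul, zero_mul] at h2
    exact (2 * m + 1).factorial_ne_zero (by exact_mod_cast h2.symm)
  have h5 : (2 * m + 1 - s : ℂ) ≠ 0 := fun h =>
    hs (2 * m + 1) (by push_cast; linear_combination -h)
  rw [mul_comm (Polynomial.eval (3 / 2) _) (Polynomial.eval _ _), ← div_div, h1, ← h2]
  have h6 : (1 - s) / 2 + (m : ℂ) = (2 * m + 1 - s) / 2 := by ring
  have h7 : (-(l / 2) ^ 2) ^ m = (-l ^ 2) ^ m / 4 ^ m := by
    rw [← div_pow]; congr 1; ring
  rw [h6, h7]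
  field_simp

/-- With the cosine and sine of `2πbk` written in exponentials, the even and odd series recombine
into values of `scaledLowerGamma` at two conjugate imaginary points. -/
theorem hypTerm_eq_scaledLowerGamma {s : ℂ} (hs : ∀ n : ℕ, s ≠ n) {a : ℝ} (ha : a ≠ 0) (b : ℝ)
    {k : ℕ} (hk : 1 ≤ k) :
    hypTerm a b 1 k s = -(1 / (2 * k)) *
      (Complex.exp (2 * Real.pi * b * k * Complex.I) *
          scaledLowerGamma s (-(Complex.I * (2 * Real.pi * k * a))) +
        Complex.exp (-(2 * Real.pi * b * k * Complex.I)) *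
          scaledLowerGamma s (Complex.I * (2 * Real.pi * k * a))) := by
  have hk0 : (k : ℂ) ≠ 0 := by exact_mod_cast (by omega : k ≠ 0)
  have ha0 : (a : ℂ) ≠ 0 := by exact_mod_cast ha
  have hpi : (Real.pi : ℂ) ≠ 0 := by exact_mod_cast Real.pi_ne_zero
  have hs0 : s ≠ 0 := by simpa using hs 0
  have hs1 : 1 - s ≠ 0 := fun h => hs 1 (by push_cast; linear_combination -h)
  set l : ℂ := 2 * Real.pi * k * a with hl
  have hl0 : l ≠ 0 := by simp [hl, hk0, ha0, hpi]
  rw [scaledLowerGamma_imaginary, scaledLowerGamma_imaginary', hypTerm]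
  have harg : ((-(Real.pi ^ 2 * a ^ 2 * 1 ^ 2 * k ^ 2) : ℝ) : ℂ) = -(l / 2) ^ 2 := by
    rw [hl]; push_cast; ring
  rw [harg, hyp1F2_eq_cosSeries hs]
  have h2 := hyp1F2_eq_sinSeries hs l
  set hyp := hyp1F2 ((1 - s) / 2) (3 / 2) (1 + (1 - s) / 2) (-(l / 2) ^ 2)
  have h3 : hyp = (1 - s) * sinSeries s l / l := by rw [← h2]; field_simp
  rw [h3]
  have hc : (Real.cos (2 * Real.pi * b * k) : ℂ) = (Complex.exp (2 * Real.pi * b * k * Complex.I) +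
      Complex.exp (-(2 * Real.pi * b * k * Complex.I))) / 2 := by
    rw [Complex.ofReal_cos, Complex.cos]; push_cast; ring_nf
  have hsn : (Real.sin (2 * Real.pi * b * k) : ℂ) =
      (Complex.exp (-(2 * Real.pi * b * k * Complex.I)) -
      Complex.exp (2 * Real.pi * b * k * Complex.I)) * Complex.I / 2 := by
    rw [Complex.ofReal_sin, Complex.sin]; push_cast; ring_nf
  rw [hc, hsn]
  set e₁ := Complex.exp (2 * Real.pi * b * k * Complex.I)
  set e₂ := Complex.exp (-(2 * Real.pi * b * k * Complex.I))
  simp only [Complex.ofReal_one, Complex.one_cpow]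
  have h5 : (2 * Real.pi * a : ℂ) = l / k := by rw [hl]; field_simp
  rw [h5]
  field_simp
  ring

/-! ### The entire extension of the summands and its size. -/

theorem ofReal_mul_cpow {r : ℝ} (hr : 0 < r) (z s : ℂ) :
    (r * z) ^ s = (r : ℂ) ^ s * z ^ s := by
  rcases eq_or_ne z 0 with rfl | hz
  · rcases eq_or_ne s 0 with rfl | hs
    · simp
    · simp [Complex.zero_cpow hs]
  · have hr' : (r : ℂ) ≠ 0 := by exact_mod_cast hr.ne'
    rw [Complex.cpow_def_of_ne_zero (mul_ne_zero hr' hz), Complex.cpow_def_of_ne_zero hr',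
      Complex.cpow_def_of_ne_zero hz, Complex.log_ofReal_mul hr hz, ← Complex.exp_add,
      Complex.ofReal_log hr.le, add_mul]

theorem gammaTerm_eq (a b : ℝ) {k : ℕ} (hk : 1 ≤ k) (s : ℂ) :
    gammaTerm a b k s = 1 / (2 * k) *
      (Complex.exp (2 * Real.pi * b * k * Complex.I) *
          (Complex.Gamma (-s) * (-(Complex.I * (2 * Real.pi * k * a))) ^ s) +
        Complex.exp (-(2 * Real.pi * b * k * Complex.I)) *
          (Complex.Gamma (-s) * (Complex.I * (2 * Real.pi * k * a)) ^ s)) := by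
  have hk' : (0 : ℝ) < k := by exact_mod_cast hk
  have hk0 : (k : ℂ) ≠ 0 := by exact_mod_cast hk'.ne'
  have h : ∀ z : ℂ, (2 * Real.pi * k * z) ^ s = (k : ℂ) ^ s * (2 * Real.pi) ^ s * z ^ s := by
    intro z
    have e : (2 * Real.pi * k * z : ℂ) = (k : ℝ) * ((2 * Real.pi : ℝ) * z) := by push_cast; ring
    rw [e, ofReal_mul_cpow hk', ofReal_mul_cpow (by positivity)]
    push_cast
    ring
  have e₁ : (-(Complex.I * (2 * Real.pi * k * a)) : ℂ) = 2 * Real.pi * k * (-Complex.I * a) := by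
    ring
  have e₂ : (Complex.I * (2 * Real.pi * k * a) : ℂ) = 2 * Real.pi * k * (Complex.I * a) := by ring
  rw [e₁, e₂, h, h, gammaTerm, Complex.cpow_sub _ _ hk0, Complex.cpow_one]
  field_simp

/-- The entire extension of the sum of the two parts of the `k`-th summand, for `d = 1`. -/
noncomputable def entireTerm (a b : ℝ) (k : ℕ) (s : ℂ) : ℂ :=
  1 / (2 * k) * (Complex.exp (2 * Real.pi * b * k * Complex.I) *
      scaledUpperGamma s (-(Complex.I * (2 * Real.pi * k * a))) +
    Complex.exp (-(2 * Real.pi * b * k * Complex.I)) *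
      scaledUpperGamma s (Complex.I * (2 * Real.pi * k * a)))

/-- The decomposition `Γ(-s) x^s = lower + upper` is applied at both imaginary points. The lower
parts cancel against the ₁F₂ terms. -/
theorem entireTerm_eq {s : ℂ} (hs : ∀ n : ℕ, s ≠ n) {a : ℝ} (ha : a ≠ 0) (b : ℝ)
    {k : ℕ} (hk : 1 ≤ k) :
    entireTerm a b k s = hypTerm a b 1 k s + gammaTerm a b k s := by
  have hk0 : (k : ℂ) ≠ 0 := by exact_mod_cast (by omega : k ≠ 0)
  have ha0 : (a : ℂ) ≠ 0 := by exact_mod_cast ha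
  have hpi : (Real.pi : ℂ) ≠ 0 := by exact_mod_cast Real.pi_ne_zero
  have h1 := scaledLowerGamma_add_upper hs (x := -(Complex.I * (2 * Real.pi * k * a)))
    (by simp) (by simp [hk0, ha0, hpi])
  have h2 := scaledLowerGamma_add_upper hs (x := Complex.I * (2 * Real.pi * k * a))
    (by simp) (by simp [hk0, ha0, hpi])
  rw [hypTerm_eq_scaledLowerGamma hs ha b hk, gammaTerm_eq a b hk, entireTerm, ← h1, ← h2]
  ring

theorem differentiable_entireTerm {a : ℝ} (ha : a ≠ 0) (b : ℝ) {k : ℕ} (hk : 1 ≤ k) :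
    Differentiable ℂ (entireTerm a b k) := by
  have hk0 : (k : ℂ) ≠ 0 := by exact_mod_cast (by omega : k ≠ 0)
  have ha0 : (a : ℂ) ≠ 0 := by exact_mod_cast ha
  have hpi : (Real.pi : ℂ) ≠ 0 := by exact_mod_cast Real.pi_ne_zero
  have h1 := differentiable_scaledUpperGamma (x := -(Complex.I * (2 * Real.pi * k * a)))
    (by simp) (by simp [hk0, ha0, hpi])
  have h2 := differentiable_scaledUpperGamma (x := Complex.I * (2 * Real.pi * k * a))
    (by simp) (by simp [hk0, ha0, hpi])
  exact ((h1.const_mul _).add (h2.const_mul _)).const_mul _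

/-- The exponentials have modulus one, so `b` does not enter; `1/(2k)` times the `1/|x|` decay at
`|x| = 2πk|a|` gives `1/k²`. -/
theorem norm_entireTerm_le {r : ℝ} (hr : 0 < r) {S : ℝ} {M : ℕ} {a b : ℝ} (ha : r ≤ |a|) {s : ℂ}
    (hM : -s.re - 1 ≤ M) (hS : |s.im| ≤ S) (k : ℕ) :
    ‖entireTerm a b (k + 1) s‖ ≤ (∫ u in Ioi 0, laplaceBound S r M u) / r * (1 / (k + 1 : ℝ) ^ 2) := by
  have hk : (0 : ℝ) < k + 1 := by positivity
  have ha0 : a ≠ 0 := by rintro rfl; simp at ha; linarith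
  set C := ∫ u in Ioi 0, laplaceBound S r M u with hC
  have hC0 : 0 ≤ C := setIntegral_nonneg measurableSet_Ioi fun u hu => by
    have : (0 : ℝ) < u := hu
    unfold laplaceBound
    positivity
  have hnorm : ∀ x : ℂ, ‖x‖ = 2 * Real.pi * (k + 1) * |a| → 0 ≤ x.re →
      ‖scaledUpperGamma s x‖ ≤ C / r * (1 / (k + 1 : ℝ)) := by
    intro x hx hre
    have h2 : r * (k + 1) ≤ ‖x‖ := by
      rw [hx]
      have : (1 : ℝ) ≤ 2 * Real.pi := by linarith [Real.pi_gt_three]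
      calc r * (k + 1) ≤ |a| * (k + 1) := by gcongr
        _ ≤ (2 * Real.pi) * (|a| * (k + 1)) := le_mul_of_one_le_left (by positivity) this
        _ = _ := by ring
    have h3 : r ≤ ‖x‖ := le_trans (le_mul_of_one_le_right hr.le (by linarith [(Nat.cast_nonneg k : (0:ℝ) ≤ k)])) h2
    refine (norm_scaledUpperGamma_le hre hr h3 hM hS).trans ?_
    calc ‖x‖⁻¹ * C ≤ (r * (k + 1))⁻¹ * C := by gcongr
      _ = _ := by field_simp
  have e : ∀ y : ℝ, ‖Complex.exp (y * Complex.I)‖ = 1 := Complex.norm_exp_ofReal_mul_I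
  have e₁ : ‖Complex.exp (2 * Real.pi * b * (k + 1 : ℕ) * Complex.I)‖ = 1 := by
    have := e (2 * Real.pi * b * (k + 1 : ℕ))
    push_cast at this ⊢
    exact this
  have e₂ : ‖Complex.exp (-(2 * Real.pi * b * (k + 1 : ℕ) * Complex.I))‖ = 1 := by
    have := e (-(2 * Real.pi * b * (k + 1 : ℕ)))
    push_cast at this ⊢
    rw [neg_mul] at this
    exact this
  have hx : ‖(Complex.I * (2 * Real.pi * (k + 1 : ℕ) * a) : ℂ)‖ = 2 * Real.pi * (k + 1) * |a| := by
    have : (Complex.I * (2 * Real.pi * (k + 1 : ℕ) * a) : ℂ) =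
        Complex.I * ((2 * Real.pi * (k + 1) * a : ℝ) : ℂ) := by push_cast; ring
    rw [this, norm_mul, Complex.norm_I, one_mul, Complex.norm_real, Real.norm_eq_abs, abs_mul,
      abs_of_pos (by positivity)]
  have n₁ := hnorm _ hx (by simp)
  have n₂ := hnorm (-(Complex.I * (2 * Real.pi * (k + 1 : ℕ) * a))) (by rw [norm_neg, hx])
    (by simp)
  rw [entireTerm, norm_mul]
  have n₃ : ‖(1 / (2 * ((k + 1 : ℕ) : ℂ)))‖ = 1 / (2 * (k + 1 : ℝ)) := by
    rw [norm_div, norm_mul, Complex.norm_natCast]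
    simp
  rw [n₃]
  calc _ ≤ 1 / (2 * (k + 1 : ℝ)) * (C / r * (1 / (k + 1 : ℝ)) + C / r * (1 / (k + 1 : ℝ))) := by
        gcongr
        refine (norm_add_le _ _).trans ?_
        rw [norm_mul, norm_mul, e₁, e₂, one_mul, one_mul]
        gcongr
    _ = _ := by field_simp; ring

theorem summable_one_div_add_one_sq (C : ℝ) :
    Summable fun k : ℕ => C * (1 / (k + 1 : ℝ) ^ 2) := by
  have := (summable_nat_add_iff 1).mpr (Real.summable_one_div_nat_pow.mpr one_lt_two)
  refine Summable.mul_left C ?_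
  simpa using this

theorem summable_norm_entireTerm {a : ℝ} (ha : a ≠ 0) (b : ℝ) (s : ℂ) :
    Summable fun k : ℕ => ‖entireTerm a b (k + 1) s‖ := by
  obtain ⟨M, hM⟩ := exists_nat_ge (-s.re - 1)
  exact Summable.of_nonneg_of_le (fun _ => norm_nonneg _)
    (fun k => norm_entireTerm_le (abs_pos.mpr ha) le_rfl hM le_rfl k)
    (summable_one_div_add_one_sq _)

theorem differentiable_tsum_entireTerm {a : ℝ} (ha : a ≠ 0) (b : ℝ) :
    Differentiable ℂ fun s => ∑' k : ℕ, entireTerm a b (k + 1) s := by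
  intro s₀
  obtain ⟨S, M, hs, hopen⟩ := exists_nat_bound_region s₀
  refine (Complex.differentiableOn_tsum_of_summable_norm (summable_one_div_add_one_sq
    ((∫ u in Ioi 0, laplaceBound S |a| M u) / |a|))
    (fun k => (differentiable_entireTerm ha b (by omega)).differentiableOn) hopen
    fun k s hs => ?_).differentiableAt (hopen.mem_nhds hs)
  exact norm_entireTerm_le (abs_pos.mpr ha) le_rfl hs.1.le hs.2.le k

/-! ### Scaling by `d`, and convergence of the right-hand side. -/

/-- Apart from the factor `d ^ (-s)`, the length `d` enters only through the product `a * d`. So `d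
= 1` is the general case. -/
theorem gammaTerm_scale {d : ℝ} (hd : 0 < d) (a b : ℝ) (k : ℕ) (s : ℂ) :
    gammaTerm a b k s = (d : ℂ) ^ (-s) * gammaTerm (a * d) b k s := by
  have hd0 : (d : ℂ) ≠ 0 := by exact_mod_cast hd.ne'
  have e₁ : (-Complex.I * (a * d : ℝ) : ℂ) = d * (-Complex.I * a) := by push_cast; ring
  have e₂ : (Complex.I * (a * d : ℝ) : ℂ) = d * (Complex.I * a) := by push_cast; ring
  rw [gammaTerm, gammaTerm, e₁, e₂, ofReal_mul_cpow hd, ofReal_mul_cpow hd, Complex.cpow_neg]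
  have := (Complex.cpow_ne_zero_iff (x := (d : ℂ)) (y := s)).mpr (Or.inl hd0)
  field_simp

theorem hypTerm_scale {d : ℝ} (hd : 0 < d) (a b : ℝ) (k : ℕ) (s : ℂ) :
    hypTerm a b d k s = (d : ℂ) ^ (-s) * hypTerm (a * d) b 1 k s := by
  have hd0 : (d : ℂ) ≠ 0 := by exact_mod_cast hd.ne'
  have e : ((-(Real.pi ^ 2 * (a * d) ^ 2 * 1 ^ 2 * k ^ 2) : ℝ) : ℂ) =
      ((-(Real.pi ^ 2 * a ^ 2 * d ^ 2 * k ^ 2) : ℝ) : ℂ) := by push_cast; ring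
  rw [hypTerm, hypTerm, e, Complex.cpow_neg, sub_eq_add_neg 1 s, Complex.cpow_add _ _ hd0,
    Complex.cpow_one, Complex.cpow_neg]
  simp only [Complex.ofReal_one, Complex.one_cpow]
  push_cast
  have := (Complex.cpow_ne_zero_iff (x := (d : ℂ)) (y := s)).mpr (Or.inl hd0)
  field_simp

/-- The entire extension of the `k`-th summand of the right-hand side. -/
noncomputable def entireSummand (a b d : ℝ) (k : ℕ) (s : ℂ) : ℂ :=
  (d : ℂ) ^ (-s) * entireTerm (a * d) b k s

theorem entireSummand_eq {s : ℂ} (hs : ∀ n : ℕ, s ≠ n) {a d : ℝ} (ha : a ≠ 0) (hd : 0 < d) (b : ℝ)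
    {k : ℕ} (hk : 1 ≤ k) :
    entireSummand a b d k s = hypTerm a b d k s + gammaTerm a b k s := by
  rw [entireSummand, entireTerm_eq hs (mul_ne_zero ha hd.ne') b hk, hypTerm_scale hd,
    gammaTerm_scale hd a, mul_add]

theorem differentiable_ofReal_cpow_neg {d : ℝ} (hd : 0 < d) :
    Differentiable ℂ fun s : ℂ => (d : ℂ) ^ (-s) := fun _ =>
  DifferentiableAt.const_cpow (f := fun s : ℂ => -s) differentiableAt_id.neg (Or.inl (by exact_mod_cast hd.ne'))

theorem differentiable_entireSummand {a d : ℝ} (ha : a ≠ 0) (hd : 0 < d) (b : ℝ)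
    {k : ℕ} (hk : 1 ≤ k) : Differentiable ℂ (entireSummand a b d k) :=
  (differentiable_ofReal_cpow_neg hd).mul
    (differentiable_entireTerm (mul_ne_zero ha hd.ne') b hk)

theorem summable_norm_entireSummand {a d : ℝ} (ha : a ≠ 0) (hd : 0 < d) (b : ℝ) (s : ℂ) :
    Summable fun k : ℕ => ‖entireSummand a b d (k + 1) s‖ := by
  simp_rw [entireSummand, norm_mul]
  exact (summable_norm_entireTerm (mul_ne_zero ha hd.ne') b s).mul_left _

theorem differentiable_tsum_entireSummand {a d : ℝ} (ha : a ≠ 0) (hd : 0 < d) (b : ℝ) :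
    Differentiable ℂ fun s => ∑' k : ℕ, entireSummand a b d (k + 1) s := by
  simp_rw [entireSummand, tsum_mul_left]
  exact (differentiable_ofReal_cpow_neg hd).mul
    (differentiable_tsum_entireTerm (mul_ne_zero ha hd.ne') b)

theorem absUniformlyConvergesOn_cpow_mul_entireSummand {ε δ B : ℝ} (hδ : 0 < δ) :
    AbsUniformlyConvergesOn
      (fun (k : ℕ) (p : ℂ × ℝ × ℝ × ℝ) =>
        (p.2.2.2 : ℂ) ^ p.1 * entireSummand p.2.1 p.2.2.1 p.2.2.2 (k + 1) p.1)
      {p | ∃ (s : ℂ) (a b d : ℝ), p = (s, a, b, d) ∧ -ε < s.re ∧ |s.im| < ε ∧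
        δ ≤ |a| ∧ |a| ≤ B ∧ δ ≤ d ∧ d ≤ B} := by
  obtain ⟨M, hM⟩ := exists_nat_ge ε
  -- After multiplication by `d ^ s` only `a * d` is left, and its modulus is at least `δ * δ`.
  refine absUniformlyConvergesOn_of_eventually_le (summable_one_div_add_one_sq
    ((∫ u in Ioi 0, laplaceBound ε (δ * δ) M u) / (δ * δ))) 0 ?_
  rintro k - p ⟨s, a, b, d, rfl, hs, hi, ha, -, hd, -⟩
  have hd0 : 0 < d := hδ.trans_le hd
  have hd1 : (d : ℂ) ≠ 0 := by exact_mod_cast hd0.ne'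
  have := (Complex.cpow_ne_zero_iff (x := (d : ℂ)) (y := s)).mpr (Or.inl hd1)
  simp only [entireSummand]
  rw [Complex.cpow_neg, mul_inv_cancel_left₀ this]
  refine norm_entireTerm_le (by positivity) ?_ (by linarith) hi.le k
  rw [abs_mul, abs_of_pos hd0]
  gcongr

theorem absUniformlyConvergesOn_entireSummand {ε δ B : ℝ} (hε : 0 < ε) (hδ : 0 < δ) :
    AbsUniformlyConvergesOn
      (fun (k : ℕ) (p : ℂ × ℝ × ℝ × ℝ) => entireSummand p.2.1 p.2.2.1 p.2.2.2 (k + 1) p.1)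
      {p | ∃ (s : ℂ) (a b d : ℝ), p = (s, a, b, d) ∧ -ε < s.re ∧ |s.im| < ε ∧
        δ ≤ |a| ∧ |a| ≤ B ∧ δ ≤ d ∧ d ≤ B ∧ (1 ≤ d ∨ s.re ≤ B)} := by
  obtain ⟨M, hM⟩ := exists_nat_ge ε
  -- `D ^ max ε B` dominates `d ^ (-re s)` in all cases. For `re s ≥ 0` the power is at most `1` if
  -- `d ≥ 1`, and at most `δ⁻¹ ^ re s` with `re s ≤ B` otherwise. For `re s < 0` it is a power of `d
  -- ≤ B` with exponent below `ε`.
  set D : ℝ := max 1 (max δ⁻¹ B) with hD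
  have hD1 : 1 ≤ D := le_max_left _ _
  refine absUniformlyConvergesOn_of_eventually_le (summable_one_div_add_one_sq
    (D ^ max ε B * ((∫ u in Ioi 0, laplaceBound ε (δ * δ) M u) / (δ * δ)))) 0 ?_
  rintro k - p ⟨s, a, b, d, rfl, hs, hi, ha, -, hd, hdB, hor⟩
  have hd0 : 0 < d := hδ.trans_le hd
  simp only [entireSummand]
  rw [norm_mul, Complex.norm_cpow_eq_rpow_re_of_pos hd0, mul_assoc (D ^ _)]
  have h1 : ‖entireTerm (a * d) b (k + 1) s‖ ≤
      (∫ u in Ioi 0, laplaceBound ε (δ * δ) M u) / (δ * δ) * (1 / (k + 1 : ℝ) ^ 2) := by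
    refine norm_entireTerm_le (by positivity) ?_ (by linarith) hi.le k
    rw [abs_mul, abs_of_pos hd0]
    gcongr
  have h2 : d ^ (-s).re ≤ D ^ max ε B := by
    rw [Complex.neg_re]
    rcases le_or_gt 0 s.re with h0 | h0
    · rcases hor with h | h
      · calc d ^ (-s.re) ≤ 1 := Real.rpow_le_one_of_one_le_of_nonpos h (by linarith)
          _ ≤ _ := Real.one_le_rpow hD1 (le_max_of_le_left hε.le)
      · calc d ^ (-s.re) = d⁻¹ ^ s.re := by rw [Real.rpow_neg hd0.le, Real.inv_rpow hd0.le]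
          _ ≤ D ^ s.re := by
            gcongr
            exact (inv_anti₀ hδ hd).trans ((le_max_left _ _).trans (le_max_right _ _))
          _ ≤ _ := Real.rpow_le_rpow_of_exponent_le hD1 (h.trans (le_max_right _ _))
    · calc d ^ (-s.re) ≤ D ^ (-s.re) := by
            gcongr
            · linarith
            · exact hdB.trans ((le_max_right _ _).trans (le_max_right _ _))
        _ ≤ _ := Real.rpow_le_rpow_of_exponent_le hD1 (by linarith [le_max_left ε B])
  gcongr

/-! ### Explicit continuation of the Gauss function to the cut plane and its lower edge. -/

/-- A continuous primitive of the logarithm, normalised to vanish to second order at `1`. -/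
noncomputable def logPrimitive (u : ℂ) : ℂ := u * Complex.log u - u + 1

/-- Unlike the logarithm, `u log u` stays bounded at `0`. One dominating function then works for all
`z` near and on the cut, although `1 - z t` may vanish inside the interval. -/
theorem exists_norm_logPrimitive_le (R : ℝ) :
    ∃ C : ℝ, ∀ u : ℂ, ‖u‖ ≤ R → ‖logPrimitive u‖ ≤ C := by
  obtain ⟨C, hC⟩ := (isCompact_Icc (a := (0 : ℝ)) (b := R)).exists_bound_of_continuousOn
    (Real.continuous_mul_log.continuousOn)
  refine ⟨C + R * Real.pi + R + 1, fun u hu => ?_⟩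
  have h1 := hC ‖u‖ ⟨norm_nonneg _, hu⟩
  have h2 : ‖Complex.log u‖ ≤ |Real.log ‖u‖| + Real.pi := by
    refine (Complex.norm_le_abs_re_add_abs_im _).trans ?_
    rw [Complex.log_re, Complex.log_im]
    gcongr
    exact Complex.abs_arg_le_pi u
  have h3 : ‖u * Complex.log u‖ ≤ C + R * Real.pi := by
    rw [norm_mul]
    calc ‖u‖ * ‖Complex.log u‖ ≤ ‖u‖ * (|Real.log ‖u‖| + Real.pi) := by gcongr
      _ = ‖‖u‖ * Real.log ‖u‖‖ + ‖u‖ * Real.pi := by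
        rw [norm_mul, norm_norm, Real.norm_eq_abs]; ring
      _ ≤ _ := by have := Real.pi_pos; gcongr
  rw [logPrimitive]
  refine (norm_add_le _ _).trans ?_
  rw [norm_one]
  have := norm_sub_le (u * Complex.log u) u
  linarith

theorem differentiableAt_logPrimitive {u : ℂ} (hu : u ∈ Complex.slitPlane) :
    DifferentiableAt ℂ logPrimitive u := by
  unfold logPrimitive
  exact ((differentiableAt_id.mul (differentiableAt_id.clog hu)).sub differentiableAt_id).add
    (differentiableAt_const _)

theorem hasSum_logPrimitive {v : ℂ} (hv : ‖v‖ < 1) :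
    HasSum (fun n : ℕ => v ^ (n + 2) / ((n + 2) * (n + 1))) (logPrimitive (1 - v)) := by
  have h := Complex.hasSum_taylorSeries_neg_log hv
  have h1 := (hasSum_nat_add_iff' 1).mpr h
  have h2 := (hasSum_nat_add_iff' 2).mpr h
  have h3 := (h1.mul_left v).sub h2
  convert! h3 using 1
  · funext n
    have e1 : ((n : ℂ) + 1) ≠ 0 := by exact_mod_cast n.succ_ne_zero
    have e2 : ((n : ℂ) + 2) ≠ 0 := by exact_mod_cast (n + 1).succ_ne_zero
    push_cast
    field_simp
    ring
  · simp [logPrimitive, Finset.sum_range_succ]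
    ring

/-- The integral part of `gaussRemainder`. -/
noncomputable def gaussKernel (c z : ℂ) : ℂ :=
  ∫ t : ℝ in Ioc 0 1, logPrimitive (1 - z * t) * (t : ℂ) ^ (c - 1)

/-- The function `∑ i ≥ 2, z ^ i / (i + c)` on the cut plane, for `0 < re c`. -/
noncomputable def gaussRemainder (c z : ℂ) : ℂ :=
  c * (c + 1) * gaussKernel c z - (c + 1) * (Complex.log (1 - z) + z)
    + c * z * Complex.log (1 - z)

theorem add_ne_zero_of_re_pos {c : ℂ} (hc : 0 < c.re) {x : ℝ} (hx : 0 ≤ x) : (x : ℂ) + c ≠ 0 := by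
  intro h
  have := congrArg Complex.re h
  simp at this
  linarith

/-- Partial fractions: `1/(i+c) = c(c+1)/(i(i-1)(i+c)) + (c+1)/i - c/(i-1)` for `i ≥ 2`. The first
part is an integral of `logPrimitive`; the other two are logarithmic series. -/
theorem hasSum_gaussRemainder {c z : ℂ} (hc : 0 < c.re) (hz : ‖z‖ < 1) :
    HasSum (fun n : ℕ => z ^ (n + 2) / (n + 2 + c)) (gaussRemainder c z) := by
  -- Division by zero makes the terms `n = 0, 1` vanish, so the series really starts at `n = 2`.
  have hsum : Summable fun n : ℕ => ‖z ^ n / ((n : ℂ) * (n - 1))‖ := by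
    refine (summable_nat_add_iff 2).mp ?_
    have := (hasSum_logPrimitive hz).summable.norm
    convert! this using 2 with n
    push_cast
    ring_nf
  have hK := hasSum_integral_powerSeries hsum hc
  have hKeq : ∫ t : ℝ in Ioc 0 1, (∑' n : ℕ, z ^ n / ((n : ℂ) * (n - 1)) * (t : ℂ) ^ n) *
      (t : ℂ) ^ (c - 1) = gaussKernel c z := by
    rw [gaussKernel]
    refine setIntegral_congr_fun measurableSet_Ioc fun t ht => ?_
    have hzt : ‖z * t‖ < 1 := by
      rw [norm_mul, Complex.norm_real, Real.norm_of_nonneg ht.1.le]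
      calc ‖z‖ * t ≤ ‖z‖ * 1 := by gcongr; exact ht.2
        _ < 1 := by linarith
    congr 1
    refine HasSum.tsum_eq ((hasSum_nat_add_iff' 2).mp ?_)
    convert! hasSum_logPrimitive hzt using 1
    · funext n
      push_cast
      rw [mul_pow]
      ring
    · simp [Finset.sum_range_succ]
  rw [hKeq] at hK
  have h0 := (hasSum_nat_add_iff' 2).mpr hK
  have h := Complex.hasSum_taylorSeries_neg_log hz
  have h1 := (hasSum_nat_add_iff' 1).mpr h
  have h2 := (hasSum_nat_add_iff' 2).mpr h
  have h3 := ((h0.mul_left (c * (c + 1))).add (h2.mul_left (c + 1))).sub (h1.mul_left (c * z))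
  convert! h3 using 1
  · funext n
    have e1 : ((n : ℂ) + 1) ≠ 0 := by exact_mod_cast n.succ_ne_zero
    have e2 : ((n : ℂ) + 2) ≠ 0 := by exact_mod_cast (n + 1).succ_ne_zero
    have e3 : ((n : ℂ) + 2 + c) ≠ 0 := by
      have := add_ne_zero_of_re_pos hc (x := n + 2) (by positivity)
      push_cast at this
      exact this
    push_cast
    rw [show (n : ℂ) + 2 - 1 = n + 1 by ring]
    field_simp
    ring
  · simp [gaussRemainder, Finset.sum_range_succ]
    ring

/-- All denominators have real part at least one, so a geometric series bounds the sum uniformly in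
`c`. -/
theorem norm_gaussRemainder_le {c z : ℂ} (hc : 0 < c.re) (hz : ‖z‖ ≤ 1 / 2) :
    ‖gaussRemainder c z‖ ≤ 2 * ‖z‖ ^ 2 := by
  have hz1 : ‖z‖ < 1 := by linarith
  have hg := (hasSum_geometric_of_lt_one (norm_nonneg z) hz1).mul_left (‖z‖ ^ 2)
  have h : ‖gaussRemainder c z‖ ≤ ‖z‖ ^ 2 * (1 - ‖z‖)⁻¹ := by
    rw [← (hasSum_gaussRemainder hc hz1).tsum_eq]
    refine tsum_of_norm_bounded hg fun n => ?_
    rw [norm_div, norm_pow, ← pow_add, add_comm n]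
    refine div_le_self (by positivity) ?_
    refine le_trans ?_ (Complex.re_le_norm _)
    simp
    linarith [(Nat.cast_nonneg n : (0 : ℝ) ≤ n)]
  refine h.trans ?_
  rw [mul_comm]
  gcongr
  rw [inv_le_comm₀ (by linarith) (by norm_num)]
  linarith

theorem norm_ofReal_cpow_le {t : ℝ} (ht : t ∈ Ioc (0 : ℝ) 1) {η : ℝ} {c : ℂ} (hc : η ≤ c.re) :
    ‖(t : ℂ) ^ (c - 1)‖ ≤ ‖(t : ℂ) ^ ((η : ℂ) - 1)‖ := by
  rw [Complex.norm_cpow_eq_rpow_re_of_pos ht.1, Complex.norm_cpow_eq_rpow_re_of_pos ht.1]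
  exact Real.rpow_le_rpow_of_exponent_ge ht.1 ht.2 (by simpa using hc)

theorem norm_one_sub_mul_le {z : ℂ} {t R : ℝ} (ht : t ∈ Ioc (0 : ℝ) 1) (hz : ‖z‖ ≤ R) :
    ‖1 - z * (t : ℂ)‖ ≤ 1 + R := by
  refine (norm_sub_le _ _).trans ?_
  rw [norm_one, norm_mul, Complex.norm_real, Real.norm_of_nonneg ht.1.le]
  have : ‖z‖ * t ≤ ‖z‖ := mul_le_of_le_one_right (norm_nonneg _) ht.2
  linarith

theorem measurable_gaussKernel_integrand (c z : ℂ) :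
    Measurable fun t : ℝ => logPrimitive (1 - z * t) * (t : ℂ) ^ (c - 1) := by
  unfold logPrimitive
  fun_prop

theorem exists_gaussKernel_bound (R : ℝ) : ∃ C : ℝ, ∀ (η : ℝ) (c z : ℂ) (t : ℝ), ‖z‖ ≤ R →
    η ≤ c.re → t ∈ Ioc (0 : ℝ) 1 →
    ‖logPrimitive (1 - z * t) * (t : ℂ) ^ (c - 1)‖ ≤ C * ‖(t : ℂ) ^ ((η : ℂ) - 1)‖ := by
  obtain ⟨C, hC⟩ := exists_norm_logPrimitive_le (1 + R)
  refine ⟨C, fun η c z t hz hc ht => ?_⟩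
  rw [norm_mul]
  have h1 := hC _ (norm_one_sub_mul_le ht hz)
  have h2 := norm_ofReal_cpow_le ht hc
  have : 0 ≤ C := (norm_nonneg _).trans h1
  gcongr

theorem integrableOn_gaussKernel_bound (C : ℝ) {η : ℝ} (hη : 0 < η) :
    IntegrableOn (fun t : ℝ => C * ‖(t : ℂ) ^ ((η : ℂ) - 1)‖) (Ioc 0 1) :=
  (integrableOn_cpow_unit (w := η) (by simpa using hη)).norm.const_mul C

theorem differentiableOn_gaussKernel_left (z : ℂ) :
    DifferentiableOn ℂ (fun c => gaussKernel c z) {c | 0 < c.re} := by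
  intro c₀ hc₀
  have hη : 0 < c₀.re / 2 := half_pos hc₀
  obtain ⟨C, hC⟩ := exists_gaussKernel_bound ‖z‖
  have hopen : IsOpen {c : ℂ | c₀.re / 2 < c.re} := isOpen_lt (by fun_prop) (by fun_prop)
  have hmem : c₀ ∈ {c : ℂ | c₀.re / 2 < c.re} := by
    have : 0 < c₀.re := hc₀
    change c₀.re / 2 < c₀.re
    linarith
  refine ((differentiableOn_integral_of_dominated hopen
    (fun c _ => (measurable_gaussKernel_integrand c z).aestronglyMeasurable) ?_ ?_
    (integrableOn_gaussKernel_bound C hη)).differentiableAt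
      (hopen.mem_nhds hmem)).differentiableWithinAt
  · filter_upwards [ae_restrict_mem measurableSet_Ioc] with t ht c hc
    have : (t : ℂ) ≠ 0 := by exact_mod_cast ht.1.ne'
    exact ((DifferentiableAt.const_cpow (by fun_prop) (Or.inl this)).const_mul
      _).differentiableWithinAt
  · filter_upwards [ae_restrict_mem measurableSet_Ioc] with t ht c hc
    exact hC _ c z t le_rfl (le_of_lt hc) ht

theorem differentiableOn_gaussRemainder_left (z : ℂ) :
    DifferentiableOn ℂ (fun c => gaussRemainder c z) {c | 0 < c.re} := by
  have := differentiableOn_gaussKernel_left z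
  unfold gaussRemainder
  fun_prop

theorem isOpen_cutPlane : IsOpen {z : ℂ | 1 - z ∈ Complex.slitPlane} :=
  Complex.isOpen_slitPlane.preimage (continuous_const.sub continuous_id)

theorem one_sub_mul_mem_slitPlane {z : ℂ} (hz : 1 - z ∈ Complex.slitPlane) {t : ℝ}
    (ht : t ∈ Icc (0 : ℝ) 1) : 1 - z * t ∈ Complex.slitPlane := by
  have h := Complex.starConvex_one_slitPlane hz (a := 1 - t) (b := t) (by linarith [ht.2]) ht.1
    (by ring)
  convert! h using 1
  simp only [Complex.real_smul]
  push_cast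
  ring

theorem differentiableOn_gaussKernel_right {c : ℂ} (hc : 0 < c.re) :
    DifferentiableOn ℂ (fun z => gaussKernel c z) {z | 1 - z ∈ Complex.slitPlane} := by
  intro z₀ hz₀
  obtain ⟨C, hC⟩ := exists_gaussKernel_bound (‖z₀‖ + 1)
  have hopen := isOpen_cutPlane.inter (Metric.isOpen_ball (x := (0 : ℂ)) (ε := ‖z₀‖ + 1))
  have hmem : z₀ ∈ {z : ℂ | 1 - z ∈ Complex.slitPlane} ∩ Metric.ball 0 (‖z₀‖ + 1) :=
    ⟨hz₀, by simp⟩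
  refine ((differentiableOn_integral_of_dominated hopen
    (fun z _ => (measurable_gaussKernel_integrand c z).aestronglyMeasurable) ?_ ?_
    (integrableOn_gaussKernel_bound C hc)).differentiableAt
      (hopen.mem_nhds hmem)).differentiableWithinAt
  · filter_upwards [ae_restrict_mem measurableSet_Ioc] with t ht z hz
    have h1 := one_sub_mul_mem_slitPlane hz.1 ⟨ht.1.le, ht.2⟩
    refine DifferentiableAt.differentiableWithinAt (DifferentiableAt.mul_const ?_ _)
    exact (differentiableAt_logPrimitive h1).comp (f := fun z : ℂ => 1 - z * t) z (by fun_prop)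
  · filter_upwards [ae_restrict_mem measurableSet_Ioc] with t ht z hz
    exact hC _ c z t (by simpa using (mem_ball_zero_iff.mp hz.2).le) le_rfl ht

theorem differentiableOn_gaussRemainder_right {c : ℂ} (hc : 0 < c.re) :
    DifferentiableOn ℂ (fun z => gaussRemainder c z) {z | 1 - z ∈ Complex.slitPlane} := by
  have h1 := differentiableOn_gaussKernel_right hc
  have h2 : DifferentiableOn ℂ (fun z : ℂ => Complex.log (1 - z))
      {z | 1 - z ∈ Complex.slitPlane} := fun z hz =>
    (DifferentiableAt.clog (by fun_prop) hz).differentiableWithinAt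
  unfold gaussRemainder
  fun_prop

/-- The logarithm approaches its value on the cut from above. -/
theorem tendsto_log_one_sub_mul {x t : ℝ} (ht : 0 < t) (hxt : 1 - x * t ≠ 0) :
    Tendsto (fun z : ℂ => Complex.log (1 - z * t)) (𝓝[{z | z.im < 0}] (x : ℂ))
      (𝓝 (Complex.log (1 - x * t))) := by
  have hc : Tendsto (fun z : ℂ => 1 - z * t) (𝓝[{z | z.im < 0}] (x : ℂ))
      (𝓝 (1 - (x : ℂ) * t)) :=
    (Continuous.tendsto (by fun_prop) (x : ℂ)).mono_left nhdsWithin_le_nhds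
  rcases lt_or_gt_of_ne hxt with h | h
  · have h1 := Complex.continuousWithinAt_log_of_re_neg_of_im_zero (z := 1 - (x : ℂ) * t)
      (by simpa using h) (by simp)
    refine h1.tendsto.comp (tendsto_nhdsWithin_iff.mpr ⟨hc, ?_⟩)
    filter_upwards [self_mem_nhdsWithin] with z hz
    have hz' : z.im < 0 := hz
    have : 0 ≤ -(z.im * t) := by nlinarith
    simpa using this
  · have h1 : (1 - (x : ℂ) * t) ∈ Complex.slitPlane := Or.inl (by simpa using h)
    exact (continuousAt_clog h1).tendsto.comp hc

/-- If `im z < 0` and `t > 0` then `1 - z t` lies in the upper half plane, from which the principal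
logarithm is continuous up to the negative axis. Dominated convergence carries this over to the
kernel, the point `t = 1/x` being negligible. -/
theorem tendsto_gaussRemainder {c : ℂ} (hc : 0 < c.re) {x : ℝ} (hx : 1 < x) :
    Tendsto (gaussRemainder c) (𝓝[{z | z.im < 0}] (x : ℂ)) (𝓝 (gaussRemainder c x)) := by
  have hid : Tendsto (fun z : ℂ => z) (𝓝[{z | z.im < 0}] (x : ℂ)) (𝓝 (x : ℂ)) :=
    tendsto_id.mono_left nhdsWithin_le_nhds
  have hlog : Tendsto (fun z : ℂ => Complex.log (1 - z)) (𝓝[{z | z.im < 0}] (x : ℂ))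
      (𝓝 (Complex.log (1 - x))) := by
    simpa using tendsto_log_one_sub_mul (x := x) one_pos (by linarith)
  have hK : Tendsto (gaussKernel c) (𝓝[{z | z.im < 0}] (x : ℂ)) (𝓝 (gaussKernel c x)) := by
    obtain ⟨C, hC⟩ := exists_gaussKernel_bound (‖(x : ℂ)‖ + 1)
    refine tendsto_integral_filter_of_dominated_convergence _ (Eventually.of_forall fun z =>
      (measurable_gaussKernel_integrand c z).aestronglyMeasurable) ?_
      (integrableOn_gaussKernel_bound C hc) ?_
    · have hev : ∀ᶠ z in 𝓝[{z : ℂ | z.im < 0}] (x : ℂ), ‖z‖ < ‖(x : ℂ)‖ + 1 :=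
        (hid.norm).eventually (gt_mem_nhds (by linarith))
      filter_upwards [hev] with z hz
      filter_upwards [ae_restrict_mem measurableSet_Ioc] with t ht
      exact hC _ c z t hz.le le_rfl ht
    · have hne : ∀ᵐ t : ℝ ∂volume.restrict (Ioc 0 1), t ≠ x⁻¹ :=
        ae_restrict_of_ae (Measure.ae_ne _ _)
      filter_upwards [ae_restrict_mem measurableSet_Ioc, hne] with t ht htx
      have hxt : 1 - x * t ≠ 0 := by
        intro h
        refine htx (eq_inv_of_mul_eq_one_right ?_)
        linarith
      have hl := tendsto_log_one_sub_mul (x := x) ht.1 hxt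
      have hc' : Tendsto (fun z : ℂ => 1 - z * t) (𝓝[{z | z.im < 0}] (x : ℂ))
          (𝓝 (1 - (x : ℂ) * t)) := (hid.mul_const _).const_sub _
      exact (((hc'.mul hl).sub hc').add_const 1).mul_const _
  exact ((hK.const_mul _).sub ((hlog.add hid).const_mul _)).add ((hid.const_mul c).mul hlog)

/-- An explicit form of `₂F₁(1, 1 - s; 2 - s; ·)` for `re s < N + 1`. -/
noncomputable def gaussForm (N : ℕ) (s z : ℂ) : ℂ :=
  1 + ∑ j ∈ Finset.range (N + 1), (1 - s) * z ^ (j + 1) / (j + 2 - s)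
    + (1 - s) * z ^ N * gaussRemainder (N + 1 - s) z

theorem add_two_sub_ne_zero {s : ℂ} (hs : ∀ n : ℕ, 2 ≤ n → s ≠ n) (j : ℕ) :
    (j : ℂ) + 2 - s ≠ 0 := fun h =>
  hs (j + 2) (by omega) (by push_cast; linear_combination -h)

/-- Splitting off `N + 1` terms shifts the parameter of the tail to `c = N + 1 - s`, whose real part
is positive. -/
theorem hasSum_gaussForm {N : ℕ} {s : ℂ} (hN : s.re < N + 1) {z : ℂ}
    (hz : ‖z‖ < 1) :
    HasSum (fun n : ℕ => (1 - s) * z ^ (n + 1) / (n + 2 - s)) (gaussForm N s z - 1) := by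
  have hc : 0 < ((N : ℂ) + 1 - s).re := by simp; linarith
  refine (hasSum_nat_add_iff' (N + 1)).mp ?_
  convert! (hasSum_gaussRemainder hc hz).mul_left ((1 - s) * z ^ N) using 1
  · funext n
    push_cast
    ring
  · rw [gaussForm]
    ring

theorem ordinaryHypergeometric_eq {s : ℂ} (hs : ∀ n : ℕ, 2 ≤ n → s ≠ n) {z g : ℂ}
    (h : HasSum (fun n : ℕ => (1 - s) * z ^ (n + 1) / (n + 2 - s)) (g - 1)) :
    ordinaryHypergeometric 1 (1 - s) (2 - s) z = g := by
  rw [ordinaryHypergeometric_eq_tsum]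
  refine HasSum.tsum_eq ((hasSum_nat_add_iff' 1).mp ?_)
  convert! h using 1
  · funext n
    have h1 := ascPochhammer_eval_mul_add (1 - s) (n + 1)
    rw [show (1 : ℂ) - s + 1 = 2 - s by ring] at h1
    have h2 : (ascPochhammer ℂ (n + 1)).eval (2 - s) ≠ 0 := by
      refine ascPochhammer_eval_ne_zero (fun m hm => hs (m + 2) (by omega) ?_) _
      push_cast
      linear_combination -hm
    have h3 := add_two_sub_ne_zero hs n
    have h4 : ((n + 1).factorial : ℂ) ≠ 0 := by exact_mod_cast (n + 1).factorial_ne_zero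
    rw [ascPochhammer_eval_one, smul_eq_mul, inv_mul_cancel₀ h4, one_mul]
    rw [show (1 : ℂ) - s + (n + 1 : ℕ) = n + 2 - s by push_cast; ring] at h1
    field_simp
    linear_combination z ^ (n + 1) * h1
  · simp

theorem isPrincipalGauss_gaussForm {N : ℕ} {s : ℂ} (hs : ∀ n : ℕ, 2 ≤ n → s ≠ n)
    (hN : s.re < N + 1) : IsPrincipalGauss 1 (1 - s) (2 - s) (gaussForm N s) := by
  have hc : 0 < ((N : ℂ) + 1 - s).re := by simp; linarith
  refine ⟨?_, fun z hz => (ordinaryHypergeometric_eq hs (hasSum_gaussForm hN hz)).symm,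
    fun x hx => ?_⟩
  · have := differentiableOn_gaussRemainder_right hc
    unfold gaussForm
    fun_prop
  · unfold gaussForm
    have hp : Tendsto (fun z : ℂ => 1 + ∑ j ∈ Finset.range (N + 1),
        (1 - s) * z ^ (j + 1) / (j + 2 - s)) (𝓝[{z | z.im < 0}] (x : ℂ))
        (𝓝 (1 + ∑ j ∈ Finset.range (N + 1), (1 - s) * (x : ℂ) ^ (j + 1) / (j + 2 - s))) :=
      (Continuous.tendsto (by fun_prop) (x : ℂ)).mono_left nhdsWithin_le_nhds
    have hq : Tendsto (fun z : ℂ => (1 - s) * z ^ N) (𝓝[{z | z.im < 0}] (x : ℂ))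
        (𝓝 ((1 - s) * (x : ℂ) ^ N)) :=
      (Continuous.tendsto (by fun_prop) (x : ℂ)).mono_left nhdsWithin_le_nhds
    exact hp.add (hq.mul (tendsto_gaussRemainder hc hx))

/-- `gaussForm` shows that a principal branch exists, and uniqueness identifies it with the one
chosen in `gauss2F1`. The value does not depend on `N`. -/
theorem gauss2F1_eq_gaussForm {N : ℕ} {s : ℂ} (hs : ∀ n : ℕ, 2 ≤ n → s ≠ n)
    (hN : s.re < N + 1) {z : ℂ} (hz : z ≠ 1) :
    gauss2F1 1 (1 - s) (2 - s) z = gaussForm N s z := by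
  have h : ∃ f, IsPrincipalGauss 1 (1 - s) (2 - s) f := ⟨_, isPrincipalGauss_gaussForm hs hN⟩
  rw [gauss2F1, dif_pos h]
  exact isPrincipalGauss_unique h.choose_spec (isPrincipalGauss_gaussForm hs hN) hz

/-! ### Sums over `|k| = K` and convergence of the Gauss series. -/

/-- The terms with `|k| = K` of a family indexed by the integers. -/
noncomputable def shell (f : ℤ → ℂ) (K : ℕ) : ℂ := ∑ k ∈ ({(K : ℤ), -(K : ℤ)} : Finset ℤ), f k

theorem natAbs_eq_of_mem_shell {k : ℤ} {K : ℕ} (hk : k ∈ ({(K : ℤ), -(K : ℤ)} : Finset ℤ)) :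
    k.natAbs = K := by
  rw [Finset.mem_insert, Finset.mem_singleton] at hk
  omega

theorem shell_congr {f g : ℤ → ℂ} {K : ℕ} (h : ∀ k : ℤ, k.natAbs = K → f k = g k) :
    shell f K = shell g K :=
  Finset.sum_congr rfl fun k hk => h k (natAbs_eq_of_mem_shell hk)

theorem shell_add (f g : ℤ → ℂ) (K : ℕ) : shell (fun k => f k + g k) K = shell f K + shell g K :=
  Finset.sum_add_distrib

theorem shell_mul_left (c : ℂ) (f : ℤ → ℂ) (K : ℕ) :
    shell (fun k => c * f k) K = c * shell f K :=
  (Finset.mul_sum _ _ _).symm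

theorem shell_sum {ι : Type*} (J : Finset ι) (f : ι → ℤ → ℂ) (K : ℕ) :
    shell (fun k => ∑ j ∈ J, f j k) K = ∑ j ∈ J, shell (f j) K :=
  Finset.sum_comm

theorem norm_shell_le {f : ℤ → ℂ} {K : ℕ} {C : ℝ} (hC : 0 ≤ C)
    (h : ∀ k : ℤ, k.natAbs = K → ‖f k‖ ≤ C) : ‖shell f K‖ ≤ 2 * C := by
  refine (norm_sum_le _ _).trans ((Finset.sum_le_card_nsmul _ _ C fun k hk =>
    h k (natAbs_eq_of_mem_shell hk)).trans ?_)
  rw [nsmul_eq_mul]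
  gcongr
  exact_mod_cast Finset.card_le_two

theorem shell_of_pos (f : ℤ → ℂ) {K : ℕ} (hK : 0 < K) :
    shell f K = f K + f (-(K : ℤ)) := by
  rw [shell, Finset.sum_pair]
  omega

theorem gaussShell_eq_shell (a b d : ℝ) (s : ℂ) (K : ℕ) :
    gaussShell a b d s K = shell (gaussTerm a b d s) K := rfl

open Classical in
/-- The argument `-A / (b - k)` of the Gauss function, with the excluded indices sent to `0`. -/
noncomputable def node (A b : ℝ) (k : ℤ) : ℝ :=
  if (k : ℝ) = b ∨ (k : ℝ) = A + b then 0 else -(A / (b - k))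

theorem node_ne_one (A b : ℝ) (k : ℤ) : node A b k ≠ 1 := by
  unfold node
  split_ifs with h
  · exact zero_ne_one
  · push Not at h
    intro h1
    have hb : b - k ≠ 0 := sub_ne_zero.mpr (Ne.symm h.1)
    rw [← neg_div, div_eq_one_iff_eq hb] at h1
    exact h.2 (by linarith)

/-- The argument `0` at the excluded indices makes the product vanish there, so no case distinction
is needed afterwards. -/
theorem gaussTerm_eq_node (a b d : ℝ) (s : ℂ) (k : ℤ) :
    gaussTerm a b d s k =
      -(node (a * d) b k : ℂ) * gauss2F1 1 (1 - s) (2 - s) (node (a * d) b k) := by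
  unfold gaussTerm node
  split_ifs with h
  · simp
  · push_cast
    rw [neg_neg]

theorem gaussTerm_eq_gaussForm {N : ℕ} {s : ℂ} (hs : ∀ n : ℕ, 2 ≤ n → s ≠ n)
    (hN : s.re < N + 1) (a b d : ℝ) (k : ℤ) :
    gaussTerm a b d s k = -(node (a * d) b k : ℂ) * gaussForm N s (node (a * d) b k) := by
  rw [gaussTerm_eq_node, gauss2F1_eq_gaussForm hs hN]
  exact_mod_cast node_ne_one _ _ _

/-- Estimates for the arguments of the Gauss function at large indices. -/
theorem node_bounds {B A b : ℝ} (hA : |A| ≤ B) (hb : |b| ≤ B) {K : ℕ} (hK : 6 * B + 1 ≤ K)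
    {k : ℤ} (hk : k.natAbs = K) :
    |node A b k| ≤ 1 / 2 ∧ |node A b k| ≤ 2 * B / K ∧ node A b k = -(A / (b - k)) := by
  have hB : 0 ≤ B := (abs_nonneg _).trans hA
  have hK0 : (0 : ℝ) < K := by linarith
  have hkK : |(k : ℝ)| = K := by
    rw [← hk, Nat.cast_natAbs, Int.cast_abs]
  -- The lower bound on `K` is generous: `2B ≤ K` is needed here, `2B < K` keeps `k` off the
  -- excluded indices, and `4B ≤ K` makes the argument at most `1/2`.
  have h1 : (K : ℝ) / 2 ≤ |b - k| := by
    have := abs_sub_abs_le_abs_sub (k : ℝ) b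
    rw [abs_sub_comm, hkK] at this
    linarith
  have hne : ¬((k : ℝ) = b ∨ (k : ℝ) = A + b) := by
    rintro (h | h)
    · rw [h] at hkK; linarith
    · have := abs_add_le A b
      rw [← h, hkK] at this
      linarith
  have e : node A b k = -(A / (b - k)) := if_neg hne
  have h2 : |node A b k| ≤ 2 * B / K := by
    rw [e, abs_neg, abs_div]
    calc |A| / |b - k| ≤ B / (K / 2) := by gcongr
      _ = _ := by field_simp
  refine ⟨h2.trans ?_, h2, e⟩
  rw [div_le_iff₀ hK0]
  linarith

/-- The first-order terms are only `O(1/K)`, but those of `k` and `-k` add up to `2Ab/(K² - b²)`.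
This cancellation is why the sum is taken symmetrically. -/
theorem norm_shell_node_le {B A b : ℝ} (hA : |A| ≤ B) (hb : |b| ≤ B) {K : ℕ}
    (hK : 6 * B + 1 ≤ K) :
    ‖shell (fun k => (node A b k : ℂ)) K‖ ≤ 4 * B ^ 2 * (1 / (K : ℝ) ^ 2) := by
  have hB : 0 ≤ B := (abs_nonneg _).trans hA
  have hK0 : (0 : ℝ) < K := by linarith
  have hbK : |b| ≤ K / 2 := by linarith
  have hb2 : b ^ 2 ≤ (K : ℝ) ^ 2 / 4 := by
    rw [← sq_abs b]
    nlinarith [abs_nonneg b]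
  rw [shell_of_pos _ (by exact_mod_cast hK0), (node_bounds hA hb hK (k := K) (by simp)).2.2,
    (node_bounds hA hb hK (k := -K) (by simp)).2.2, ← Complex.ofReal_add, Complex.norm_real,
    Real.norm_eq_abs]
  have h1 : b - K ≠ 0 := by
    have := (abs_le.mp hbK).2
    intro h; linarith
  have h2 : b + K ≠ 0 := by
    have := (abs_le.mp hbK).1
    intro h; linarith
  have e : -(A / (b - ((K : ℤ) : ℝ))) + -(A / (b - ((-(K : ℤ) : ℤ) : ℝ))) =
      2 * A * b / (K ^ 2 - b ^ 2) := by
    have h3 : (K : ℝ) ^ 2 - b ^ 2 ≠ 0 := by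
      have : 0 < (K : ℝ) ^ 2 := by positivity
      intro h; linarith
    push_cast
    rw [sub_neg_eq_add]
    field_simp
    ring
  have h4 : (K : ℝ) ^ 2 / 2 ≤ K ^ 2 - b ^ 2 := by nlinarith [sq_nonneg (K : ℝ)]
  rw [e, abs_div, abs_mul, abs_mul, abs_two]
  calc 2 * |A| * |b| / |(K : ℝ) ^ 2 - b ^ 2| ≤ 2 * B * B / (K ^ 2 / 2) := by
        gcongr
        exact h4.trans (le_abs_self _)
    _ = _ := by field_simp; ring

/-- From second order on no pairing is needed, because the square of the argument is already
`O(1/K²)`. -/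
theorem norm_shell_le_of_le_node_sq {B A b : ℝ} (hA : |A| ≤ B) (hb : |b| ≤ B) {K : ℕ}
    (hK : 6 * B + 1 ≤ K) {f : ℤ → ℂ} {C : ℝ} (hC : 0 ≤ C)
    (h : ∀ k : ℤ, |node A b k| ≤ 1 / 2 → ‖f k‖ ≤ C * |node A b k| ^ 2) :
    ‖shell f K‖ ≤ 8 * C * B ^ 2 * (1 / (K : ℝ) ^ 2) := by
  have hB : 0 ≤ B := (abs_nonneg _).trans hA
  have hK0 : (0 : ℝ) < K := by linarith
  have := norm_shell_le (f := f) (K := K) (C := C * (2 * B / K) ^ 2) (by positivity) fun k hk => by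
    obtain ⟨h1, h2, -⟩ := node_bounds hA hb hK hk
    refine (h k h1).trans ?_
    gcongr
  refine this.trans (le_of_eq ?_)
  field_simp
  ring

theorem summable_const_div_sq (C : ℝ) : Summable fun K : ℕ => C * (1 / (K : ℝ) ^ 2) :=
  (Real.summable_one_div_nat_pow.mpr one_lt_two).mul_left C

theorem exists_index_bound (A b : ℝ) : ∃ (B : ℝ) (K₀ : ℕ), |A| ≤ B ∧ |b| ≤ B ∧
    ∀ K : ℕ, K₀ ≤ K → 6 * B + 1 ≤ (K : ℝ) := by
  obtain ⟨K₀, hK₀⟩ := exists_nat_ge (6 * max |A| |b| + 1)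
  exact ⟨max |A| |b|, K₀, le_max_left _ _, le_max_right _ _, fun K hK =>
    hK₀.trans (by exact_mod_cast hK)⟩

theorem summable_of_eventually_le_div_sq {f : ℕ → ℂ} {C : ℝ} {K₀ : ℕ}
    (h : ∀ K, K₀ ≤ K → ‖f K‖ ≤ C * (1 / (K : ℝ) ^ 2)) : Summable fun K => ‖f K‖ :=
  Summable.of_norm_bounded_eventually_nat (summable_const_div_sq C)
    (by filter_upwards [eventually_ge_atTop K₀] with K hK; rw [norm_norm]; exact h K hK)

theorem summable_norm_shell_node (A b : ℝ) :
    Summable fun K => ‖shell (fun k => (node A b k : ℂ)) K‖ := by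
  obtain ⟨B, K₀, hA, hb, hK⟩ := exists_index_bound A b
  exact summable_of_eventually_le_div_sq fun K h => norm_shell_node_le hA hb (hK K h)

theorem summable_norm_shell_node_pow (A b : ℝ) (j : ℕ) :
    Summable fun K => ‖shell (fun k => (node A b k : ℂ) ^ (j + 2)) K‖ := by
  obtain ⟨B, K₀, hA, hb, hK⟩ := exists_index_bound A b
  refine summable_of_eventually_le_div_sq fun K h =>
    norm_shell_le_of_le_node_sq hA hb (hK K h) zero_le_one fun k hk => ?_
  rw [one_mul, norm_pow, Complex.norm_real, Real.norm_eq_abs]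
  exact pow_le_pow_of_le_one (abs_nonneg _) (by linarith) (by omega)

/-- The remainder part of a summand, after removal of finitely many simple poles. -/
noncomputable def remainderTerm (N : ℕ) (s : ℂ) (x : ℝ) : ℂ :=
  (x : ℂ) ^ (N + 1) * gaussRemainder (N + 1 - s) x

theorem norm_remainderTerm_le {N : ℕ} {s : ℂ} (hN : s.re < N + 1) {x : ℝ} (hx : |x| ≤ 1 / 2) :
    ‖remainderTerm N s x‖ ≤ 1 * |x| ^ 2 := by
  have h := norm_gaussRemainder_le (c := (N : ℂ) + 1 - s) (z := x) (by simp; linarith)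
    (by simpa using hx)
  rw [remainderTerm, norm_mul, norm_pow, Complex.norm_real, Real.norm_eq_abs]
  rw [Complex.norm_real, Real.norm_eq_abs] at h
  have h1 : |x| ^ (N + 1) ≤ 1 / 2 := by
    rw [pow_succ]
    calc |x| ^ N * |x| ≤ 1 * (1 / 2) := by
          gcongr
          exact pow_le_one₀ (abs_nonneg _) (by linarith)
      _ = _ := one_mul _
  calc _ ≤ 1 / 2 * (2 * |x| ^ 2) := by gcongr
    _ = _ := by ring

theorem differentiableOn_remainderTerm (N : ℕ) (x : ℝ) :
    DifferentiableOn ℂ (fun s => remainderTerm N s x) {s | s.re < N + 1} := by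
  refine DifferentiableOn.const_mul ?_ _
  refine (differentiableOn_gaussRemainder_left x).comp (f := fun s : ℂ => (N : ℂ) + 1 - s)
    (by fun_prop) fun s hs => ?_
  have hs' : s.re < N + 1 := hs
  simpa using hs'

/-- Three parts: a linear one that needs pairing, finitely many powers whose coefficients carry the
poles `2, …, N + 2`, and a remainder holomorphic for `re s < N + 1`. -/
theorem gaussShell_eq {N : ℕ} {s : ℂ} (hs : ∀ n : ℕ, 2 ≤ n → s ≠ n)
    (hN : s.re < N + 1) (a b d : ℝ) (K : ℕ) :
    gaussShell a b d s K = -(shell (fun k => (node (a * d) b k : ℂ)) K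
      + ∑ j ∈ Finset.range (N + 1), (1 - s) / (j + 2 - s) *
          shell (fun k => (node (a * d) b k : ℂ) ^ (j + 2)) K
      + (1 - s) * shell (fun k => remainderTerm N s (node (a * d) b k)) K) := by
  simp_rw [← shell_mul_left, ← shell_sum, ← shell_add]
  rw [← neg_one_mul, ← shell_mul_left, gaussShell_eq_shell]
  refine shell_congr fun k _ => ?_
  rw [gaussTerm_eq_gaussForm hs hN, gaussForm, remainderTerm, mul_add, mul_add, Finset.mul_sum]
  rw [mul_add, mul_add, Finset.mul_sum]
  congr 1
  · congr 1
    · ring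
    · refine Finset.sum_congr rfl fun j _ => ?_
      ring
  · ring

theorem summable_norm_shell_remainder {N : ℕ} {s : ℂ} (hN : s.re < N + 1) (A b : ℝ) :
    Summable fun K => ‖shell (fun k => remainderTerm N s (node A b k)) K‖ := by
  obtain ⟨B, K₀, hA, hb, hK⟩ := exists_index_bound A b
  exact summable_of_eventually_le_div_sq fun K h =>
    norm_shell_le_of_le_node_sq hA hb (hK K h) zero_le_one fun k hk => norm_remainderTerm_le hN hk

theorem differentiableOn_tsum_shell_remainder (N : ℕ) (A b : ℝ) :
    DifferentiableOn ℂ (fun s => ∑' K : ℕ, shell (fun k => remainderTerm N s (node A b k)) K)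
      {s | s.re < N + 1} := by
  obtain ⟨B, K₀, hA, hb, hK⟩ := exists_index_bound A b
  have hopen : IsOpen {s : ℂ | s.re < N + 1} := isOpen_lt (by fun_prop) (by fun_prop)
  have hterm : ∀ K, DifferentiableOn ℂ (fun s => shell (fun k => remainderTerm N s (node A b k)) K)
      {s | s.re < N + 1} := fun K =>
    DifferentiableOn.fun_sum fun k _ => differentiableOn_remainderTerm N _
  have htail : DifferentiableOn ℂ
      (fun s => ∑' K : ℕ, shell (fun k => remainderTerm N s (node A b k)) (K + K₀))
      {s | s.re < N + 1} := by
    refine Complex.differentiableOn_tsum_of_summable_norm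
      ((summable_nat_add_iff K₀).mpr (summable_const_div_sq (8 * 1 * B ^ 2)))
      (fun K => hterm _) hopen fun K s hs => ?_
    exact norm_shell_le_of_le_node_sq hA hb (hK _ (by omega)) zero_le_one fun k hk =>
      norm_remainderTerm_le hs hk
  refine ((DifferentiableOn.fun_sum (u := Finset.range K₀) fun K _ => hterm K).add
    htail).congr fun s hs => ?_
  exact ((summable_norm_shell_remainder hs A b).of_norm.sum_add_tsum_nat_add K₀).symm

/-- The sum over all shells, with finitely many simple poles made explicit. -/
theorem hasSum_gaussShell {N : ℕ} {s : ℂ} (hs : ∀ n : ℕ, 2 ≤ n → s ≠ n)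
    (hN : s.re < N + 1) (a b d : ℝ) :
    HasSum (gaussShell a b d s) (-((∑' K, shell (fun k => (node (a * d) b k : ℂ)) K)
      + ∑ j ∈ Finset.range (N + 1), (1 - s) / (j + 2 - s) *
          (∑' K, shell (fun k => (node (a * d) b k : ℂ) ^ (j + 2)) K)
      + (1 - s) * ∑' K, shell (fun k => remainderTerm N s (node (a * d) b k)) K)) := by
  have h := (((summable_norm_shell_node (a * d) b).of_norm.hasSum.add
    (hasSum_sum (s := Finset.range (N + 1)) fun j _ =>
      (summable_norm_shell_node_pow (a * d) b j).of_norm.hasSum.mul_left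
        ((1 - s) / (j + 2 - s)))).add
    ((summable_norm_shell_remainder hN (a * d) b).of_norm.hasSum.mul_left (1 - s))).neg
  convert! h using 1
  funext K
  exact gaussShell_eq hs hN a b d K

theorem summable_norm_gaussShell {s : ℂ} (hs : ∀ n : ℕ, 2 ≤ n → s ≠ n) (a b d : ℝ) :
    Summable fun K => ‖gaussShell a b d s K‖ := by
  obtain ⟨N, hN⟩ := exists_nat_gt s.re
  exact (hasSum_gaussShell hs (N := N) (by linarith) a b d).summable.norm

theorem isOpen_compl_natCast_ge_two : IsOpen {s : ℂ | ∀ n : ℕ, 2 ≤ n → s ≠ n} := by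
  have h : IsClosed ((fun n : ℕ => (n : ℂ)) '' {n | 2 ≤ n}) :=
    Complex.isometry_ofReal.isClosedEmbedding.isClosedMap.comp
      Nat.isClosedEmbedding_coe_real.isClosedMap _ (isClosed_discrete _)
  convert! h.isOpen_compl using 1
  ext s
  simp [eq_comm]

theorem differentiableOn_tsum_gaussShell (a b d : ℝ) :
    DifferentiableOn ℂ (fun s => ∑' K : ℕ, gaussShell a b d s K)
      {s | ∀ n : ℕ, 2 ≤ n → s ≠ n} := by
  intro s₀ hs₀
  obtain ⟨N, hN⟩ := exists_nat_gt s₀.re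
  have hopen : IsOpen {s : ℂ | s.re < N + 1} := isOpen_lt (by fun_prop) (by fun_prop)
  have hmem : s₀ ∈ {s : ℂ | s.re < N + 1} := by
    change s₀.re < N + 1
    linarith
  have hT := (differentiableOn_tsum_shell_remainder N (a * d) b).differentiableAt
    (hopen.mem_nhds hmem)
  refine DifferentiableAt.differentiableWithinAt ?_
  have hev : (fun s => ∑' K : ℕ, gaussShell a b d s K) =ᶠ[𝓝 s₀] fun s =>
      -((∑' K, shell (fun k => (node (a * d) b k : ℂ)) K)
      + ∑ j ∈ Finset.range (N + 1), (1 - s) / (j + 2 - s) *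
          (∑' K, shell (fun k => (node (a * d) b k : ℂ) ^ (j + 2)) K)
      + (1 - s) * ∑' K, shell (fun k => remainderTerm N s (node (a * d) b k)) K) := by
    filter_upwards [hopen.mem_nhds hmem, isOpen_compl_natCast_ge_two.mem_nhds hs₀] with s h1 h2
    exact (hasSum_gaussShell h2 h1 a b d).tsum_eq
  refine DifferentiableAt.congr_of_eventuallyEq ?_ hev
  refine (((differentiableAt_const _).add (DifferentiableAt.fun_sum fun j _ => ?_)).add
    (DifferentiableAt.mul (by fun_prop) hT)).neg
  exact (DifferentiableAt.div (by fun_prop) (by fun_prop) (add_two_sub_ne_zero hs₀ j)).mul_const _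

theorem meromorphic_tsum_gaussShell (a b d : ℝ) :
    Meromorphic (fun s => ∑' K : ℕ, gaussShell a b d s K) := by
  intro s₀
  obtain ⟨N, hN⟩ := exists_nat_gt s₀.re
  have hopen : IsOpen {s : ℂ | s.re < N + 1} := isOpen_lt (by fun_prop) (by fun_prop)
  have hmem : s₀ ∈ {s : ℂ | s.re < N + 1} := by
    change s₀.re < N + 1
    linarith
  have hT := ((differentiableOn_tsum_shell_remainder N (a * d) b).analyticAt
    (hopen.mem_nhds hmem)).meromorphicAt
  have hm : MeromorphicAt (fun s =>
      -((∑' K, shell (fun k => (node (a * d) b k : ℂ)) K)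
      + ∑ j ∈ Finset.range (N + 1), (1 - s) / (j + 2 - s) *
          (∑' K, shell (fun k => (node (a * d) b k : ℂ) ^ (j + 2)) K)
      + (1 - s) * ∑' K, shell (fun k => remainderTerm N s (node (a * d) b k)) K)) s₀ := by
    have hid : MeromorphicAt (fun s : ℂ => s) s₀ := MeromorphicAt.id s₀
    refine MeromorphicAt.neg (MeromorphicAt.add (MeromorphicAt.add (MeromorphicAt.const _ _)
      (MeromorphicAt.fun_sum fun j _ => ?_)) (MeromorphicAt.mul ?_ hT))
    · exact (((MeromorphicAt.const 1 s₀).sub hid).div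
        ((MeromorphicAt.const ((j : ℂ) + 2) s₀).sub hid)).mul (MeromorphicAt.const _ _)
    · exact (MeromorphicAt.const 1 s₀).sub hid
  refine hm.congr ?_
  -- The possible poles other than `s₀` form a closed set, so a punctured neighbourhood of `s₀`
  -- avoids all of them.
  have hne : ∀ᶠ s : ℂ in 𝓝[≠] s₀, ∀ n : ℕ, 2 ≤ n → s ≠ n := by
    have hcl : IsClosed (((fun n : ℕ => (n : ℂ)) '' {n | 2 ≤ n}) \ {s₀}) := by
      have : ((fun n : ℕ => (n : ℂ)) '' {n | 2 ≤ n}) \ {s₀} =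
          (fun n : ℕ => (n : ℂ)) '' {n | 2 ≤ n ∧ (n : ℂ) ≠ s₀} := by
        ext s
        constructor
        · rintro ⟨⟨n, hn, rfl⟩, h⟩; exact ⟨n, ⟨hn, h⟩, rfl⟩
        · rintro ⟨n, ⟨hn, h⟩, rfl⟩; exact ⟨⟨n, hn, rfl⟩, h⟩
      rw [this]
      exact Complex.isometry_ofReal.isClosedEmbedding.isClosedMap.comp
        Nat.isClosedEmbedding_coe_real.isClosedMap _ (isClosed_discrete _)
    have hn := hcl.isOpen_compl.mem_nhds (x := s₀) (by simp)
    filter_upwards [nhdsWithin_le_nhds hn, self_mem_nhdsWithin] with s h1 h2 n hn rfl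
    exact h1 ⟨⟨n, hn, rfl⟩, h2⟩
  filter_upwards [nhdsWithin_le_nhds (hopen.mem_nhds hmem), hne] with s h1 h2
  exact (hasSum_gaussShell h2 h1 a b d).tsum_eq.symm

/-- The hypothesis controls the integers up to `ε`. The later ones are at distance at least `m - ε`,
where `m` is the first natural number beyond `ε`. -/
theorem exists_uniform_dist_natCast {ε δ : ℝ} (hδ : 0 < δ) : ∃ η : ℝ, 0 < η ∧
    ∀ s : ℂ, s.re < ε → (∀ n : ℕ, (n : ℝ) ≤ ε → δ ≤ ‖s - n‖) → ∀ n : ℕ, η ≤ ‖(n : ℂ) - s‖ := by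
  obtain ⟨m, hm, hmin⟩ : ∃ m : ℕ, ε < m ∧ ∀ n : ℕ, ε < n → m ≤ n := by
    classical
    have h : ∃ m : ℕ, ε < m := exists_nat_gt ε
    exact ⟨Nat.find h, Nat.find_spec h, fun n hn => Nat.find_min' h hn⟩
  refine ⟨min δ (m - ε), lt_min hδ (by linarith), fun s hs h n => ?_⟩
  rcases le_or_gt (n : ℝ) ε with hn | hn
  · rw [norm_sub_rev]
    exact (min_le_left _ _).trans (h n hn)
  · refine (min_le_right _ _).trans (le_trans ?_ (Complex.re_le_norm _))
    have : (m : ℝ) ≤ n := by exact_mod_cast hmin n hn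
    simp
    linarith

/-- The factor `1 - s` is kept outside because `|s|` is unbounded in the half plane; the bound on
`T` depends on `s` only through `η`. -/
theorem gauss_series_bound {η : ℝ} (hη : 0 < η) {s : ℂ} (h : ∀ n : ℕ, η ≤ ‖(n : ℂ) - s‖)
    {x : ℝ} (hx : |x| ≤ 1 / 2) :
    ∃ T : ℂ, gauss2F1 1 (1 - s) (2 - s) x = 1 + (1 - s) * T ∧ ‖x * T‖ ≤ 2 / η * |x| ^ 2 := by
  have hs : ∀ n : ℕ, 2 ≤ n → s ≠ n := by
    rintro n - rfl
    have := h n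
    simp at this
    linarith
  obtain ⟨N, hN⟩ := exists_nat_gt s.re
  have hx1 : (x : ℂ) ≠ 1 := by
    intro h
    have : x = 1 := by exact_mod_cast h
    rw [this] at hx
    norm_num at hx
  have hxn : ‖(x : ℂ)‖ < 1 := by
    rw [Complex.norm_real, Real.norm_eq_abs]; linarith
  have hS := hasSum_gaussForm (N := N) (s := s) (by linarith) hxn
  refine ⟨∑' n : ℕ, (x : ℂ) ^ (n + 1) / (n + 2 - s), ?_, ?_⟩
  · rw [gauss2F1_eq_gaussForm hs (N := N) (by linarith) hx1, ← tsum_mul_left]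
    simp_rw [← mul_div_assoc]
    rw [hS.tsum_eq]
    ring
  · have hg := (hasSum_geometric_of_lt_one (abs_nonneg x) (by linarith : |x| < 1)).mul_left
      (|x| / η)
    have hT : ‖∑' n : ℕ, (x : ℂ) ^ (n + 1) / (n + 2 - s)‖ ≤ |x| / η * (1 - |x|)⁻¹ := by
      refine tsum_of_norm_bounded hg fun n => ?_
      rw [norm_div, norm_pow, Complex.norm_real, Real.norm_eq_abs, div_mul_eq_mul_div, ← pow_succ']
      have := h (n + 2)
      push_cast at this
      gcongr
    have h2 : (1 - |x|)⁻¹ ≤ 2 := by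
      rw [inv_le_comm₀ (by linarith) (by norm_num)]
      linarith
    rw [norm_mul, Complex.norm_real, Real.norm_eq_abs]
    calc _ ≤ |x| * (|x| / η * 2) := by gcongr; exact hT.trans (by gcongr)
      _ = _ := by ring

theorem absUniformlyConvergesOn_gaussShell {ε δ B : ℝ} (hδ : 0 < δ) :
    AbsUniformlyConvergesOn
      (fun (K : ℕ) (p : ℂ × ℝ × ℝ × ℝ) =>
        gaussShell p.2.1 p.2.2.1 p.2.2.2 p.1 K / (p.1 * (1 - p.1)))
      {p | ∃ (s : ℂ) (a b d : ℝ), p = (s, a, b, d) ∧ a ≠ 0 ∧ 0 < d ∧ s.re < ε ∧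
        (∀ n : ℕ, (n : ℝ) ≤ ε → δ ≤ ‖s - n‖) ∧
        |b| ≤ B ∧ (∀ m : ℤ, δ ≤ |b - m|) ∧
        (∀ m : ℤ, δ ≤ |a * d + b - m|) ∧ |a * d| ≤ B} := by
  obtain ⟨η, hη, hdist⟩ := exists_uniform_dist_natCast (ε := ε) hδ
  obtain ⟨K₀, hK₀⟩ := exists_nat_ge (6 * B + 1)
  refine absUniformlyConvergesOn_of_eventually_le
    (summable_const_div_sq (4 * B ^ 2 / (η * η) + 8 * (2 / η) * B ^ 2 / η)) K₀ ?_
  rintro K hK p ⟨s, a, b, d, rfl, -, -, hs, hn, hb, -, -, hA⟩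
  have hd := hdist s hs hn
  have hKB : 6 * B + 1 ≤ K := hK₀.trans (by exact_mod_cast hK)
  have hs0 : η ≤ ‖s‖ := by simpa using hd 0
  have hs1 : η ≤ ‖1 - s‖ := by simpa using hd 1
  have hs0' : s ≠ 0 := norm_pos_iff.mp (hη.trans_le hs0)
  have hs1' : 1 - s ≠ 0 := norm_pos_iff.mp (hη.trans_le hs1)
  set z : ℤ → ℂ := fun k => (node (a * d) b k : ℂ) with hz
  set T : ℤ → ℂ := fun k => (gauss2F1 1 (1 - s) (2 - s) (z k) - 1) / (1 - s) with hT
  -- In the second-order part `1 - s` cancels, leaving `1 / s`; both denominators are then bounded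
  -- below by powers of `η`.
  have hsplit : gaussShell a b d s K / (s * (1 - s)) =
      -(shell z K / (s * (1 - s)) + shell (fun k => z k * T k) K / s) := by
    have : gaussShell a b d s K = -1 * (shell z K + (1 - s) * shell (fun k => z k * T k) K) := by
      rw [← shell_mul_left, ← shell_add, ← shell_mul_left, gaussShell_eq_shell]
      refine shell_congr fun k _ => ?_
      rw [gaussTerm_eq_node]
      simp only [hT, hz]
      field_simp
      ring
    rw [this]
    field_simp
  have h1 := norm_shell_node_le hA hb hKB
  have h2 : ‖shell (fun k => z k * T k) K‖ ≤ 8 * (2 / η) * B ^ 2 * (1 / (K : ℝ) ^ 2) := by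
    refine norm_shell_le_of_le_node_sq hA hb hKB (by positivity) fun k hk => ?_
    obtain ⟨T', hT1, hT2⟩ := gauss_series_bound hη hd hk
    have : T k = T' := by
      simp only [hT, hz]
      rw [hT1]
      field_simp
      ring
    rw [this]
    exact hT2
  change ‖gaussShell a b d s K / (s * (1 - s))‖ ≤ _
  rw [hsplit, norm_neg]
  refine (norm_add_le _ _).trans ?_
  rw [norm_div, norm_div, norm_mul, add_mul]
  gcongr
  · calc _ ≤ 4 * B ^ 2 * (1 / (K : ℝ) ^ 2) / (η * η) := by gcongr
      _ = _ := by ring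
  · calc _ ≤ 8 * (2 / η) * B ^ 2 * (1 / (K : ℝ) ^ 2) / η := by gcongr
      _ = _ := by ring

/-! ### Logarithmic moments and the Gauss function in a left half plane. -/

/-- The logarithm of an analytic function has only integrable singularities, and `t ^ q` is
continuous on `[0, 1]` because `re q > 0`. -/
theorem integrableOn_log_mul_cpow {f : ℝ → ℝ} (hf : ∀ t, AnalyticAt ℝ f t) {q : ℂ}
    (hq : 0 < q.re) :
    IntegrableOn (fun t : ℝ => (Real.log (f t) : ℂ) * (t : ℂ) ^ q) (Ioc 0 1) := by
  have h1 : IntervalIntegrable (fun t => (Real.log (f t) : ℂ)) volume 0 1 := by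
    have h := MeromorphicOn.intervalIntegrable_log (f := f) (a := 0) (b := 1)
      fun t _ => (hf t).meromorphicAt
    exact ⟨h.1.ofReal, h.2.ofReal⟩
  have h2 := h1.mul_continuousOn (Complex.continuous_ofReal_cpow_const hq).continuousOn
  rwa [intervalIntegrable_iff_integrableOn_Ioc_of_le zero_le_one] at h2

theorem log_ofReal_eq (u : ℝ) :
    Complex.log u = Real.log u + (if u < 0 then (Real.pi : ℂ) else 0) * Complex.I := by
  apply Complex.ext
  · rw [Complex.log_ofReal_re]
    split_ifs <;> simp
  · rw [Complex.log_im]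
    split_ifs with h
    · rw [Complex.arg_ofReal_of_neg h]; simp
    · rw [Complex.arg_ofReal_of_nonneg (not_lt.mp h)]; simp

theorem hasDerivAt_log_ofReal {u : ℝ} (hu : u ≠ 0) :
    HasDerivAt (fun v : ℝ => Complex.log v) ((u : ℂ)⁻¹) u := by
  have h := (Real.hasDerivAt_log hu).ofReal_comp
  simp_rw [log_ofReal_eq]
  have hc : (fun v : ℝ => (if v < 0 then (Real.pi : ℂ) else 0) * Complex.I) =ᶠ[𝓝 u]
      fun _ => (if u < 0 then (Real.pi : ℂ) else 0) * Complex.I := by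
    rcases lt_or_gt_of_ne hu with h0 | h0
    · filter_upwards [gt_mem_nhds h0] with v hv
      rw [if_pos hv, if_pos h0]
    · filter_upwards [lt_mem_nhds h0] with v hv
      rw [if_neg (not_lt.mpr hv.le), if_neg (not_lt.mpr h0.le)]
  have h2 := h.add ((hasDerivAt_const u ((if u < 0 then (Real.pi : ℂ) else 0) *
    Complex.I)).congr_of_eventuallyEq hc)
  rw [add_zero, Complex.ofReal_inv] at h2
  exact h2

/-- The jump `πi` of the logarithm at `0` is multiplied by `u`. This lets the fundamental theorem of
calculus be applied across a zero of `1 - x t`. -/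
theorem continuous_ofReal_mul_log : Continuous fun u : ℝ => (u : ℂ) * Complex.log u := by
  have e : (fun u : ℝ => (u : ℂ) * Complex.log u) = fun u : ℝ =>
      ((u * Real.log u : ℝ) : ℂ) + ((min u 0 * Real.pi : ℝ) : ℂ) * Complex.I := by
    funext u
    rw [log_ofReal_eq]
    split_ifs with h
    · rw [min_eq_left h.le]; push_cast; ring
    · rw [min_eq_right (not_lt.mp h)]; push_cast; ring
  rw [e]
  have := Real.continuous_mul_log
  fun_prop

/-- The Mellin-type transform of `log (1 - x t)` on `(0, 1]`. -/
noncomputable def logMoment (x : ℝ) (p : ℂ) : ℂ :=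
  ∫ t : ℝ in Ioc 0 1, Complex.log (1 - x * t) * (t : ℂ) ^ (p - 1)

theorem log_one_sub_eq (x t : ℝ) : Complex.log (1 - x * t) = Real.log (1 - x * t) +
    (if 1 < x * t then (Real.pi : ℂ) else 0) * Complex.I := by
  have := log_ofReal_eq (1 - x * t)
  push_cast at this
  rw [this]
  simp only [sub_neg]

theorem integrableOn_indicator_cpow (x : ℝ) {p : ℂ} (hp : 0 < p.re) :
    IntegrableOn (fun t : ℝ => (if 1 < x * t then (Real.pi : ℂ) else 0) * Complex.I *
      (t : ℂ) ^ (p - 1)) (Ioc 0 1) := by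
  have h := (integrableOn_cpow_unit hp).const_mul ((Real.pi : ℂ) * Complex.I)
  have hm : MeasurableSet {t : ℝ | 1 < x * t} := measurableSet_lt (by fun_prop) (by fun_prop)
  refine (h.indicator hm).congr (Eventually.of_forall fun t => ?_)
  by_cases ht : 1 < x * t <;> simp [indicator, ht]

theorem integrableOn_logMoment (x : ℝ) {p : ℂ} (hp : 1 < p.re) :
    IntegrableOn (fun t : ℝ => Complex.log (1 - x * t) * (t : ℂ) ^ (p - 1)) (Ioc 0 1) := by
  have h1 := integrableOn_log_mul_cpow (f := fun t => 1 - x * t) (q := p - 1)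
    (fun t => by fun_prop) (by simpa using hp)
  refine (h1.add (integrableOn_indicator_cpow x (p := p) (by linarith))).congr
    (Eventually.of_forall fun t => ?_)
  simp only [Pi.add_apply]
  rw [log_one_sub_eq, add_mul]

/-- The logarithm has imaginary part `π` exactly where `x t > 1`, that is on `(1/x, 1]`, and there
`t ^ (p - 1)` is integrated in closed form. -/
theorem logMoment_eq (x : ℝ) {p : ℂ} (hp : 1 < p.re) :
    logMoment x p = (∫ t : ℝ in Ioc 0 1, (Real.log (1 - x * t) : ℂ) * (t : ℂ) ^ (p - 1)) +
      if 1 < x then Real.pi * Complex.I * (1 - (x : ℂ) ^ (-p)) / p else 0 := by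
  have h1 := integrableOn_log_mul_cpow (f := fun t => 1 - x * t) (q := p - 1)
    (fun t => by fun_prop) (by simpa using hp)
  have h2 := integrableOn_indicator_cpow x (p := p) (by linarith)
  have e : logMoment x p = ∫ t : ℝ in Ioc 0 1, ((Real.log (1 - x * t) : ℂ) * (t : ℂ) ^ (p - 1) +
      (if 1 < x * t then (Real.pi : ℂ) else 0) * Complex.I * (t : ℂ) ^ (p - 1)) := by
    rw [logMoment]
    refine integral_congr_ae (Eventually.of_forall fun t => ?_)
    simp only
    rw [log_one_sub_eq, add_mul]
  rw [e, integral_add h1 h2]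
  congr 1
  split_ifs with hx
  · have hx0 : 0 < x := by linarith
    have hp0 : p ≠ 0 := by rintro rfl; simp at hp; linarith
    have e2 : ∫ t : ℝ in Ioc 0 1, (if 1 < x * t then (Real.pi : ℂ) else 0) * Complex.I *
        (t : ℂ) ^ (p - 1) = ∫ t : ℝ in Ioc x⁻¹ 1, Real.pi * Complex.I * (t : ℂ) ^ (p - 1) := by
      have hsub : Ioc x⁻¹ 1 ⊆ Ioc (0 : ℝ) 1 := Ioc_subset_Ioc_left (inv_nonneg.mpr hx0.le)
      rw [← inter_eq_right.mpr hsub, ← setIntegral_indicator measurableSet_Ioc]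
      refine setIntegral_congr_fun measurableSet_Ioc fun t ht => ?_
      by_cases h : 1 < x * t
      · have : t ∈ Ioc x⁻¹ 1 := ⟨by rwa [inv_lt_iff_one_lt_mul₀ hx0, mul_comm], ht.2⟩
        simp [h, this]
      · have : t ∉ Ioc x⁻¹ 1 := fun h' => h (by
          have := h'.1
          rwa [inv_lt_iff_one_lt_mul₀ hx0, mul_comm] at this)
        simp [h, this]
    rw [e2, integral_const_mul, ← intervalIntegral.integral_of_le (inv_le_one_of_one_le₀ hx.le),
      integral_cpow (Or.inl (by simp; linarith)), sub_add_cancel, Complex.ofReal_one,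
      Complex.one_cpow, Complex.ofReal_inv, Complex.inv_cpow, Complex.cpow_neg]
    · ring
    · rw [Complex.arg_ofReal_of_nonneg hx0.le]
      exact Real.pi_pos.ne
  · refine setIntegral_eq_zero_of_forall_eq_zero fun t ht => ?_
    have : ¬ 1 < x * t := by
      push Not at hx ⊢
      rcases le_or_gt x 0 with h | h
      · nlinarith [ht.1]
      · calc x * t ≤ x * 1 := by gcongr; exact ht.2
          _ ≤ 1 := by linarith
    simp [this]

/-- Integration of the derivative of `(1 - x t) log (1 - x t) t ^ p` over `[0, 1]`. -/
theorem logMoment_add_one (x : ℝ) {p : ℂ} (hp : 1 < p.re) :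
    (p + 1) * x * logMoment x (p + 1) =
      p * logMoment x p - x / (p + 1) - (1 - x) * Complex.log (1 - x) := by
  have hp0 : p ≠ 0 := by rintro rfl; simp at hp; linarith
  have hp1 : 1 < (p + 1).re := by simp; linarith
  have i1 := integrableOn_logMoment x hp
  have i2 := integrableOn_logMoment x hp1
  have i3 := integrableOn_cpow_unit (w := p + 1) (by linarith)
  rw [add_sub_cancel_right] at i2 i3
  set φ : ℝ → ℂ := fun t => (((1 - x * t : ℝ) : ℂ) * Complex.log ((1 - x * t : ℝ) : ℂ)) *
    (t : ℂ) ^ p with hφ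
  set φ' : ℝ → ℂ := fun t => p * (Complex.log (1 - x * t) * (t : ℂ) ^ (p - 1)) -
    (p + 1) * x * (Complex.log (1 - x * t) * (t : ℂ) ^ p) - x * (t : ℂ) ^ p with hφ'
  have hcont : ContinuousOn φ (Icc 0 1) := by
    refine Continuous.continuousOn ?_
    exact (continuous_ofReal_mul_log.comp (f := fun t : ℝ => 1 - x * t) (by fun_prop)).mul
      (Complex.continuous_ofReal_cpow_const (by linarith))
  have hint : IntegrableOn φ' (Ioc 0 1) :=
    ((i1.const_mul p).sub (i2.const_mul ((p + 1) * x))).sub (i3.const_mul x)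
  have hderiv : ∀ t ∈ Ioo (0 : ℝ) 1 \ {t | 1 - x * t = 0}, HasDerivAt φ (φ' t) t := by
    rintro t ⟨ht, hxt⟩
    have hxt' : 1 - x * t ≠ 0 := hxt
    have ht0 : (t : ℂ) ≠ 0 := by exact_mod_cast ht.1.ne'
    have d0 : HasDerivAt (fun t : ℝ => 1 - x * t) (-x) t := by
      simpa using ((hasDerivAt_id t).const_mul x).const_sub 1
    have d1 := (hasDerivAt_log_ofReal hxt').scomp t d0
    have d2 := d0.ofReal_comp
    have d3 : HasDerivAt (fun t : ℝ => (t : ℂ) ^ p) (p * (t : ℂ) ^ (p - 1)) t := by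
      have := hasDerivAt_ofReal_cpow_const' (r := p - 1) ht.1.ne'
        (by intro h; exact hp0 (by linear_combination h))
      rw [sub_add_cancel] at this
      have h2 := this.const_mul p
      convert! h2 using 1
      funext y
      field_simp
    have d4 := (d2.mul d1).mul d3
    convert! d4 using 1
    simp only [hφ', Pi.mul_apply, Function.comp_apply]
    rw [Complex.real_smul]
    have hu : ((1 - x * t : ℝ) : ℂ) ≠ 0 := by exact_mod_cast hxt'
    have e : (t : ℂ) ^ p = t * (t : ℂ) ^ (p - 1) := by
      rw [Complex.cpow_sub _ _ ht0, Complex.cpow_one]; field_simp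
    have e2 : ((1 - x * t : ℝ) : ℂ) = 1 - x * t := by push_cast; ring
    rw [e, mul_left_comm (((1 - x * t : ℝ) : ℂ)) ((-x : ℝ) : ℂ), mul_inv_cancel₀ hu, e2]
    push_cast
    ring
  have hcount : {t : ℝ | 1 - x * t = 0}.Countable := by
    refine Set.Countable.mono (s₂ := {x⁻¹}) (fun t ht => ?_) (countable_singleton _)
    have : 1 - x * t = 0 := ht
    exact eq_inv_of_mul_eq_one_right (by linarith)
  have h := integral_eq_of_hasDerivAt_off_countable_of_le φ φ' zero_le_one hcount hcont hderiv
    ((intervalIntegrable_iff_integrableOn_Ioc_of_le zero_le_one).mpr hint)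
  have hA : IntegrableOn (fun t : ℝ => p * (Complex.log (1 - x * t) * (t : ℂ) ^ (p - 1)) -
      (p + 1) * x * (Complex.log (1 - x * t) * (t : ℂ) ^ p)) (Ioc 0 1) :=
    (i1.const_mul p).sub (i2.const_mul ((p + 1) * x))
  simp only [hφ'] at h
  rw [intervalIntegral.integral_of_le zero_le_one, integral_sub hA (i3.const_mul x),
    integral_sub (i1.const_mul p) (i2.const_mul ((p + 1) * x)),
    integral_const_mul, integral_const_mul, integral_const_mul] at h
  have e3 := integral_cpow_unit (w := p + 1) (by linarith)
  rw [add_sub_cancel_right] at e3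
  have e4 : φ 1 - φ 0 = (1 - x) * Complex.log (1 - x) := by
    simp [hφ, Complex.zero_cpow hp0]
  rw [e4, e3] at h
  rw [logMoment, logMoment, add_sub_cancel_right]
  linear_combination -h

theorem gaussKernel_eq_logMoment (x : ℝ) {w : ℂ} (hw : 1 < w.re) :
    gaussKernel w x = logMoment x w - x * logMoment x (w + 1) + x / (w + 1) := by
  have hw1 : 1 < (w + 1).re := by simp; linarith
  have i1 := integrableOn_logMoment x hw
  have i2 := integrableOn_logMoment x hw1
  have i3 := integrableOn_cpow_unit (w := w + 1) (by linarith)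
  have e3 := integral_cpow_unit (w := w + 1) (by linarith)
  rw [add_sub_cancel_right] at i2 i3 e3
  have hA : IntegrableOn (fun t : ℝ => Complex.log (1 - x * t) * (t : ℂ) ^ (w - 1) -
      x * (Complex.log (1 - x * t) * (t : ℂ) ^ w)) (Ioc 0 1) := i1.sub (i2.const_mul (x : ℂ))
  rw [gaussKernel, logMoment, logMoment, div_eq_mul_one_div (x : ℂ), ← e3, add_sub_cancel_right,
    ← integral_const_mul, ← integral_const_mul, ← integral_sub i1 (i2.const_mul _),
    ← integral_add hA (i3.const_mul _)]
  refine setIntegral_congr_fun measurableSet_Ioc fun t ht => ?_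
  have ht0 : (t : ℂ) ≠ 0 := by exact_mod_cast ht.1.ne'
  have e : (t : ℂ) ^ w = t * (t : ℂ) ^ (w - 1) := by
    rw [Complex.cpow_sub _ _ ht0, Complex.cpow_one]; field_simp
  simp only [logPrimitive]
  rw [e]
  ring

/-- The summand of the series in `logSineH` as a logarithmic integral, in the left half plane. -/
theorem neg_mul_gauss2F1_div {s : ℂ} (hs : s.re < -2) {x : ℝ} (hx : x ≠ 1) :
    -(x : ℂ) * gauss2F1 1 (1 - s) (2 - s) x / (s * (1 - s)) =
      logMoment x (-s) + Complex.log (1 - x) / s := by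
  have hs2 : ∀ n : ℕ, 2 ≤ n → s ≠ n := by
    rintro n - rfl
    simp at hs
    linarith [(Nat.cast_nonneg n : (0 : ℝ) ≤ n)]
  have hne : ∀ y : ℝ, 0 ≤ y → (y : ℂ) - s ≠ 0 := by
    intro y hy h
    have := congrArg Complex.re h
    simp at this
    linarith
  have h0 : s ≠ 0 := by have := hne 0 le_rfl; intro h; simp [h] at this
  have h1 : (1 : ℂ) - s ≠ 0 := by simpa using hne 1 zero_le_one
  have h2 : (2 : ℂ) - s ≠ 0 := by simpa using hne 2 zero_le_two
  -- The kernel at `1 - s` involves the moments at `1 - s` and `2 - s`; the recurrence, used twice,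
  -- brings both down to `-s`.
  have r1 := logMoment_add_one x (p := -s) (by simp; linarith)
  have r2 := logMoment_add_one x (p := 1 - s) (by simp; linarith)
  have r3 := gaussKernel_eq_logMoment x (w := 1 - s) (by simp; linarith)
  rw [show -s + 1 = 1 - s by ring] at r1
  rw [show 1 - s + 1 = 2 - s by ring] at r2 r3
  rw [gauss2F1_eq_gaussForm hs2 (N := 0) (by simp; linarith) (by exact_mod_cast hx), gaussForm]
  simp only [zero_add, Finset.range_one, Finset.sum_singleton, pow_one, Nat.cast_zero, pow_zero,
    mul_one, gaussRemainder]
  rw [r3, div_eq_iff (mul_ne_zero h0 h1)]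
  set L := Complex.log (1 - (x : ℂ))
  set l₀ := logMoment x (-s)
  set l₁ := logMoment x (1 - s)
  set l₂ := logMoment x (2 - s)
  rw [show (1 : ℂ) - s + 1 = 2 - s by ring]
  linear_combination (norm := (field_simp; ring)) ((1 - s) ^ 2 * x) * r2 - (1 - s) * r1

/-! ### The logarithm of the sine product and its termwise integration. -/

/-- The logarithm of the factor `1 - y / k` of the sine product; it is `log |y|` for `k = 0`. -/
noncomputable def latticeLog (y : ℝ) (k : ℤ) : ℝ := Real.log (k - y) - Real.log k

theorem shell_ofReal (f : ℤ → ℝ) (K : ℕ) :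
    shell (fun k => (f k : ℂ)) K = ((∑ k ∈ ({(K : ℤ), -(K : ℤ)} : Finset ℤ), f k : ℝ) : ℂ) := by
  rw [shell]; push_cast; rfl

theorem sum_latticeLog_of_pos {y : ℝ} {K : ℕ} (hK : 0 < K) (h1 : (K : ℝ) ≠ y) (h2 : -(K : ℝ) ≠ y) :
    ∑ k ∈ ({(K : ℤ), -(K : ℤ)} : Finset ℤ), latticeLog y k = Real.log (1 - y ^ 2 / K ^ 2) := by
  have hK0 : (K : ℝ) ≠ 0 := by positivity
  rw [Finset.sum_pair (by omega), latticeLog, latticeLog]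
  push_cast
  have e : (1 : ℝ) - y ^ 2 / K ^ 2 = (K - y) / K * ((-K - y) / (-K)) := by
    field_simp; ring
  have n1 : (K : ℝ) - y ≠ 0 := sub_ne_zero.mpr h1
  have n2 : -(K : ℝ) - y ≠ 0 := sub_ne_zero.mpr h2
  rw [e, Real.log_mul (div_ne_zero n1 hK0) (div_ne_zero n2 (neg_ne_zero.mpr hK0)),
    Real.log_div n1 hK0, Real.log_div n2 (neg_ne_zero.mpr hK0)]

theorem abs_sum_latticeLog_le {y Y : ℝ} (hy : |y| ≤ Y) {K : ℕ} (hK : 2 * Y + 1 ≤ K) :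
    |∑ k ∈ ({(K : ℤ), -(K : ℤ)} : Finset ℤ), latticeLog y k| ≤ 2 * Y ^ 2 * (1 / (K : ℝ) ^ 2) := by
  have hY : 0 ≤ Y := (abs_nonneg _).trans hy
  have hK0 : (0 : ℝ) < K := by linarith
  have hy2 : y ^ 2 ≤ Y ^ 2 := by rw [← sq_abs]; gcongr
  rw [sum_latticeLog_of_pos (by exact_mod_cast hK0) (by have := (abs_le.mp hy).2; intro h; linarith)
    (by have := (abs_le.mp hy).1; intro h; linarith)]
  set v := y ^ 2 / (K : ℝ) ^ 2 with hv
  have hv0 : 0 ≤ v := by positivity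
  have hvY : v ≤ Y ^ 2 * (1 / (K : ℝ) ^ 2) := by
    rw [hv, div_eq_mul_one_div]; gcongr
  have hv1 : v ≤ 1 / 2 := by
    rw [hv, div_le_iff₀ (by positivity)]
    nlinarith
  have hpos : 0 < 1 - v := by linarith
  have u1 := Real.log_le_sub_one_of_pos hpos
  have u2 := Real.one_sub_inv_le_log_of_pos hpos
  have u3 : (1 - v)⁻¹ ≤ 1 + 2 * v := by
    rw [inv_le_iff_one_le_mul₀ hpos]
    nlinarith
  rw [abs_le]
  constructor <;> linarith

theorem summable_sum_latticeLog (y : ℝ) :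
    Summable fun K : ℕ => ∑ k ∈ ({(K : ℤ), -(K : ℤ)} : Finset ℤ), latticeLog y k := by
  obtain ⟨K₀, hK₀⟩ := exists_nat_ge (2 * |y| + 1)
  refine Summable.of_norm_bounded_eventually_nat (summable_const_div_sq (2 * |y| ^ 2)) ?_
  filter_upwards [eventually_ge_atTop K₀] with K hK
  exact abs_sum_latticeLog_le le_rfl (hK₀.trans (by exact_mod_cast hK))

/-- The logarithm of the sine product. -/
theorem hasSum_latticeLog {y : ℝ} (hy : ∀ m : ℤ, y ≠ m) :
    HasSum (fun K : ℕ => ∑ k ∈ ({(K : ℤ), -(K : ℤ)} : Finset ℤ), latticeLog y k)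
      (Real.log (Real.sin (Real.pi * y)) - Real.log Real.pi) := by
  have hsin : Real.sin (Real.pi * y) ≠ 0 := by
    rw [Ne, Real.sin_eq_zero_iff]
    rintro ⟨n, hn⟩
    refine hy n ?_
    have := Real.pi_ne_zero
    field_simp at hn
    linarith
  have hy0 : y ≠ 0 := by simpa using hy 0
  refine (summable_sum_latticeLog y).hasSum_iff_tendsto_nat.mpr ?_
  refine (tendsto_add_atTop_iff_nat 1).mp ?_
  have h := ((Real.tendsto_euler_sin_prod y).log hsin).sub_const (Real.log Real.pi)
  refine h.congr fun n => ?_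
  have hfac : ∀ j ∈ Finset.range n, (1 : ℝ) - y ^ 2 / ((j : ℝ) + 1) ^ 2 ≠ 0 := by
    intro j _ h
    have hj : (0 : ℝ) < (j : ℝ) + 1 := by positivity
    rw [sub_eq_zero, eq_comm, div_eq_one_iff_eq (by positivity), sq_eq_sq_iff_eq_or_eq_neg] at h
    rcases h with h | h
    · exact hy (j + 1) (by push_cast; exact h)
    · exact hy (-(j + 1)) (by push_cast; linarith)
  rw [Real.log_mul (mul_ne_zero Real.pi_ne_zero hy0) (Finset.prod_ne_zero_iff.mpr hfac),
    Real.log_mul Real.pi_ne_zero hy0, Real.log_prod hfac, Finset.sum_range_succ']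
  have e0 : ∑ k ∈ ({((0 : ℕ) : ℤ), -((0 : ℕ) : ℤ)} : Finset ℤ), latticeLog y k = Real.log y := by
    simp [latticeLog]
  rw [e0]
  have e1 : ∀ j ∈ Finset.range n, ∑ k ∈ ({((j + 1 : ℕ) : ℤ), -((j + 1 : ℕ) : ℤ)} : Finset ℤ),
      latticeLog y k = Real.log (1 - y ^ 2 / ((j : ℝ) + 1) ^ 2) := by
    intro j _
    rw [sum_latticeLog_of_pos (by omega)]
    · push_cast; rfl
    · have := hy ((j + 1 : ℕ) : ℤ)
      push_cast at this ⊢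
      exact this.symm
    · have := hy (-((j + 1 : ℕ) : ℤ))
      push_cast at this ⊢
      exact this.symm
  rw [Finset.sum_congr rfl e1]
  ring

/-- Passing from `m` to `m + 1` shifts `log |k - m|` by one index, so the sum over `|k| ≤ N`
telescopes to its two ends. -/
theorem sum_latticeLog_add_one_sub (m : ℤ) (N : ℕ) :
    ∑ K ∈ Finset.range (N + 1), ∑ k ∈ ({(K : ℤ), -(K : ℤ)} : Finset ℤ),
      (latticeLog (m + 1 : ℤ) k - latticeLog m k) =
      Real.log (N + m + 1) - Real.log (N - m) := by
  induction N with
  | zero =>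
    simp only [zero_add, Finset.range_one, Finset.sum_singleton, Nat.cast_zero, neg_zero,
      Finset.insert_eq_of_mem, Finset.mem_singleton, latticeLog]
    rw [← Real.log_neg_eq_log ((m : ℝ) + 1)]
    push_cast
    ring_nf
  | succ N ih =>
    rw [Finset.sum_range_succ, ih, Finset.sum_pair (by omega)]
    simp only [latticeLog]
    rw [← Real.log_neg_eq_log ((N + 1 : ℕ) + (m : ℝ) + 1), ← Real.log_neg_eq_log ((N : ℝ) + m + 1)]
    push_cast
    ring_nf

/-- At an integer `m` the vanishing factor drops out because `log 0 = 0`. The sum does not depend on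
`m`, since the telescoped ends `log ((N+m+1)/(N-m))` tend to zero, and for `m = 0` every term is
zero. -/
theorem hasSum_latticeLog_int (m : ℤ) :
    HasSum (fun K : ℕ => ∑ k ∈ ({(K : ℤ), -(K : ℤ)} : Finset ℤ), latticeLog m k) 0 := by
  have hstep : ∀ m : ℤ,
      ∑' K : ℕ, ∑ k ∈ ({(K : ℤ), -(K : ℤ)} : Finset ℤ), latticeLog (m + 1 : ℤ) k =
      ∑' K : ℕ, ∑ k ∈ ({(K : ℤ), -(K : ℤ)} : Finset ℤ), latticeLog m k := by
    intro m
    have h1 := (summable_sum_latticeLog ((m + 1 : ℤ) : ℝ)).hasSum.sub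
      (summable_sum_latticeLog (m : ℝ)).hasSum
    have h2 := (tendsto_add_atTop_iff_nat 1).mpr h1.tendsto_sum_nat
    have h3 : Tendsto (fun N : ℕ => Real.log (N + m + 1) - Real.log (N - m)) atTop (𝓝 0) := by
      have e : Tendsto (fun N : ℕ => Real.log (1 + (2 * m + 1) / ((N : ℝ) - m))) atTop (𝓝 0) := by
        have hd : Tendsto (fun N : ℕ => (N : ℝ) - m) atTop atTop :=
          tendsto_atTop_add_const_right _ (-(m : ℝ)) tendsto_natCast_atTop_atTop
        have := ((tendsto_const_nhds (x := (2 * m + 1 : ℝ))).div_atTop hd).const_add 1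
        rw [add_zero] at this
        simpa using this.log one_ne_zero
      refine e.congr' ?_
      filter_upwards [eventually_gt_atTop (m.natAbs + 1)] with N hN
      have hN' : |(m : ℝ)| + 1 < N := by
        have : ((m.natAbs + 1 : ℕ) : ℝ) < N := by exact_mod_cast hN
        push_cast at this
        rwa [Nat.cast_natAbs, Int.cast_abs] at this
      have a1 := le_abs_self (m : ℝ)
      have a2 := neg_abs_le (m : ℝ)
      rw [← Real.log_div (by linarith) (by linarith)]
      congr 1
      field_simp [show (N : ℝ) - m ≠ 0 by linarith]
      ring
    have h4 : (fun N : ℕ => ∑ K ∈ Finset.range (N + 1),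
        (∑ k ∈ ({(K : ℤ), -(K : ℤ)} : Finset ℤ), latticeLog (m + 1 : ℤ) k -
          ∑ k ∈ ({(K : ℤ), -(K : ℤ)} : Finset ℤ), latticeLog m k)) =
        fun N : ℕ => Real.log (N + m + 1) - Real.log (N - m) := by
      funext N
      rw [← sum_latticeLog_add_one_sub]
      refine Finset.sum_congr rfl fun K _ => ?_
      rw [Finset.sum_sub_distrib]
    rw [h4] at h2
    have := tendsto_nhds_unique h2 h3
    linarith
  have h0 : ∑' K : ℕ, ∑ k ∈ ({(K : ℤ), -(K : ℤ)} : Finset ℤ), latticeLog m k = 0 := by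
    induction m using Int.induction_on with
    | zero => simp [latticeLog]
    | succ n ih =>
      have := hstep n
      rw [this, ih]
    | pred n ih =>
      have := hstep (-n - 1)
      rw [sub_add_cancel] at this
      rw [← this, ih]
  rw [← h0]
  exact (summable_sum_latticeLog _).hasSum

theorem analyticAt_affine (a b : ℝ) (k : ℤ) (t : ℝ) :
    AnalyticAt ℝ (fun t : ℝ => (k : ℝ) - (a * t + b)) t := by fun_prop

theorem integrableOn_latticeLog (a b : ℝ) (k : ℤ) {q : ℂ} (hq : 0 < q.re) :
    IntegrableOn (fun t : ℝ => (latticeLog (a * t + b) k : ℂ) * (t : ℂ) ^ q) (Ioc 0 1) := by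
  have h1 := integrableOn_log_mul_cpow (analyticAt_affine a b k) hq
  have h2 := (integrableOn_cpow_unit (w := q + 1) (by simp; linarith)).const_mul
    (Real.log k : ℂ)
  rw [add_sub_cancel_right] at h2
  refine (h1.sub h2).congr (Eventually.of_forall fun t => ?_)
  simp only [Pi.sub_apply, latticeLog]
  push_cast
  ring

theorem ae_affine_ne_int {a : ℝ} (ha : a ≠ 0) (b : ℝ) :
    ∀ᵐ t : ℝ ∂volume.restrict (Ioc 0 1), ∀ m : ℤ, a * t + b ≠ m := by
  refine ae_restrict_of_ae ?_
  rw [ae_all_iff]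
  intro m
  have : ∀ᵐ t : ℝ ∂volume, t ≠ (m - b) / a := Measure.ae_ne _ _
  filter_upwards [this] with t ht h
  apply ht
  field_simp
  linarith

/-- Termwise integration of the logarithm of the sine product. -/
theorem hasSum_integral_latticeLog {a : ℝ} (ha : a ≠ 0) (b : ℝ) {q : ℂ} (hq : 0 < q.re) :
    HasSum (shell fun k => ∫ t : ℝ in Ioc 0 1, (latticeLog (a * t + b) k : ℂ) * (t : ℂ) ^ q)
      (∫ t : ℝ in Ioc 0 1, ((Real.log (Real.sin (Real.pi * (a * t + b))) - Real.log Real.pi : ℝ)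
        : ℂ) * (t : ℂ) ^ q) := by
  set F : ℕ → ℝ → ℂ := fun K t =>
    ((∑ k ∈ ({(K : ℤ), -(K : ℤ)} : Finset ℤ), latticeLog (a * t + b) k : ℝ) : ℂ) * (t : ℂ) ^ q
    with hF
  have hFe : ∀ K t, F K t = ∑ k ∈ ({(K : ℤ), -(K : ℤ)} : Finset ℤ),
      (latticeLog (a * t + b) k : ℂ) * (t : ℂ) ^ q := by
    intro K t
    simp only [hF]
    push_cast
    rw [Finset.sum_mul]
  have hint : ∀ K, IntegrableOn (F K) (Ioc 0 1) := by
    intro K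
    refine (integrable_finsetSum ({(K : ℤ), -(K : ℤ)} : Finset ℤ) fun k _ =>
      integrableOn_latticeLog a b k hq).congr (Eventually.of_forall fun t => ?_)
    exact (hFe K t).symm
  set Y := |a| + |b| with hY
  obtain ⟨K₀, hK₀⟩ := exists_nat_ge (2 * Y + 1)
  have hY0 : 0 ≤ Y := by positivity
  have hsum : Summable fun K => ∫ t in Ioc (0 : ℝ) 1, ‖F K t‖ := by
    refine Summable.of_norm_bounded_eventually_nat (summable_const_div_sq (2 * Y ^ 2)) ?_
    filter_upwards [eventually_ge_atTop K₀] with K hK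
    have hb : ∀ t ∈ Ioc (0 : ℝ) 1, ‖F K t‖ ≤ 2 * Y ^ 2 * (1 / (K : ℝ) ^ 2) := by
      intro t ht
      have hy : |a * t + b| ≤ Y := by
        refine (abs_add_le _ _).trans ?_
        rw [abs_mul, abs_of_pos ht.1]
        have := mul_le_of_le_one_right (abs_nonneg a) ht.2
        linarith
      simp only [hF]
      rw [norm_mul, Complex.norm_real, Real.norm_eq_abs]
      have h1 := abs_sum_latticeLog_le hy (K := K) (hK₀.trans (by exact_mod_cast hK))
      have h2 : ‖(t : ℂ) ^ q‖ ≤ 1 := by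
        rw [Complex.norm_cpow_eq_rpow_re_of_pos ht.1]
        exact Real.rpow_le_one ht.1.le ht.2 hq.le
      calc _ ≤ (2 * Y ^ 2 * (1 / (K : ℝ) ^ 2)) * 1 := by gcongr
        _ = _ := mul_one _
    rw [Real.norm_of_nonneg (integral_nonneg fun t => norm_nonneg _)]
    calc ∫ t in Ioc (0 : ℝ) 1, ‖F K t‖ ≤ ∫ t in Ioc (0 : ℝ) 1, 2 * Y ^ 2 * (1 / (K : ℝ) ^ 2) :=
          setIntegral_mono_on (hint K).norm (integrableOn_const (by simp)) measurableSet_Ioc hb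
      _ = _ := by simp
  have h := hasSum_integral_of_summable_integral_norm hint hsum
  convert! h using 1
  · funext K
    rw [shell, ← integral_finsetSum _ fun k _ => integrableOn_latticeLog a b k hq]
    refine integral_congr_ae (Eventually.of_forall fun t => ?_)
    exact (hFe K t).symm
  · refine integral_congr_ae ?_
    filter_upwards [ae_affine_ne_int ha b] with t ht
    simp only [hF]
    rw [tsum_mul_right, ← Complex.ofReal_tsum, (hasSum_latticeLog ht).tsum_eq]

/-! ### The integral of a single logarithmic factor. -/

theorem integral_cpow_neg_sub_one {s : ℂ} (hs : s.re < 0) :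
    ∫ t : ℝ in Ioc 0 1, (t : ℂ) ^ (-s - 1) = -(1 / s) := by
  rw [integral_cpow_unit (w := -s) (by simpa using hs)]
  ring

/-- With `x = a/(k - b)` the factor is `(k - b)(1 - x t)`, and `neg_mul_gauss2F1_div` applies. For
`x > 1` the imaginary parts of the moment and of `log (1 - x) / s` do not cancel: they leave the
term `πi x^s / s`, which has to be subtracted. -/
theorem integral_latticeLog_of_ne {s : ℂ} (hs : s.re < -2) (a b : ℝ) {k : ℤ} (h1 : (k : ℝ) ≠ b)
    (h2 : (k : ℝ) ≠ a + b) :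
    ∫ t : ℝ in Ioc 0 1, (latticeLog (a * t + b) k : ℂ) * (t : ℂ) ^ (-s - 1) =
      -(1 / s) * latticeLog (a + b) k + gaussTerm a b 1 s k / (s * (1 - s)) +
      (if 1 < a / (k - b) then
        -(Real.pi * Complex.I * ((a / (k - b) : ℝ) : ℂ) ^ s / s) else 0) := by
  have hkb : (k : ℝ) - b ≠ 0 := sub_ne_zero.mpr h1
  set x := a / (k - b) with hx
  have hnode : node (a * 1) b k = x := by
    rw [node, if_neg (by rw [mul_one]; tauto), mul_one, hx, ← div_neg, neg_sub]
  have hx1 : x ≠ 1 := by rw [← hnode]; exact node_ne_one _ _ _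
  have hs0 : s ≠ 0 := by rintro rfl; simp at hs; linarith
  rw [gaussTerm_eq_node, hnode, neg_mul_gauss2F1_div hs hx1, logMoment_eq x (by simp; linarith),
    neg_neg]
  have hax : a = x * (k - b) := by rw [hx]; field_simp
  have hl1 : latticeLog (a + b) k = Real.log (k - b) + Real.log (1 - x) - Real.log k := by
    rw [latticeLog, ← Real.log_mul hkb (sub_ne_zero.mpr hx1.symm)]
    congr 2
    linear_combination -hax
  have hint : ∫ t : ℝ in Ioc 0 1, (latticeLog (a * t + b) k : ℂ) * (t : ℂ) ^ (-s - 1) =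
      ∫ t : ℝ in Ioc 0 1, ((Real.log (k - b) - Real.log k : ℝ) * (t : ℂ) ^ (-s - 1) +
        (Real.log (1 - x * t) : ℂ) * (t : ℂ) ^ (-s - 1)) := by
    refine integral_congr_ae ?_
    have hne : ∀ᵐ t : ℝ ∂volume.restrict (Ioc 0 1), t ≠ x⁻¹ :=
      ae_restrict_of_ae (Measure.ae_ne _ _)
    filter_upwards [hne] with t ht
    have hxt : 1 - x * t ≠ 0 := by
      intro h
      exact ht (eq_inv_of_mul_eq_one_right (by linarith))
    have : latticeLog (a * t + b) k = Real.log (k - b) - Real.log k + Real.log (1 - x * t) := by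
      rw [latticeLog]
      have e : (k : ℝ) - (a * t + b) = (k - b) * (1 - x * t) := by
        linear_combination -t * hax
      rw [e, Real.log_mul hkb hxt]
      ring
    rw [this]
    push_cast
    ring
  have i1 := (integrableOn_cpow_unit (w := -s) (by simp; linarith)).const_mul
    ((Real.log (k - b) - Real.log k : ℝ) : ℂ)
  have i2 := integrableOn_log_mul_cpow (f := fun t => 1 - x * t) (q := -s - 1)
    (fun t => by fun_prop) (by simp; linarith)
  rw [hint, integral_add i1 i2, integral_const_mul, integral_cpow_neg_sub_one (by linarith), hl1]
  have hlog := log_one_sub_eq x 1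
  simp only [Complex.ofReal_one, mul_one] at hlog
  rw [hlog]
  push_cast
  split_ifs with h <;> field_simp <;> ring

theorem integral_log_cpow {s : ℂ} (hs : s.re < -2) :
    ∫ t : ℝ in Ioc 0 1, (Real.log t : ℂ) * (t : ℂ) ^ (-s - 1) = -(1 / s ^ 2) := by
  have hs0 : s ≠ 0 := by rintro rfl; simp at hs; linarith
  -- The primitive is `t^(-s) log t + t^(-s)/s`, written with `t log t` to make continuity at `0`
  -- visible.
  set φ : ℝ → ℂ := fun t => ((t * Real.log t : ℝ) : ℂ) * (t : ℂ) ^ (-s - 1) +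
    (t : ℂ) ^ (-s) / s with hφ
  have hcont : ContinuousOn φ (Icc 0 1) := by
    have h1 := Complex.continuous_ofReal_cpow_const (y := -s - 1) (by simp; linarith)
    have h2 := Complex.continuous_ofReal_cpow_const (y := -s) (by simp; linarith)
    have h3 := Complex.continuous_ofReal.comp Real.continuous_mul_log
    exact ((h3.mul h1).add (h2.div_const s)).continuousOn
  have hderiv : ∀ t ∈ Ioo (0 : ℝ) 1 \ ∅, HasDerivAt φ
      (-s * ((Real.log t : ℂ) * (t : ℂ) ^ (-s - 1))) t := by
    rintro t ⟨ht, -⟩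
    have ht0 : (t : ℂ) ≠ 0 := by exact_mod_cast ht.1.ne'
    have hpow : ∀ r : ℂ, r ≠ 0 → HasDerivAt (fun t : ℝ => (t : ℂ) ^ r) (r * (t : ℂ) ^ (r - 1)) t :=
      fun r hr => by
        have := (hasDerivAt_ofReal_cpow_const' (r := r - 1) ht.1.ne'
          (by intro h; exact hr (by linear_combination h))).const_mul r
        rw [sub_add_cancel] at this
        convert! this using 1
        funext y
        field_simp
    have hne : -s - 1 ≠ 0 := by
      intro h
      have := congrArg Complex.re h
      simp at this
      linarith
    have d1 := ((hasDerivAt_id t).mul (Real.hasDerivAt_log ht.1.ne')).ofReal_comp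
    have d := (d1.mul (hpow _ hne)).add ((hpow (-s) (neg_ne_zero.mpr hs0)).div_const s)
    convert! d using 1
    simp only [Pi.mul_apply, id]
    rw [mul_inv_cancel₀ ht.1.ne', Complex.cpow_sub (-s - 1) 1 ht0, Complex.cpow_one]
    generalize (t : ℂ) ^ (-s - 1) = y
    push_cast
    field_simp
    ring
  have hint := integrableOn_log_mul_cpow (f := fun t => t) (q := -s - 1)
    (fun t => by fun_prop) (by simp; linarith)
  have h := integral_eq_of_hasDerivAt_off_countable_of_le φ _ zero_le_one countable_empty hcont
    hderiv ((intervalIntegrable_iff_integrableOn_Ioc_of_le zero_le_one).mpr (hint.const_mul (-s)))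
  rw [intervalIntegral.integral_of_le zero_le_one, integral_const_mul] at h
  have e : φ 1 - φ 0 = 1 / s := by
    simp [hφ, Complex.zero_cpow (neg_ne_zero.mpr hs0)]
  rw [e] at h
  field_simp
  field_simp at h
  linear_combination -h

/-- The integral is the derivative at `h = 0` of `B(u, 1 + h) = Γ(u) Γ(1 + h) / Γ(u + 1 + h)` with
`u = -s`. It is obtained as a limit of difference quotients under the integral sign. -/
theorem integral_log_one_sub_cpow {s : ℂ} (hs : s.re < -2) :
    ∫ t : ℝ in Ioc 0 1, (Real.log (1 - t) : ℂ) * (t : ℂ) ^ (-s - 1) =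
      (Complex.digamma (1 - s) + Real.eulerMascheroniConstant) / s := by
  set u := -s with hu
  have hu2 : 2 < u.re := by simp [hu]; linarith
  have hu0 : u ≠ 0 := by rintro h; rw [h] at hu2; simp at hu2; linarith
  have hΓu : Complex.Gamma u ≠ 0 := Complex.Gamma_ne_zero_of_re_pos (by linarith)
  have hΓu1 : Complex.Gamma (u + 1) = u * Complex.Gamma u := Complex.Gamma_add_one u hu0
  have hΓne : Complex.Gamma (u + 1) ≠ 0 := by rw [hΓu1]; exact mul_ne_zero hu0 hΓu
  set G : ℂ → ℂ := fun h => Complex.Gamma u * Complex.Gamma (1 + h) / Complex.Gamma (u + 1 + h)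
    with hG
  have hd : HasDerivAt G (-(1 / u) * (Complex.digamma (u + 1) + Real.eulerMascheroniConstant))
      0 := by
    have d1 : HasDerivAt (fun h => Complex.Gamma (1 + h))
        (-(Real.eulerMascheroniConstant : ℂ)) 0 := by
      have := Complex.hasDerivAt_Gamma_one
      rw [← add_zero (1 : ℂ)] at this
      exact this.comp_const_add 1 0
    have d2 : HasDerivAt (fun h => Complex.Gamma (u + 1 + h)) (deriv Complex.Gamma (u + 1)) 0 := by
      have := (Complex.differentiableAt_Gamma (u + 1) fun m h => by
        have := congrArg Complex.re h
        simp at this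
        linarith [(Nat.cast_nonneg m : (0 : ℝ) ≤ m)]).hasDerivAt
      rw [← add_zero (u + 1)] at this
      simpa using this.comp_const_add (u + 1) 0
    have d3 := (d1.const_mul (Complex.Gamma u)).div d2 (by simpa using hΓne)
    convert! d3 using 1
    rw [Complex.digamma_def, logDeriv_apply]
    simp only [add_zero, Complex.Gamma_one, mul_one]
    rw [hΓu1] at hΓne ⊢
    field_simp
    ring
  have hbeta : ∀ h : ℝ, 0 ≤ h → G h = Complex.betaIntegral u (1 + h) := by
    intro h hh
    have := Complex.Gamma_mul_Gamma_eq_betaIntegral (s := u) (t := 1 + h) (by linarith)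
      (by simp; linarith)
    simp only [hG]
    rw [this, ← add_assoc, mul_div_cancel_left₀]
    exact Complex.Gamma_ne_zero_of_re_pos (by simp; linarith)
  set v : ℕ → ℝ := fun n => 1 / ((n : ℝ) + 1) with hv
  have hvpos : ∀ n, 0 < v n := fun n => by simp only [hv]; positivity
  have hv0 : Tendsto v atTop (𝓝 0) := tendsto_one_div_add_atTop_nhds_zero_nat
  have ht : Tendsto (fun n => (v n : ℂ)) atTop (𝓝[≠] 0) := by
    refine tendsto_nhdsWithin_iff.mpr ⟨?_, Eventually.of_forall fun n => ?_⟩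
    · have := (Complex.continuous_ofReal.tendsto 0).comp hv0
      simpa only [Complex.ofReal_zero, Function.comp_def] using this
    · simpa using (hvpos n).ne'
  have hs1 : Tendsto (fun n => (v n : ℂ)⁻¹ • (G (0 + v n) - G 0)) atTop
      (𝓝 (-(1 / u) * (Complex.digamma (u + 1) + Real.eulerMascheroniConstant))) :=
    hd.tendsto_slope_zero.comp ht
  have hint := integrableOn_log_mul_cpow (f := fun t => 1 - t) (q := u - 1)
    (fun t => by fun_prop) (by simp; linarith)
  have hs2 : Tendsto (fun n => ∫ t : ℝ in Ioc 0 1,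
      (v n : ℂ)⁻¹ * ((t : ℂ) ^ (u - 1) * (((1 - t) ^ (v n) - 1 : ℝ) : ℂ))) atTop
      (𝓝 (∫ t : ℝ in Ioc 0 1, (Real.log (1 - t) : ℂ) * (t : ℂ) ^ (u - 1))) := by
    have hlt : ∀ᵐ t : ℝ ∂volume.restrict (Ioc 0 1), t ≠ 1 := ae_restrict_of_ae (Measure.ae_ne _ _)
    refine tendsto_integral_of_dominated_convergence
      (fun t => ‖(Real.log (1 - t) : ℂ) * (t : ℂ) ^ (u - 1)‖) (fun n => ?_) hint.norm
      (fun n => ?_) ?_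
    · refine Measurable.aestronglyMeasurable ?_
      fun_prop
    · filter_upwards [ae_restrict_mem measurableSet_Ioc, hlt] with t ht ht1
      have hpos : 0 < 1 - t := by
        rcases ht.2.lt_or_eq with h | h
        · linarith
        · exact absurd h ht1
      rw [norm_mul, norm_mul, norm_mul, mul_comm ‖((t : ℂ) ^ (u - 1))‖, ← mul_assoc]
      gcongr
      rw [norm_inv, Complex.norm_real, Complex.norm_real, Complex.norm_real,
        Real.norm_of_nonneg (hvpos n).le, Real.norm_eq_abs, Real.norm_eq_abs,
        inv_mul_le_iff₀ (hvpos n)]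
      have hl : Real.log (1 - t) ≤ 0 := Real.log_nonpos hpos.le (by linarith [ht.1])
      have h1 : (1 - t) ^ (v n) ≤ 1 := Real.rpow_le_one hpos.le (by linarith [ht.1]) (hvpos n).le
      rw [abs_of_nonpos (by linarith), abs_of_nonpos hl, Real.rpow_def_of_pos hpos]
      -- `exp y ≥ 1 + y` shows that the difference quotient of `(1 - t) ^ h` is at most `|log (1 -
      -- t)|`, uniformly in `n`.
      have := Real.add_one_le_exp (Real.log (1 - t) * v n)
      linarith
    · filter_upwards [ae_restrict_mem measurableSet_Ioc, hlt] with t ht1 ht2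
      have hpos : 0 < 1 - t := by
        rcases ht1.2.lt_or_eq with h | h
        · linarith
        · exact absurd h ht2
      have d : HasDerivAt (fun h : ℝ => (1 - t) ^ h) (Real.log (1 - t)) 0 := by
        have := (hasDerivAt_id (0 : ℝ)).const_rpow (a := 1 - t) hpos
        simpa using this
      have hvn : Tendsto v atTop (𝓝[≠] 0) := tendsto_nhdsWithin_iff.mpr
        ⟨hv0, Eventually.of_forall fun n => by simpa using (hvpos n).ne'⟩
      have h1 := d.tendsto_slope_zero.comp hvn
      have h2 := ((Complex.continuous_ofReal.tendsto _).comp h1).mul_const ((t : ℂ) ^ (u - 1))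
      refine h2.congr fun n => ?_
      simp only [Function.comp_apply, zero_add, smul_eq_mul, Real.rpow_zero]
      push_cast
      ring
  have heq : ∀ n, (v n : ℂ)⁻¹ • (G (0 + v n) - G 0) = ∫ t : ℝ in Ioc 0 1,
      (v n : ℂ)⁻¹ * ((t : ℂ) ^ (u - 1) * (((1 - t) ^ (v n) - 1 : ℝ) : ℂ)) := by
    intro n
    have b0 := hbeta 0 le_rfl
    have c1 := Complex.betaIntegral_convergent (u := u) (v := 1 + v n) (by linarith)
      (by simp; linarith [hvpos n])
    have c0 := Complex.betaIntegral_convergent (u := u) (v := 1 + (0 : ℝ)) (by linarith) (by simp)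
    rw [Complex.ofReal_zero] at b0
    rw [zero_add, hbeta _ (hvpos n).le, b0, Complex.betaIntegral, Complex.betaIntegral]
    rw [Complex.ofReal_zero] at c0
    rw [← intervalIntegral.integral_sub c1 c0, intervalIntegral.integral_of_le zero_le_one,
      integral_const_mul, smul_eq_mul]
    congr 1
    refine setIntegral_congr_fun measurableSet_Ioc fun t ht => ?_
    rw [add_sub_cancel_left, add_sub_cancel_left, Complex.cpow_zero, ← mul_sub,
      Complex.ofReal_sub, Complex.ofReal_cpow (by linarith [ht.2])]
    push_cast
    rfl
  simp_rw [heq] at hs1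
  have := tendsto_nhds_unique hs2 hs1
  rw [this, show u + 1 = 1 - s by rw [hu]; ring, hu]
  have hs0 : s ≠ 0 := by rintro rfl; simp at hs; linarith
  field_simp

/-- The zero of the factor is at `t = 0`, so `log t` is integrated; this is the origin of the term
`1/s²`. -/
theorem integral_latticeLog_of_eq {s : ℂ} (hs : s.re < -2) {a b : ℝ} (ha : 0 < a) {k : ℤ}
    (h : (k : ℝ) = b) :
    ∫ t : ℝ in Ioc 0 1, (latticeLog (a * t + b) k : ℂ) * (t : ℂ) ^ (-s - 1) =
      -(1 / s) * latticeLog (a + b) k - 1 / s ^ 2 := by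
  have i1 := (integrableOn_cpow_unit (w := -s) (by simp; linarith)).const_mul
    ((Real.log a - Real.log k : ℝ) : ℂ)
  have i2 := integrableOn_log_mul_cpow (f := fun t => t) (q := -s - 1)
    (fun t => by fun_prop) (by simp; linarith)
  have hint : ∫ t : ℝ in Ioc 0 1, (latticeLog (a * t + b) k : ℂ) * (t : ℂ) ^ (-s - 1) =
      ∫ t : ℝ in Ioc 0 1, ((Real.log a - Real.log k : ℝ) * (t : ℂ) ^ (-s - 1) +
        (Real.log t : ℂ) * (t : ℂ) ^ (-s - 1)) := by
    refine setIntegral_congr_fun measurableSet_Ioc fun t ht => ?_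
    have : latticeLog (a * t + b) k = Real.log a - Real.log k + Real.log t := by
      rw [latticeLog, h, show b - (a * t + b) = -(a * t) by ring, Real.log_neg_eq_log,
        Real.log_mul ha.ne' ht.1.ne']
      ring
    rw [this]
    push_cast
    ring
  rw [hint, integral_add i1 i2, integral_const_mul, integral_cpow_neg_sub_one (by linarith),
    integral_log_cpow hs, latticeLog, h, show b - (a + b) = -a by ring, Real.log_neg_eq_log]
  push_cast
  ring

/-- The zero is at `t = 1`, which brings in the digamma function. Since `latticeLog (a + b) k` is
`-log |k|` by the convention `log 0 = 0`, the constant `log a` has to be added separately. -/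
theorem integral_latticeLog_of_eq_add {s : ℂ} (hs : s.re < -2) {a b : ℝ} (ha : 0 < a) {k : ℤ}
    (h : (k : ℝ) = a + b) :
    ∫ t : ℝ in Ioc 0 1, (latticeLog (a * t + b) k : ℂ) * (t : ℂ) ^ (-s - 1) =
      -(1 / s) * latticeLog (a + b) k +
      (Complex.digamma (1 - s) + Real.eulerMascheroniConstant - Real.log a) / s := by
  have i1 := (integrableOn_cpow_unit (w := -s) (by simp; linarith)).const_mul
    ((Real.log a - Real.log k : ℝ) : ℂ)
  have i2 := integrableOn_log_mul_cpow (f := fun t => 1 - t) (q := -s - 1)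
    (fun t => by fun_prop) (by simp; linarith)
  have hint : ∫ t : ℝ in Ioc 0 1, (latticeLog (a * t + b) k : ℂ) * (t : ℂ) ^ (-s - 1) =
      ∫ t : ℝ in Ioc 0 1, ((Real.log a - Real.log k : ℝ) * (t : ℂ) ^ (-s - 1) +
        (Real.log (1 - t) : ℂ) * (t : ℂ) ^ (-s - 1)) := by
    refine integral_congr_ae ?_
    have hne : ∀ᵐ t : ℝ ∂volume.restrict (Ioc 0 1), t ≠ 1 :=
      ae_restrict_of_ae (Measure.ae_ne _ _)
    filter_upwards [hne] with t ht
    have : latticeLog (a * t + b) k = Real.log a - Real.log k + Real.log (1 - t) := by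
      rw [latticeLog, h, show a + b - (a * t + b) = a * (1 - t) by ring,
        Real.log_mul ha.ne' (sub_ne_zero.mpr ht.symm)]
      ring
    rw [this]
    push_cast
    ring
  rw [hint, integral_add i1 i2, integral_const_mul, integral_cpow_neg_sub_one (by linarith),
    integral_log_one_sub_cpow hs, latticeLog, h, sub_self, Real.log_zero]
  push_cast
  ring

/-! ### Assembling the function `H` from the sine product. -/

theorem shell_ite_eq (k₀ : ℤ) (v : ℂ) (K : ℕ) :
    shell (fun k => if k = k₀ then v else 0) K = if K = k₀.natAbs then v else 0 := by
  rw [shell, Finset.sum_ite_eq']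
  refine if_congr ?_ rfl rfl
  rw [Finset.mem_insert, Finset.mem_singleton]
  omega

theorem hasSum_shell_of_support {f : ℤ → ℂ} (S : Finset ℤ) (h : ∀ k, k ∉ S → f k = 0) :
    HasSum (shell f) (∑ k ∈ S, f k) := by
  have e : shell f = fun K => ∑ k₀ ∈ S, if K = k₀.natAbs then f k₀ else 0 := by
    funext K
    simp_rw [← shell_ite_eq, ← shell_sum]
    refine shell_congr fun k _ => ?_
    rw [Finset.sum_ite_eq]
    split_ifs with hk
    · rfl
    · exact h k hk
  rw [e]
  exact hasSum_sum fun k₀ _ => hasSum_ite_eq _ _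

open Classical in
theorem hasSum_shell_ite_real (y : ℝ) (v : ℂ) :
    HasSum (shell fun k => if (k : ℝ) = y then v else 0)
      (if ∃ m : ℤ, y = m then v else 0) := by
  by_cases h : ∃ m : ℤ, y = m
  · obtain ⟨m, rfl⟩ := h
    rw [if_pos ⟨m, rfl⟩]
    have := hasSum_shell_of_support (f := fun k : ℤ => if (k : ℝ) = m then v else 0) {m}
      fun k hk => if_neg (by simpa using hk)
    simpa using this
  · rw [if_neg h]
    have := hasSum_shell_of_support (f := fun k : ℤ => if (k : ℝ) = y then v else 0) ∅
      fun k _ => if_neg fun hk => h ⟨k, hk.symm⟩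
    simpa using this

theorem coe_add_intCast_unitAddCircle (x : ℝ) (n : ℤ) :
    ((x + n : ℝ) : UnitAddCircle) = (x : UnitAddCircle) := by
  rw [AddCircle.coe_add]
  have : ((n : ℝ) : UnitAddCircle) = 0 := by
    rw [AddCircle.coe_eq_zero_iff]
    exact ⟨n, by simp⟩
  rw [this, add_zero]

theorem hurwitzZetaAt_of_mem_Ioc (s : ℂ) {x : ℝ} (hx : x ≤ 1) :
    hurwitzZetaAt s x = HurwitzZeta.hurwitzZeta (x : UnitAddCircle) s := by
  have : ⌈x⌉₊ - 1 = 0 := by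
    have : ⌈x⌉₊ ≤ 1 := Nat.ceil_le.mpr (by simpa using hx)
    omega
  rw [hurwitzZetaAt, this]
  simp

theorem hurwitzZetaAt_one_sub_fract (s : ℂ) (b : ℝ) :
    hurwitzZetaAt s (1 - Int.fract b) = HurwitzZeta.hurwitzZeta ((-b : ℝ) : UnitAddCircle) s := by
  rw [hurwitzZetaAt_of_mem_Ioc s (by linarith [Int.fract_nonneg b])]
  congr 1
  rw [← coe_add_intCast_unitAddCircle (-b) (1 + ⌊b⌋)]
  congr 1
  rw [Int.fract]
  push_cast
  ring

/-- Both arguments are congruent to `-b` modulo one, so the difference is the finite sum of the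
removed terms and has no convergence condition. -/
theorem hurwitzZetaAt_sub (s : ℂ) (b : ℝ) (n : ℤ) :
    hurwitzZetaAt s (1 - Int.fract b) - hurwitzZetaAt s (n - b) =
      ∑ j ∈ Finset.range (⌈(n - b : ℝ)⌉₊ - 1), ((n - b - (j + 1) : ℝ) : ℂ) ^ (-s) := by
  rw [hurwitzZetaAt_one_sub_fract, hurwitzZetaAt]
  have : ((n - b : ℝ) : UnitAddCircle) = ((-b : ℝ) : UnitAddCircle) := by
    rw [← coe_add_intCast_unitAddCircle (-b) n]
    congr 1
    ring
  rw [this]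
  ring

theorem ofReal_div_cpow {a y : ℝ} (ha : 0 < a) (hy : 0 < y) (s : ℂ) :
    ((a / y : ℝ) : ℂ) ^ s = (a : ℂ) ^ s * (y : ℂ) ^ (-s) := by
  rw [div_eq_mul_inv, Complex.ofReal_mul, ofReal_mul_cpow ha, Complex.ofReal_inv,
    Complex.inv_cpow, Complex.cpow_neg]
  rw [Complex.arg_ofReal_of_nonneg hy.le]
  exact Real.pi_pos.ne

/-- The poles inside the interval of integration. -/
theorem hasSum_shell_inner_poles {a : ℝ} (ha : 0 < a) (b : ℝ) (s : ℂ) :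
    HasSum (shell fun k => if b < k ∧ (k : ℝ) < a + b then
        -(Real.pi * Complex.I * ((a / (k - b) : ℝ) : ℂ) ^ s / s) else 0)
      (-(Complex.I * (Real.pi * (a : ℂ) ^ s / s) *
        (hurwitzZetaAt s (1 - Int.fract b) - hurwitzZetaAt s (⌈a + b⌉ - b)))) := by
  set n := ⌈a + b⌉ with hn
  have hn1 : a + b ≤ n := Int.le_ceil _
  have hn2 : (n : ℝ) < a + b + 1 := Int.ceil_lt_add_one _
  -- The integers strictly between `b` and `a + b` are `n - 1 - j` with `0 ≤ j < m`: `k < a + b`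
  -- means `k < n`, and `b < k` means `j + 1 < n - b`.
  set m := ⌈(n - b : ℝ)⌉₊ - 1 with hm
  have hmem : ∀ j : ℕ, j ∈ Finset.range m ↔ (j : ℝ) + 1 < n - b := by
    intro j
    rw [Finset.mem_range, hm, Nat.lt_sub_iff_add_lt, Nat.lt_ceil]
    push_cast
    rfl
  have hinj : Set.InjOn (fun j : ℕ => n - 1 - (j : ℤ)) (Finset.range m : Set ℕ) := by
    intro i _ j _ hij
    simp only at hij
    omega
  have h := hasSum_shell_of_support (f := fun k : ℤ => if b < k ∧ (k : ℝ) < a + b then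
    -(Real.pi * Complex.I * ((a / (k - b) : ℝ) : ℂ) ^ s / s) else 0)
    ((Finset.range m).image fun j : ℕ => n - 1 - (j : ℤ)) fun k hk => by
      refine if_neg fun hc => hk ?_
      rw [Finset.mem_image]
      have hkn : k < n := Int.lt_ceil.mpr hc.2
      refine ⟨(n - 1 - k).toNat, ?_, by omega⟩
      rw [hmem]
      have : (((n - 1 - k).toNat : ℤ) : ℝ) = ((n - 1 - k : ℤ) : ℝ) := by
        congr 1; omega
      rw [Int.cast_natCast] at this
      rw [this]
      push_cast
      linarith [hc.1]
  rw [Finset.sum_image hinj] at h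
  rw [hurwitzZetaAt_sub, Finset.mul_sum, ← Finset.sum_neg_distrib]
  convert! h using 1
  refine Finset.sum_congr rfl fun j hj => ?_
  have hj' := (hmem j).mp hj
  have hj0 : (0 : ℝ) ≤ j := Nat.cast_nonneg j
  rw [if_pos ⟨by push_cast; linarith, by push_cast; linarith⟩, ofReal_div_cpow ha]
  · have e : (((n - 1 - (j : ℤ) : ℤ) : ℝ) - b : ℝ) = n - b - (j + 1) := by push_cast; ring
    rw [e]
    ring
  · push_cast
    linarith

-- One formula for all `k`, with the special positions as indicator terms, so that each part can be
-- summed over the shells separately.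
open Classical in
theorem integral_latticeLog {s : ℂ} (hs : s.re < -2) {a : ℝ} (ha : 0 < a) (b : ℝ) (k : ℤ) :
    ∫ t : ℝ in Ioc 0 1, (latticeLog (a * t + b) k : ℂ) * (t : ℂ) ^ (-s - 1) =
      -(1 / s) * latticeLog (a + b) k + 1 / (s * (1 - s)) * gaussTerm a b 1 s k +
      (if (k : ℝ) = b then -(1 / s ^ 2) else 0) +
      (if (k : ℝ) = a + b then
        (Complex.digamma (1 - s) + Real.eulerMascheroniConstant - Real.log a) / s else 0) +
      (if b < k ∧ (k : ℝ) < a + b then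
        -(Real.pi * Complex.I * ((a / (k - b) : ℝ) : ℂ) ^ s / s) else 0) := by
  by_cases h1 : (k : ℝ) = b
  · have hg : gaussTerm a b 1 s k = 0 := by rw [gaussTerm, if_pos (Or.inl h1)]
    rw [integral_latticeLog_of_eq hs ha h1, hg, if_pos h1, if_neg (by linarith), if_neg (by
      rintro ⟨h, -⟩; linarith)]
    ring
  · by_cases h2 : (k : ℝ) = a + b
    · have hg : gaussTerm a b 1 s k = 0 := by rw [gaussTerm, if_pos (Or.inr (by linarith))]
      rw [integral_latticeLog_of_eq_add hs ha h2, hg, if_neg h1, if_pos h2, if_neg (by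
        rintro ⟨-, h⟩; linarith)]
      ring
    · have hiff : (1 < a / (k - b)) ↔ (b < k ∧ (k : ℝ) < a + b) := by
        constructor
        · intro h
          have hpos : 0 < (k : ℝ) - b := by
            by_contra! hc
            have := div_nonpos_of_nonneg_of_nonpos ha.le hc
            linarith
          rw [one_lt_div hpos] at h
          constructor <;> linarith
        · rintro ⟨h, h'⟩
          rw [one_lt_div (by linarith)]
          linarith
      rw [integral_latticeLog_of_ne hs a b h1 h2, if_neg h1, if_neg h2, if_congr hiff rfl rfl]
      ring

theorem real_sin_pi_mul_ne_zero {y : ℝ} (hy : ∀ m : ℤ, y ≠ m) : Real.sin (Real.pi * y) ≠ 0 := by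
  rw [Ne, Real.sin_eq_zero_iff]
  rintro ⟨n, hn⟩
  refine hy n ?_
  have := Real.pi_ne_zero
  field_simp at hn
  linarith

/-- The shell series of the integrals of `latticeLog` is evaluated twice: by termwise integration of
the sine product, and by summing `integral_latticeLog`. The constants `log 2` and `log π` account
for the difference between the sine product and `2 sin`. -/
theorem logSineH_eq_integral_of_pos {s : ℂ} (hs : s.re < -2) {a : ℝ} (ha : 0 < a) (b : ℝ) :
    logSineH a b 1 s = -∫ t : ℝ in Ioc 0 1,
      (Real.log (2 * Real.sin (Real.pi * (a * t + b))) : ℂ) * (t : ℂ) ^ (-s - 1) := by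
  classical
  have hs0 : s ≠ 0 := by rintro rfl; simp at hs; linarith
  have hs2 : ∀ n : ℕ, 2 ≤ n → s ≠ n := by
    rintro n - rfl
    simp at hs
    linarith [(Nat.cast_nonneg n : (0 : ℝ) ≤ n)]
  have hq : 0 < (-s - 1).re := by simp; linarith
  -- `X` is the value of the lattice sum at the endpoint `t = 1`. The two cases correspond to the
  -- digamma term and the `log sin` term of `logSineH`.
  set X : ℝ := if ∃ m : ℤ, a + b = m then 0 else
    Real.log (Real.sin (Real.pi * (a + b))) - Real.log Real.pi with hX
  have hXsum : HasSum (shell fun k => (latticeLog (a + b) k : ℂ)) X := by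
    have : HasSum (fun K : ℕ => ∑ k ∈ ({(K : ℤ), -(K : ℤ)} : Finset ℤ), latticeLog (a + b) k) X := by
      by_cases h : ∃ m : ℤ, a + b = m
      · rw [hX, if_pos h]
        obtain ⟨m, hm⟩ := h
        rw [hm]
        exact hasSum_latticeLog_int m
      · rw [hX, if_neg h]
        push Not at h
        exact hasSum_latticeLog h
    have h2 := Complex.hasSum_ofReal.mpr this
    convert! h2 using 1
    funext K
    exact shell_ofReal _ _
  have hsum := ((((hXsum.mul_left (-(1 / s))).add
    ((summable_norm_gaussShell hs2 a b 1).of_norm.hasSum.mul_left (1 / (s * (1 - s))))).add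
    (hasSum_shell_ite_real b (-(1 / s ^ 2)))).add
    (hasSum_shell_ite_real (a + b)
      ((Complex.digamma (1 - s) + Real.eulerMascheroniConstant - Real.log a) / s))).add
    (hasSum_shell_inner_poles ha b s)
  have hI := hasSum_integral_latticeLog ha.ne' b hq
  have hshell : (shell fun k => ∫ t : ℝ in Ioc 0 1,
      (latticeLog (a * t + b) k : ℂ) * (t : ℂ) ^ (-s - 1)) = fun K =>
      -(1 / s) * shell (fun k => (latticeLog (a + b) k : ℂ)) K +
      1 / (s * (1 - s)) * gaussShell a b 1 s K +
      shell (fun k => if (k : ℝ) = b then -(1 / s ^ 2) else 0) K +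
      shell (fun k => if (k : ℝ) = a + b then
        (Complex.digamma (1 - s) + Real.eulerMascheroniConstant - Real.log a) / s else 0) K +
      shell (fun k => if b < k ∧ (k : ℝ) < a + b then
        -(Real.pi * Complex.I * ((a / (k - b) : ℝ) : ℂ) ^ s / s) else 0) K := by
    funext K
    rw [gaussShell_eq_shell, ← shell_mul_left, ← shell_mul_left, ← shell_add, ← shell_add,
      ← shell_add, ← shell_add]
    exact shell_congr fun k _ => integral_latticeLog hs ha b k
  rw [hshell] at hI
  have hmain := hI.unique hsum
  have hsplit : ∫ t : ℝ in Ioc 0 1, ((Real.log (Real.sin (Real.pi * (a * t + b))) -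
      Real.log Real.pi : ℝ) : ℂ) * (t : ℂ) ^ (-s - 1) =
      (∫ t : ℝ in Ioc 0 1, (Real.log (2 * Real.sin (Real.pi * (a * t + b))) : ℂ) *
        (t : ℂ) ^ (-s - 1)) + (Real.log 2 + Real.log Real.pi) / s := by
    have i1 := integrableOn_log_mul_cpow (f := fun t => 2 * Real.sin (Real.pi * (a * t + b)))
      (fun t => by fun_prop) hq
    have i2 := (integrableOn_cpow_unit (w := -s) (by simp; linarith)).const_mul
      ((Real.log 2 + Real.log Real.pi : ℝ) : ℂ)
    have e : ((Real.log 2 + Real.log Real.pi) / s : ℂ) = -∫ t : ℝ in Ioc 0 1,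
        ((Real.log 2 + Real.log Real.pi : ℝ) : ℂ) * (t : ℂ) ^ (-s - 1) := by
      rw [integral_const_mul, integral_cpow_neg_sub_one (by linarith)]
      push_cast
      ring
    rw [e, ← sub_eq_add_neg, ← integral_sub i1 i2]
    refine integral_congr_ae ?_
    filter_upwards [ae_affine_ne_int ha.ne' b] with t ht
    rw [Real.log_mul two_ne_zero (real_sin_pi_mul_ne_zero ht)]
    push_cast
    ring
  rw [hsplit] at hmain
  set J := ∫ t : ℝ in Ioc 0 1, (Real.log (2 * Real.sin (Real.pi * (a * t + b))) : ℂ) *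
        (t : ℂ) ^ (-s - 1)
  rw [logSineH]
  simp only [Complex.ofReal_one, Complex.one_cpow, mul_one, Real.sign_of_pos ha, abs_of_pos ha,
    tsum_div_const, div_one]
  set P := Complex.I * (Real.pi * (a : ℂ) ^ s / s) *
        (hurwitzZetaAt s (1 - Int.fract b) - hurwitzZetaAt s (⌈a + b⌉ - b)) with hP
  have hb : (if ∃ m : ℤ, b = m then 1 / s ^ 2 else 0) =
      -(if ∃ m : ℤ, b = m then -(1 / s ^ 2) else 0) := by
    split_ifs <;> simp
  rw [hb]
  set Q := if ∃ m : ℤ, b = m then -(1 / s ^ 2) else 0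
  rw [eq_sub_iff_add_eq.mpr hmain]
  by_cases h : ∃ m : ℤ, a + b = m
  · simp only [if_pos h, hX]
    have e : Real.log ((Real.pi * a) ^ 2) = 2 * (Real.log Real.pi + Real.log a) := by
      rw [Real.log_pow, Real.log_mul Real.pi_ne_zero ha.ne']
      push_cast
      ring
    rw [e]
    push_cast
    ring
  · simp only [if_neg h, hX]
    rw [Real.log_pow]
    push_cast
    field_simp
    ring

/-! ### The Gamma series, and the Fourier series of the logarithm of the sine. -/

/-- The sum over `k ≥ 1` of the Gamma parts, continued to all `s` off the non-negative integers. -/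
noncomputable def gammaSum (a b : ℝ) (s : ℂ) : ℂ :=
  (2 * (Real.pi : ℂ)) ^ s * Complex.Gamma (-s) * (1 / 2) *
    ((-Complex.I * a) ^ s * HurwitzZeta.expZeta (b : UnitAddCircle) (1 - s)
      + (Complex.I * a) ^ s * HurwitzZeta.expZeta ((-b : ℝ) : UnitAddCircle) (1 - s))

theorem hasSum_expZeta_succ (b : ℝ) {w : ℂ} (hw : 1 < w.re) :
    HasSum (fun k : ℕ => ((k + 1 : ℕ) : ℂ) ^ (-w) *
      Complex.exp (2 * Real.pi * b * (k + 1 : ℕ) * Complex.I))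
      (HurwitzZeta.expZeta (b : UnitAddCircle) w) := by
  have h := (hasSum_nat_add_iff' 1).mpr (HurwitzZeta.hasSum_expZeta_of_one_lt_re b hw)
  have hw0 : w ≠ 0 := fun h0 => by simp [h0] at hw; linarith
  simp only [Finset.range_one, Finset.sum_singleton, Nat.cast_zero, Complex.zero_cpow hw0,
    div_zero, sub_zero] at h
  convert! h using 1
  funext k
  rw [Complex.cpow_neg, div_eq_inv_mul]
  congr 2
  ring

theorem hasSum_gammaTerm {s : ℂ} (hs : s.re < 0) (a b : ℝ) :
    HasSum (fun k : ℕ => gammaTerm a b (k + 1) s) (gammaSum a b s) := by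
  have hw : 1 < (1 - s).re := by simp; linarith
  have h1 := (hasSum_expZeta_succ b hw).mul_left ((-Complex.I * a) ^ s)
  have h2 := (hasSum_expZeta_succ (-b) hw).mul_left ((Complex.I * a) ^ s)
  have h := (h1.add h2).mul_left ((2 * (Real.pi : ℂ)) ^ s * Complex.Gamma (-s) * (1 / 2))
  convert! h using 1
  funext k
  rw [gammaTerm, neg_sub]
  push_cast
  rw [show 2 * (Real.pi : ℂ) * -b * (k + 1) * Complex.I = -(2 * Real.pi * b * (k + 1) * Complex.I) by
    ring]
  ring

theorem hasSum_geometric_cos {r : ℝ} (hr0 : 0 ≤ r) (hr : r < 1) (y : ℝ) :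
    HasSum (fun n : ℕ => r ^ n * Real.cos (2 * Real.pi * n * y) / n)
      (-Real.log ‖1 - r * Complex.exp (2 * Real.pi * y * Complex.I)‖) := by
  have hz : ‖(r : ℂ) * Complex.exp (2 * Real.pi * y * Complex.I)‖ < 1 := by
    rw [norm_mul, show (2 * Real.pi * y * Complex.I : ℂ) = ((2 * Real.pi * y : ℝ) : ℂ) * Complex.I by
      push_cast; ring, Complex.norm_exp_ofReal_mul_I, Complex.norm_real, Real.norm_of_nonneg hr0]
    simpa using hr
  have h := Complex.hasSum_re (Complex.hasSum_taylorSeries_neg_log hz)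
  rw [Complex.neg_re, Complex.log_re] at h
  convert! h using 1
  funext n
  rw [mul_pow, ← Complex.exp_nat_mul, show ((n : ℂ) * (2 * Real.pi * y * Complex.I)) =
    ((2 * Real.pi * n * y : ℝ) : ℂ) * Complex.I by push_cast; ring, ← Complex.ofReal_pow,
    ← Complex.ofReal_natCast n, Complex.div_ofReal_re, Complex.re_ofReal_mul,
    Complex.exp_ofReal_mul_I_re]

theorem norm_one_sub_exp (y : ℝ) :
    ‖1 - Complex.exp (2 * Real.pi * y * Complex.I)‖ = |2 * Real.sin (Real.pi * y)| := by
  have h := Complex.norm_exp_I_mul_ofReal_sub_one (2 * Real.pi * y)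
  rw [norm_sub_rev, ← Real.norm_eq_abs, show Real.pi * y = 2 * Real.pi * y / 2 by ring, ← h]
  push_cast
  ring_nf

/-- Since `|1 - z| ≤ |1 - r z| + (1 - r) ≤ 2 |1 - r z| ≤ 4`, the logarithm at radius `r` is
controlled by the one on the circle. This dominates the Abel means uniformly in `r`. -/
theorem abs_log_norm_one_sub_le {r : ℝ} (hr0 : 0 ≤ r) (hr : r < 1) {z : ℂ} (hz : ‖z‖ = 1)
    (hz1 : z ≠ 1) :
    |Real.log ‖1 - r * z‖| ≤ Real.log 2 + |Real.log ‖1 - z‖| := by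
  have hrz : ‖(r : ℂ) * z‖ = r := by rw [norm_mul, hz, Complex.norm_real, Real.norm_of_nonneg hr0, mul_one]
  have hlow : 1 - r ≤ ‖1 - r * z‖ := by
    have := norm_sub_norm_le (1 : ℂ) (r * z)
    rw [norm_one, hrz] at this
    exact this
  have hpos : 0 < ‖1 - r * z‖ := by linarith
  have hup : ‖1 - r * z‖ ≤ 2 := by
    have := norm_sub_le (1 : ℂ) (r * z)
    rw [norm_one, hrz] at this
    linarith
  have hz0 : 0 < ‖1 - z‖ := norm_pos_iff.mpr (sub_ne_zero.mpr (Ne.symm hz1))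
  have hcmp : ‖1 - z‖ ≤ 2 * ‖1 - r * z‖ := by
    have h1 : (1 - z) = (1 - r * z) + ((r - 1 : ℝ) : ℂ) * z := by push_cast; ring
    have h2 : ‖1 - z‖ ≤ ‖1 - r * z‖ + (1 - r) := by
      rw [h1]
      refine (norm_add_le _ _).trans ?_
      rw [norm_mul, hz, Complex.norm_real, Real.norm_eq_abs, abs_sub_comm, abs_of_pos (by linarith)]
      linarith
    linarith
  have h1 := Real.log_le_log hpos hup
  have h2 := Real.log_le_log hz0 hcmp
  rw [Real.log_mul two_ne_zero hpos.ne'] at h2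
  have h3 := neg_abs_le (Real.log ‖1 - z‖)
  have h4 := abs_nonneg (Real.log ‖1 - z‖)
  rw [abs_le]
  constructor <;> linarith

theorem hypTerm_eq_integral {s : ℂ} (hs : s.re < 0) {a : ℝ} (ha : a ≠ 0) (b : ℝ) (k : ℕ) :
    hypTerm a b 1 k s = -∫ t in Ioc (0 : ℝ) 1,
      ((Real.cos (2 * Real.pi * k * (a * t + b)) / k : ℝ) : ℂ) * (t : ℂ) ^ (-s - 1) := by
  rcases Nat.eq_zero_or_pos k with rfl | hk
  · simp [hypTerm]
  have hsn : ∀ n : ℕ, s ≠ n := by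
    rintro n rfl
    simp at hs
    linarith [n.cast_nonneg (α := ℝ)]
  have hint : ∀ x : ℝ, IntegrableOn (fun t : ℝ => Complex.exp (-(x * Complex.I) * t) * (t : ℂ) ^ (-s - 1))
      (Ioc (0 : ℝ) 1) := by
    intro x
    have h0 := integrableOn_cpow_unit (w := -s) (by simpa using hs)
    refine h0.bdd_mul (c := 1) (by fun_prop) (Eventually.of_forall fun t => ?_)
    rw [show -(x * Complex.I) * (t : ℂ) = ((-x * t : ℝ) : ℂ) * Complex.I by push_cast; ring,
      Complex.norm_exp_ofReal_mul_I]
  rw [hypTerm_eq_scaledLowerGamma hsn ha b hk, scaledLowerGamma_eq_integral hs,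
    scaledLowerGamma_eq_integral hs, ← integral_const_mul, ← integral_const_mul,
    ← integral_add, ← integral_const_mul, ← integral_neg]
  · refine setIntegral_congr_fun measurableSet_Ioc fun t ht => ?_
    rw [show ((Real.cos (2 * Real.pi * k * (a * t + b)) / k : ℝ) : ℂ) =
      (Complex.exp (2 * Real.pi * b * k * Complex.I) *
        Complex.exp (-(-(Complex.I * (2 * Real.pi * k * a))) * t) +
        Complex.exp (-(2 * Real.pi * b * k * Complex.I)) *
        Complex.exp (-(Complex.I * (2 * Real.pi * k * a)) * t)) / (2 * k) by
      rw [← Complex.exp_add, ← Complex.exp_add]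
      push_cast
      rw [Complex.cos]
      rw [div_div]
      congr 3 <;> ring]
    have hk' : (k : ℂ) ≠ 0 := Nat.cast_ne_zero.mpr hk.ne'
    field_simp
  · refine Integrable.const_mul ((hint (-(2 * Real.pi * k * a))).congr
      (Eventually.of_forall fun t => ?_)) _
    push_cast
    ring_nf
  · refine Integrable.const_mul ((hint (2 * Real.pi * k * a)).congr
      (Eventually.of_forall fun t => ?_)) _
    push_cast
    ring_nf

/-- The full summands and the Gamma terms are both summable for `re s < 0`, hence so is their
difference; no oscillatory integral has to be estimated. -/
theorem summable_hypTerm {s : ℂ} (hs : s.re < 0) {a : ℝ} (ha : a ≠ 0) (b : ℝ) :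
    Summable fun k : ℕ => hypTerm a b 1 (k + 1) s := by
  have hsn : ∀ n : ℕ, s ≠ n := by
    rintro n rfl
    simp at hs
    linarith [n.cast_nonneg (α := ℝ)]
  refine ((summable_norm_entireTerm ha b s).of_norm.sub (hasSum_gammaTerm hs a b).summable).congr
    fun k => ?_
  rw [entireTerm_eq hsn ha b (by omega), add_sub_cancel_right]

/-- Abel means of the Fourier series of the logarithm of the sine. -/
theorem hasSum_hypTerm_mul_pow {s : ℂ} (hs : s.re < 0) {a : ℝ} (ha : a ≠ 0) (b : ℝ) {r : ℝ}
    (hr0 : 0 ≤ r) (hr : r < 1) :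
    HasSum (fun k : ℕ => hypTerm a b 1 k s * (r : ℂ) ^ k)
      (∫ t in Ioc (0 : ℝ) 1,
        (Real.log ‖1 - r * Complex.exp (2 * Real.pi * (a * t + b : ℝ) * Complex.I)‖ : ℂ) *
          (t : ℂ) ^ (-s - 1)) := by
  have h0 := integrableOn_cpow_unit (w := -s) (by simpa using hs)
  have hbd : ∀ (k : ℕ) (t : ℝ),
      |r ^ k * Real.cos (2 * Real.pi * k * (a * t + b)) / k| ≤ r ^ k := by
    intro k t
    rcases Nat.eq_zero_or_pos k with rfl | hk
    · simp
    have hk1 : (1 : ℝ) ≤ k := by exact_mod_cast hk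
    rw [abs_div, abs_mul, abs_of_nonneg (pow_nonneg hr0 k), abs_of_nonneg (by linarith : (0 : ℝ) ≤ k)]
    rw [div_le_iff₀ (by linarith)]
    have := Real.abs_cos_le_one (2 * Real.pi * k * (a * t + b))
    have := pow_nonneg hr0 k
    exact mul_le_mul_of_nonneg_left (by linarith) this
  have hint : ∀ k : ℕ, IntegrableOn (fun t : ℝ =>
      ((r ^ k * Real.cos (2 * Real.pi * k * (a * t + b)) / k : ℝ) : ℂ) * (t : ℂ) ^ (-s - 1))
      (Ioc (0 : ℝ) 1) := by
    intro k
    refine h0.bdd_mul (c := r ^ k) (by fun_prop) (Eventually.of_forall fun t => ?_)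
    rw [Complex.norm_real]
    exact hbd k t
  have hsum : Summable fun k : ℕ => ∫ t in Ioc (0 : ℝ) 1,
      ‖((r ^ k * Real.cos (2 * Real.pi * k * (a * t + b)) / k : ℝ) : ℂ) * (t : ℂ) ^ (-s - 1)‖ := by
    refine Summable.of_nonneg_of_le (fun k => integral_nonneg fun t => norm_nonneg _)
      (fun k => ?_) ((summable_geometric_of_lt_one hr0 hr).mul_right
        (∫ t in Ioc (0 : ℝ) 1, ‖(t : ℂ) ^ (-s - 1)‖))
    rw [← integral_const_mul]
    refine integral_mono (hint k).norm (h0.norm.const_mul _) fun t => ?_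
    simp only [norm_mul, Complex.norm_real]
    exact mul_le_mul_of_nonneg_right (hbd k t) (norm_nonneg _)
  have h := (hasSum_integral_of_summable_integral_norm hint hsum).neg
  rw [← integral_neg] at h
  convert! h using 1
  · funext k
    rw [hypTerm_eq_integral hs ha, neg_mul, mul_comm, ← integral_const_mul]
    congr 1
    refine integral_congr_ae (Eventually.of_forall fun t => ?_)
    push_cast
    ring
  · refine integral_congr_ae (Eventually.of_forall fun t => ?_)
    have h2 := (Complex.hasSum_ofReal.mpr (hasSum_geometric_cos hr0 hr (a * t + b))).mul_right
      ((t : ℂ) ^ (-s - 1))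
    simp only
    rw [h2.tsum_eq]
    push_cast
    ring

/-- As the series is known to converge, Abel's theorem gives its sum as the limit of the Abel means.
That limit is computed by dominated convergence under the integral. -/
theorem hasSum_hypTerm {s : ℂ} (hs : s.re < -1) {a : ℝ} (ha : a ≠ 0) (b : ℝ) :
    HasSum (fun k : ℕ => hypTerm a b 1 (k + 1) s)
      (∫ t in Ioc (0 : ℝ) 1,
        (Real.log (2 * Real.sin (Real.pi * (a * t + b))) : ℂ) * (t : ℂ) ^ (-s - 1)) := by
  have hs0 : s.re < 0 := by linarith
  have hq : 0 < (-s - 1).re := by simp; linarith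
  have hsum := summable_hypTerm hs0 ha b
  have hsum0 : Summable fun k : ℕ => hypTerm a b 1 k s := (summable_nat_add_iff 1).mp hsum
  have hzero : hypTerm a b 1 0 s = 0 := by simp [hypTerm]
  have habel := Complex.tendsto_tsum_powerSeries_nhdsWithin_lt hsum0.hasSum.tendsto_sum_nat
  rw [tendsto_map'_iff] at habel
  have hlogint : IntegrableOn (fun t : ℝ =>
      (Real.log (2 * Real.sin (Real.pi * (a * t + b))) : ℂ) * (t : ℂ) ^ (-s - 1)) (Ioc (0 : ℝ) 1) :=
    integrableOn_log_mul_cpow (f := fun t => 2 * Real.sin (Real.pi * (a * t + b)))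
      (fun t => by fun_prop) hq
  have hcpow : IntegrableOn (fun t : ℝ => (t : ℂ) ^ (-s - 1)) (Ioc (0 : ℝ) 1) :=
    integrableOn_cpow_unit (w := -s) (by simpa using hs0)
  have hr01 : ∀ᶠ r : ℝ in 𝓝[<] 1, r ∈ Ioo (0 : ℝ) 1 := Ioo_mem_nhdsLT one_pos
  have hlog : ∀ t : ℝ, Real.log ‖1 - Complex.exp (2 * Real.pi * (a * t + b : ℝ) * Complex.I)‖ =
      Real.log (2 * Real.sin (Real.pi * (a * t + b))) := fun t => by
    rw [norm_one_sub_exp, Real.log_abs]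
  have hne : ∀ᵐ t : ℝ ∂volume.restrict (Ioc 0 1),
      Complex.exp (2 * Real.pi * (a * t + b : ℝ) * Complex.I) ≠ 1 := by
    filter_upwards [ae_affine_ne_int ha b] with t ht h1
    rw [Complex.exp_eq_one_iff] at h1
    obtain ⟨m, hm⟩ := h1
    refine ht m ?_
    have : ((a * t + b : ℝ) : ℂ) = m := by
      have h2 : (2 * Real.pi * Complex.I : ℂ) ≠ 0 := Complex.two_pi_I_ne_zero
      refine mul_right_cancel₀ h2 ?_
      rw [← hm]
      ring
    exact_mod_cast this
  have hdom : Tendsto (fun r : ℝ => ∫ t in Ioc (0 : ℝ) 1,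
      (Real.log ‖1 - r * Complex.exp (2 * Real.pi * (a * t + b : ℝ) * Complex.I)‖ : ℂ) *
          (t : ℂ) ^ (-s - 1)) (𝓝[<] 1) (𝓝 (∫ t in Ioc (0 : ℝ) 1,
        (Real.log (2 * Real.sin (Real.pi * (a * t + b))) : ℂ) * (t : ℂ) ^ (-s - 1))) := by
    refine tendsto_integral_filter_of_dominated_convergence
      (fun t => Real.log 2 * ‖(t : ℂ) ^ (-s - 1)‖ +
        ‖(Real.log (2 * Real.sin (Real.pi * (a * t + b))) : ℂ) * (t : ℂ) ^ (-s - 1)‖) ?_ ?_ ?_ ?_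
    · refine Eventually.of_forall fun r => AEStronglyMeasurable.mul ?_ hcpow.aestronglyMeasurable
      refine Measurable.aestronglyMeasurable ?_
      refine Complex.measurable_ofReal.comp (Real.measurable_log.comp ?_)
      refine Continuous.measurable ?_
      fun_prop
    · filter_upwards [hr01] with r hr
      filter_upwards [hne] with t ht
      rw [norm_mul, norm_mul, Complex.norm_real, Complex.norm_real, ← add_mul, ← hlog]
      refine mul_le_mul_of_nonneg_right ?_ (norm_nonneg _)
      refine abs_log_norm_one_sub_le hr.1.le hr.2 ?_ ht
      rw [show (2 * Real.pi * (a * t + b : ℝ) * Complex.I : ℂ) =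
        ((2 * Real.pi * (a * t + b) : ℝ) : ℂ) * Complex.I by push_cast; ring,
        Complex.norm_exp_ofReal_mul_I]
    · exact (hcpow.norm.const_mul _).add hlogint.norm
    · filter_upwards [hne] with t ht
      rw [← hlog]
      refine Tendsto.mul_const _ ?_
      refine (Complex.continuous_ofReal.tendsto _).comp ?_
      have hc : Tendsto (fun r : ℝ =>
          ‖1 - (r : ℂ) * Complex.exp (2 * Real.pi * (a * t + b : ℝ) * Complex.I)‖) (𝓝[<] 1)
          (𝓝 ‖1 - Complex.exp (2 * Real.pi * (a * t + b : ℝ) * Complex.I)‖) := by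
        have : Continuous fun r : ℝ =>
          ‖1 - (r : ℂ) * Complex.exp (2 * Real.pi * (a * t + b : ℝ) * Complex.I)‖ := by fun_prop
        simpa using (this.tendsto 1).mono_left nhdsWithin_le_nhds
      exact hc.log (norm_ne_zero_iff.mpr (sub_ne_zero.mpr ht.symm))
  have heq := tendsto_nhds_unique (habel.congr' (by
    filter_upwards [hr01] with r hr
    exact (hasSum_hypTerm_mul_pow hs0 ha b hr.1.le hr.2).tsum_eq)) hdom
  rw [← heq]
  have := (hasSum_nat_add_iff' 1).mpr hsum0.hasSum
  simpa [hzero] using this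

/-- The logarithmic sine function as the sum of its Fourier parts, in a left half-plane. -/
theorem hasSum_hypTerm_logSineH {s : ℂ} (hs : s.re < -2) {a : ℝ} (ha : 0 < a) (b : ℝ) :
    HasSum (fun k : ℕ => hypTerm a b 1 (k + 1) s) (-logSineH a b 1 s) := by
  rw [logSineH_eq_integral_of_pos hs ha, neg_neg]
  exact hasSum_hypTerm (by linarith) ha.ne' b

/-! ### Continuation of the identity to all `s` off the natural numbers. -/

theorem isOpen_compl_range_natCast : IsOpen (range ((↑) : ℕ → ℂ))ᶜ :=
  isClosed_range_natCast_complex.isOpen_compl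

theorem ne_natCast_of_mem_compl {s : ℂ} (hs : s ∈ (range ((↑) : ℕ → ℂ))ᶜ) (n : ℕ) : s ≠ n :=
  fun h => hs ⟨n, h.symm⟩

theorem differentiableAt_Gamma_neg {s : ℂ} (hs : ∀ n : ℕ, s ≠ n) :
    DifferentiableAt ℂ (fun z : ℂ => Complex.Gamma (-z)) s :=
  (Complex.differentiableAt_Gamma (-s) fun m h => hs m (neg_injective h)).comp s
    differentiableAt_id.neg

theorem differentiableOn_gammaSum {a : ℝ} (ha : a ≠ 0) (b : ℝ) :
    DifferentiableOn ℂ (gammaSum a b) (range ((↑) : ℕ → ℂ))ᶜ := by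
  intro s hs
  have hsn := ne_natCast_of_mem_compl hs
  have hs0 : s ≠ 0 := by simpa using hsn 0
  have haI : Complex.I * a ≠ 0 := mul_ne_zero Complex.I_ne_zero (by exact_mod_cast ha)
  have haI' : -Complex.I * a ≠ 0 := by rw [neg_mul]; exact neg_ne_zero.mpr haI
  have hpi : (2 * (Real.pi : ℂ)) ≠ 0 := by exact_mod_cast (by positivity : 2 * Real.pi ≠ 0)
  have hexp : ∀ c : UnitAddCircle,
      DifferentiableAt ℂ (fun z : ℂ => HurwitzZeta.expZeta c (1 - z)) s := fun c =>
    (HurwitzZeta.differentiableAt_expZeta c (1 - s) (Or.inl (by simpa using hs0))).comp s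
      (differentiableAt_id.const_sub 1)
  have hc : ∀ c : ℂ, c ≠ 0 → DifferentiableAt ℂ (fun z : ℂ => c ^ z) s := fun c h =>
    differentiableAt_id.const_cpow (Or.inl h)
  exact ((((hc _ hpi).mul (differentiableAt_Gamma_neg hsn)).mul_const _).mul
    (((hc _ haI').mul (hexp _)).add ((hc _ haI).mul (hexp _)))).differentiableWithinAt

theorem differentiableAt_digamma_one_sub {s : ℂ} (hs : ∀ n : ℕ, s ≠ n) :
    DifferentiableAt ℂ (fun z : ℂ => Complex.digamma (1 - z)) s := by
  have hU : IsOpen {z : ℂ | 1 - z ∈ (range ((↑) : ℕ → ℂ))ᶜ} :=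
    isOpen_compl_range_natCast.preimage (continuous_const.sub continuous_id)
  have hG : DifferentiableOn ℂ Complex.Gamma {z : ℂ | 1 - z ∈ (range ((↑) : ℕ → ℂ))ᶜ} := by
    intro z hz
    refine (Complex.differentiableAt_Gamma z fun m hm => ?_).differentiableWithinAt
    refine ne_natCast_of_mem_compl hz (m + 1) ?_
    rw [hm]
    push_cast
    ring
  have hmem : (1 - s) ∈ {z : ℂ | 1 - z ∈ (range ((↑) : ℕ → ℂ))ᶜ} := by
    rintro ⟨n, hn⟩
    exact hs n (by rw [hn]; ring)
  have hne : Complex.Gamma (1 - s) ≠ 0 := Complex.Gamma_ne_zero fun m hm =>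
    hs (m + 1) (by push_cast; linear_combination -hm)
  have h1 := ((hG.deriv hU).differentiableAt (hU.mem_nhds hmem)).div
    (hG.differentiableAt (hU.mem_nhds hmem)) hne
  exact h1.comp s (differentiableAt_id.const_sub 1)

theorem differentiableOn_logSineH_one {a : ℝ} (ha : a ≠ 0) (b : ℝ) :
    DifferentiableOn ℂ (logSineH a b 1) (range ((↑) : ℕ → ℂ))ᶜ := by
  intro s hs
  have hsn := ne_natCast_of_mem_compl hs
  have hs0 : s ≠ 0 := by simpa using hsn 0
  have hs1 : s ≠ 1 := by simpa using hsn 1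
  have hid : DifferentiableAt ℂ (fun z : ℂ => z) s := differentiableAt_id
  have hone : ∀ {f : ℂ → ℂ}, DifferentiableAt ℂ f s →
      DifferentiableAt ℂ (fun z : ℂ => f z * ((1 : ℝ) : ℂ) ^ z) s := by
    intro f hf
    simpa using hf
  have hgauss : DifferentiableAt ℂ
      (fun z : ℂ => ∑' K : ℕ, gaussShell a b 1 z K / (z * (1 - z))) s := by
    simp_rw [tsum_div_const]
    refine DifferentiableAt.div ?_ (hid.mul (hid.const_sub 1))
      (mul_ne_zero hs0 (sub_ne_zero.mpr hs1.symm))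
    exact (differentiableOn_tsum_gaussShell a b 1).differentiableAt
      (isOpen_compl_natCast_ge_two.mem_nhds fun n _ => hsn n)
  have hpow : DifferentiableAt ℂ (fun z : ℂ => ((|a| : ℝ) : ℂ) ^ z) s :=
    hid.const_cpow (Or.inl (by exact_mod_cast abs_ne_zero.mpr ha))
  refine DifferentiableAt.differentiableWithinAt ?_
  unfold logSineH
  refine DifferentiableAt.add (DifferentiableAt.sub (DifferentiableAt.add (DifferentiableAt.add
    (DifferentiableAt.add ?_ ?_) ?_) ?_) ?_) ?_
  · exact (differentiableAt_const _).div (hone hid) (by simpa using hs0)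
  · split_ifs
    · exact differentiableAt_const _
    · exact (differentiableAt_const _).div (hone (hid.const_mul 2)) (by simpa using hs0)
  · split_ifs
    · exact (differentiableAt_const _).div (hone (hid.pow 2)) (by simpa using hs0)
    · exact differentiableAt_const _
  · split_ifs
    · exact ((differentiableAt_const _).div (hone hid) (by simpa using hs0)).mul
        (((differentiableAt_digamma_one_sub hsn).neg.sub_const _).add_const _)
    · exact differentiableAt_const _
  · simpa using hgauss
  · exact ((hpow.const_mul _).div hid hs0 |>.const_mul _).mul
      ((differentiableAt_hurwitzZetaAt _ hs1).sub (differentiableAt_hurwitzZetaAt _ hs1))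

/-- For `re s < -2` the two parts of the summand are summed separately. Both sides are holomorphic
off `ℕ`, so the identity theorem does the rest. -/
theorem tsum_entireTerm_eq_of_pos {s : ℂ} (hs : ∀ n : ℕ, s ≠ n) {a : ℝ} (ha : 0 < a) (b : ℝ) :
    ∑' k : ℕ, entireTerm a b (k + 1) s = gammaSum a b s - logSineH a b 1 s := by
  have hV : IsOpen {s : ℂ | s.re < -2} := isOpen_lt Complex.continuous_re continuous_const
  have hneg : ∀ n : ℕ, (-3 : ℂ) ≠ n := fun n h => by
    have := congrArg Complex.re h
    simp at this
    linarith [n.cast_nonneg (α := ℝ)]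
  refine eqOn_compl_natCast (differentiable_tsum_entireTerm ha.ne' b).differentiableOn
    ((differentiableOn_gammaSum ha.ne' b).sub (differentiableOn_logSineH_one ha.ne' b)) hV
    (s₀ := -3) (by simp; norm_num) hneg (fun z hz => ?_) s hs
  have hz' : z.re < -2 := hz
  have hzn : ∀ n : ℕ, z ≠ n := by
    rintro n rfl
    simp at hz'
    linarith [n.cast_nonneg (α := ℝ)]
  have h := (hasSum_hypTerm_logSineH hz' ha b).add (hasSum_gammaTerm (by linarith) a b)
  rw [Pi.sub_apply, sub_eq_neg_add, ← h.tsum_eq]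
  exact tsum_congr fun k => entireTerm_eq hzn ha.ne' b (by omega)

/-! ### Symmetries: the reflection `(a, b) ↦ (-a, -b)` and scaling by `d`. -/

theorem hypTerm_neg_neg (a b d : ℝ) (k : ℕ) (s : ℂ) : hypTerm (-a) (-b) d k s = hypTerm a b d k s := by
  unfold hypTerm
  rw [show 2 * Real.pi * -b * k = -(2 * Real.pi * b * k) by ring, Real.cos_neg, Real.sin_neg, neg_sq]
  push_cast
  ring

theorem gammaTerm_neg_neg (a b : ℝ) (k : ℕ) (s : ℂ) : gammaTerm (-a) (-b) k s = gammaTerm a b k s := by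
  unfold gammaTerm
  push_cast
  rw [show -Complex.I * -(a : ℂ) = Complex.I * a by ring,
    show Complex.I * -(a : ℂ) = -Complex.I * a by ring,
    show 2 * (Real.pi : ℂ) * -b * k * Complex.I = -(2 * Real.pi * b * k * Complex.I) by ring, neg_neg]
  ring

theorem gammaSum_neg_neg (a b : ℝ) (s : ℂ) : gammaSum (-a) (-b) s = gammaSum a b s := by
  unfold gammaSum
  rw [neg_neg]
  push_cast
  rw [show -Complex.I * -(a : ℂ) = Complex.I * a by ring,
    show Complex.I * -(a : ℂ) = -Complex.I * a by ring]
  ring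

/-- The reflection is absorbed by `k ↦ -k`, which maps each shell to itself. -/
theorem gaussShell_neg_neg (a b d : ℝ) (s : ℂ) (K : ℕ) :
    gaussShell (-a) (-b) d s K = gaussShell a b d s K := by
  have hterm : ∀ k : ℤ, gaussTerm (-a) (-b) d s (-k) = gaussTerm a b d s k := by
    intro k
    have h1 : ((-k : ℤ) : ℝ) = -b ↔ (k : ℝ) = b := by push_cast; exact neg_inj
    have h2 : ((-k : ℤ) : ℝ) = -a * d + -b ↔ (k : ℝ) = a * d + b := by
      push_cast
      constructor <;> intro h <;> linarith
    have h3 : -a * d / (-b - ((-k : ℤ) : ℝ)) = a * d / (b - k) := by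
      push_cast
      rw [neg_mul, show -b - -(k : ℝ) = -(b - k) by ring, neg_div_neg_eq]
    unfold gaussTerm
    simp only [h1, h2, h3]
  unfold gaussShell
  refine Finset.sum_nbij' (fun k => -k) (fun k => -k) ?_ ?_ ?_ ?_ ?_
  · intro k hk
    simp only [Finset.mem_insert, Finset.mem_singleton] at hk ⊢
    omega
  · intro k hk
    simp only [Finset.mem_insert, Finset.mem_singleton] at hk ⊢
    omega
  · intro k _
    exact neg_neg k
  · intro k _
    exact neg_neg k
  · intro k _
    rw [← hterm, neg_neg]

theorem logSineH_neg_neg (a b d : ℝ) (s : ℂ) : logSineH (-a) (-b) d s = logSineH a b d s := by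
  have hneg : ∀ x : ℝ, (∃ m : ℤ, -x = m) ↔ ∃ m : ℤ, x = m := fun x =>
    ⟨fun ⟨m, h⟩ => ⟨-m, by push_cast; linarith⟩, fun ⟨m, h⟩ => ⟨-m, by push_cast; linarith⟩⟩
  have h1 : -a * d + -b = -(a * d + b) := by ring
  have h2 : -b * Real.sign (-a) = b * Real.sign a := by rw [Real.sign_neg]; ring
  have h3 : Real.sin (Real.pi * -(a * d + b)) ^ 2 = Real.sin (Real.pi * (a * d + b)) ^ 2 := by
    rw [mul_neg, Real.sin_neg, neg_sq]
  have h4 : (Real.pi * -a * d) ^ 2 = (Real.pi * a * d) ^ 2 := by ring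
  have hA : (∃ m : ℤ, -a * d + -b = m) ↔ ∃ m : ℤ, a * d + b = m := by rw [h1, hneg]
  unfold logSineH
  simp only [gaussShell_neg_neg, abs_neg, h2, h4]
  by_cases hab : ∃ m : ℤ, a * d + b = m <;> by_cases hb : ∃ m : ℤ, b = m
  · simp only [if_pos hab, if_pos (hA.mpr hab), if_pos hb, if_pos ((hneg b).mpr hb)]
  · simp only [if_pos hab, if_pos (hA.mpr hab), if_neg hb, if_neg (mt (hneg b).mp hb)]
  · simp only [if_neg hab, if_neg (mt hA.mp hab), if_pos hb, if_pos ((hneg b).mpr hb), h1, h3]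
  · simp only [if_neg hab, if_neg (mt hA.mp hab), if_neg hb, if_neg (mt (hneg b).mp hb), h1, h3]

theorem gammaSum_scale {d : ℝ} (hd : 0 < d) (a b : ℝ) (s : ℂ) :
    gammaSum a b s = (d : ℂ) ^ (-s) * gammaSum (a * d) b s := by
  have hd' : (d : ℂ) ^ s ≠ 0 := by
    rw [Complex.cpow_ne_zero_iff]
    exact Or.inl (by exact_mod_cast hd.ne')
  unfold gammaSum
  push_cast
  rw [show -Complex.I * ((a : ℂ) * d) = d * (-Complex.I * a) by ring,
    show Complex.I * ((a : ℂ) * d) = d * (Complex.I * a) by ring, ofReal_mul_cpow hd,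
    ofReal_mul_cpow hd, Complex.cpow_neg]
  field_simp

theorem gaussShell_scale (a b d : ℝ) (s : ℂ) (K : ℕ) :
    gaussShell a b d s K = gaussShell (a * d) b 1 s K := by
  simp only [gaussShell_eq_shell, shell, gaussTerm_eq_node, mul_one]

/-- In the Hurwitz zeta part `|a d| ^ s` supplies a factor `d ^ s` that cancels `d ^ (-s)`; every
other part carries `d ^ (-s)` already. -/
theorem logSineH_scale {d : ℝ} (hd : 0 < d) (a b : ℝ) (s : ℂ) :
    logSineH a b d s = (d : ℂ) ^ (-s) * logSineH (a * d) b 1 s := by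
  have hd' : (d : ℂ) ^ s ≠ 0 := by
    rw [Complex.cpow_ne_zero_iff]
    exact Or.inl (by exact_mod_cast hd.ne')
  have hsign : Real.sign (a * d) = Real.sign a := by
    rcases lt_trichotomy a 0 with h | h | h
    · rw [Real.sign_of_neg h, Real.sign_of_neg (mul_neg_of_neg_of_pos h hd)]
    · rw [h, zero_mul]
    · rw [Real.sign_of_pos h, Real.sign_of_pos (mul_pos h hd)]
  have habs : ((|a * d| : ℝ) : ℂ) ^ s = (d : ℂ) ^ s * ((|a| : ℝ) : ℂ) ^ s := by
    rw [abs_mul, abs_of_pos hd, mul_comm]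
    push_cast
    exact ofReal_mul_cpow hd _ _
  have h1 : Real.pi * (a * d) * 1 = Real.pi * a * d := by ring
  unfold logSineH
  rw [habs]
  simp only [gaussShell_scale a b d, hsign, mul_one, h1, abs_mul, abs_of_pos hd,
    Complex.ofReal_one, Complex.one_cpow, Complex.cpow_neg]
  generalize ∑' K : ℕ, gaussShell (a * d) b 1 s K / (s * (1 - s)) = T
  have hA : (∃ m : ℤ, a * d * 1 + b = m) ↔ ∃ m : ℤ, a * d + b = m := by rw [mul_one]
  by_cases hab : ∃ m : ℤ, a * d + b = m <;> by_cases hb : ∃ m : ℤ, b = m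
  · simp only [if_pos hab, if_pos (hA.mpr hab), if_pos hb]
    field_simp
    ring
  · simp only [if_pos hab, if_pos (hA.mpr hab), if_neg hb]
    field_simp
    ring
  · simp only [if_neg hab, if_neg (mt hA.mp hab), if_pos hb]
    field_simp
    ring
  · simp only [if_neg hab, if_neg (mt hA.mp hab), if_neg hb]
    field_simp
    ring

/-- The principal identity, with the sum over the Gamma parts in closed form. -/
theorem hasSum_hypTerm_add_gammaTerm {s : ℂ} (hs : ∀ n : ℕ, s ≠ n) {a d : ℝ} (ha : a ≠ 0)
    (hd : 0 < d) (b : ℝ) :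
    HasSum (fun k : ℕ => hypTerm a b d (k + 1) s + gammaTerm a b (k + 1) s)
      (gammaSum a b s - logSineH a b d s) := by
  have hpos : ∀ {a : ℝ}, 0 < a → ∀ b : ℝ, HasSum
      (fun k : ℕ => hypTerm a b 1 (k + 1) s + gammaTerm a b (k + 1) s)
      (gammaSum a b s - logSineH a b 1 s) := by
    intro a ha b
    rw [← tsum_entireTerm_eq_of_pos hs ha b]
    convert! (summable_norm_entireTerm ha.ne' b s).of_norm.hasSum using 1
    funext k
    exact (entireTerm_eq hs ha.ne' b (by omega)).symm
  have hone : ∀ {a : ℝ}, a ≠ 0 → ∀ b : ℝ, HasSum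
      (fun k : ℕ => hypTerm a b 1 (k + 1) s + gammaTerm a b (k + 1) s)
      (gammaSum a b s - logSineH a b 1 s) := by
    intro a ha b
    rcases lt_or_gt_of_ne ha with h | h
    · have := hpos (neg_pos.mpr h) (-b)
      simpa only [hypTerm_neg_neg, gammaTerm_neg_neg, gammaSum_neg_neg, logSineH_neg_neg] using this
    · exact hpos h b
  have := (hone (mul_ne_zero ha hd.ne') b).mul_left ((d : ℂ) ^ (-s))
  simpa only [mul_add, mul_sub, ← hypTerm_scale hd, ← gammaTerm_scale hd, ← gammaSum_scale hd,
    ← logSineH_scale hd] using this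

/-! ### Hurwitz's formula and the principal identity. -/

theorem Gamma_mul_Gamma_neg {s : ℂ} (hs : s ≠ 0) :
    Complex.Gamma s * Complex.Gamma (-s) = -(Real.pi / (s * Complex.sin (Real.pi * s))) := by
  have h1 := Complex.Gamma_mul_Gamma_one_sub s
  have h2 := Complex.Gamma_add_one (-s) (neg_ne_zero.mpr hs)
  rw [show -s + 1 = 1 - s by ring] at h2
  rw [h2] at h1
  rw [mul_comm s, ← div_div, ← h1]
  field_simp

/-- Hurwitz's formula writes each periodic zeta value at `1 - s` through the Hurwitz zeta values of
`b` and `-b` at `s`. Multiplied by `(∓i)^s`, the phases `exp(±πis/2)` cancel for `b` and combine to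
`cos πs` for `-b`, while `Γ(s) Γ(-s)` contributes `1 / sin πs`. -/
theorem neg_gammaSum_eq_of_pos {s : ℂ} (hs : 1 < s.re) {a : ℝ} (ha : 0 < a) (b : ℝ) :
    -gammaSum a b s = Real.pi * (a : ℂ) ^ s / s *
      (HurwitzZeta.hurwitzZeta (b : UnitAddCircle) s / Complex.sin (Real.pi * s) +
        HurwitzZeta.hurwitzZeta ((-b : ℝ) : UnitAddCircle) s / Complex.tan (Real.pi * s)) := by
  have hs0 : s ≠ 0 := fun h => by simp [h] at hs; linarith
  have hne : ∀ n : ℕ, s ≠ 1 - n := by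
    rintro n rfl
    simp at hs
    linarith [n.cast_nonneg (α := ℝ)]
  have hpi : (2 * (Real.pi : ℂ)) ^ s ≠ 0 := by
    rw [Complex.cpow_ne_zero_iff]
    exact Or.inl (by exact_mod_cast (by positivity : 2 * Real.pi ≠ 0))
  have hI : Complex.I ^ s = Complex.exp (Real.pi * Complex.I * s / 2) := by
    rw [Complex.cpow_def_of_ne_zero Complex.I_ne_zero, Complex.log_I]
    ring_nf
  have hI' : (-Complex.I) ^ s = Complex.exp (-Real.pi * Complex.I * s / 2) := by
    rw [Complex.cpow_def_of_ne_zero (neg_ne_zero.mpr Complex.I_ne_zero), Complex.log_neg_I]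
    ring_nf
  have hinv : Complex.exp (-Real.pi * Complex.I * s / 2) = (Complex.exp (Real.pi * Complex.I * s / 2))⁻¹ := by
    rw [← Complex.exp_neg]
    ring_nf
  have hcos : Complex.cos (Real.pi * s) = (Complex.exp (Real.pi * Complex.I * s / 2) ^ 2 +
      (Complex.exp (Real.pi * Complex.I * s / 2))⁻¹ ^ 2) / 2 := by
    rw [← Complex.exp_neg, ← Complex.exp_nat_mul, ← Complex.exp_nat_mul, Complex.cos]
    push_cast
    ring_nf
  have hE : Complex.exp (Real.pi * Complex.I * s / 2) ≠ 0 := Complex.exp_ne_zero _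
  rw [gammaSum, HurwitzZeta.expZeta_one_sub _ hne, HurwitzZeta.expZeta_one_sub _ hne,
    AddCircle.coe_neg, neg_neg, mul_comm (-Complex.I), mul_comm Complex.I (a : ℂ),
    ofReal_mul_cpow ha, ofReal_mul_cpow ha, hI, hI', hinv, Complex.tan_eq_sin_div_cos,
    div_div_eq_mul_div, ← add_div, Complex.cpow_neg]
  have hG := Gamma_mul_Gamma_neg hs0
  rw [← AddCircle.coe_neg]
  generalize HurwitzZeta.hurwitzZeta (b : UnitAddCircle) s = Z
  generalize HurwitzZeta.hurwitzZeta ((-b : ℝ) : UnitAddCircle) s = Z'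
  have hR : ∀ X : ℂ, Real.pi * (a : ℂ) ^ s / s * (X / Complex.sin (Real.pi * s)) =
      -(Complex.Gamma s * Complex.Gamma (-s)) * (a : ℂ) ^ s * X := fun X => by
    rw [hG]
    ring
  rw [hR, hcos]
  field_simp
  ring

theorem neg_gammaSum_eq {s : ℂ} (hs : 1 < s.re) {a : ℝ} (ha : a ≠ 0) (b : ℝ) :
    -gammaSum a b s = Real.pi * ((|a| : ℝ) : ℂ) ^ s / s *
      (hurwitzZetaAt s (1 - Int.fract (-(b * Real.sign a))) / Complex.sin (Real.pi * s) +
        hurwitzZetaAt s (1 - Int.fract (b * Real.sign a)) / Complex.tan (Real.pi * s)) := by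
  rw [hurwitzZetaAt_one_sub_fract, hurwitzZetaAt_one_sub_fract, neg_neg]
  rcases lt_or_gt_of_ne ha with h | h
  · rw [← gammaSum_neg_neg, neg_gammaSum_eq_of_pos hs (neg_pos.mpr h), abs_of_neg h,
      Real.sign_of_neg h, mul_neg_one]
  · rw [neg_gammaSum_eq_of_pos hs h, abs_of_pos h, Real.sign_of_pos h, mul_one]

theorem logSineLHS_eq {s : ℂ} (hs : 1 < s.re) {a : ℝ} (ha : a ≠ 0) (b d : ℝ) :
    logSineLHS a b d s = -(gammaSum a b s - logSineH a b d s) := by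
  rw [neg_sub, sub_eq_add_neg, neg_gammaSum_eq hs ha, logSineLHS]

theorem hasSum_logSineLHS {s : ℂ} (hs : 1 < s.re) (hsn : ∀ n : ℕ, s ≠ n) {a b d : ℝ} (ha : a ≠ 0)
    (hd : 0 < d) :
    HasSum (fun k : ℕ => -(hypTerm a b d (k + 1) s + gammaTerm a b (k + 1) s))
      (logSineLHS a b d s) := by
  rw [logSineLHS_eq hs ha]
  exact (hasSum_hypTerm_add_gammaTerm hsn ha hd b).neg

/-- The punctured unit disc around `n` contains no natural number and lies in `re s > 1`. There the
left-hand side equals the negative of an entire function, which is continuous at `n`. -/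
theorem tendsto_logSineLHS {a b d : ℝ} (ha : a ≠ 0) (hd : 0 < d) {n : ℕ} (hn : 2 ≤ n) :
    Tendsto (logSineLHS a b d) (𝓝[≠] (n : ℂ)) (𝓝 (-∑' k : ℕ, entireSummand a b d (k + 1) n)) := by
  have hc := ((differentiable_tsum_entireSummand ha hd b).continuous.neg.tendsto (n : ℂ)).mono_left
    (nhdsWithin_le_nhds (s := {(n : ℂ)}ᶜ))
  refine hc.congr' ?_
  filter_upwards [nhdsWithin_le_nhds (Metric.ball_mem_nhds (n : ℂ) one_pos),
    self_mem_nhdsWithin] with z hz hzn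
  rw [Metric.mem_ball, dist_eq_norm] at hz
  have hre : 1 < z.re := by
    have h2 := (abs_lt.mp ((Complex.abs_re_le_norm (z - n)).trans_lt hz)).1
    have h3 : (2 : ℝ) ≤ n := by exact_mod_cast hn
    rw [Complex.sub_re, Complex.natCast_re] at h2
    linarith
  have hne : ∀ m : ℕ, z ≠ m := by
    rintro m rfl
    have h1 : ((m : ℤ) - n : ℂ) = (((m : ℤ) - (n : ℤ) : ℤ) : ℂ) := by push_cast; ring
    have h2 : ‖(((m : ℤ) - (n : ℤ) : ℤ) : ℂ)‖ < 1 := by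
      rw [← h1]
      simpa using hz
    rw [Complex.norm_intCast] at h2
    have h3 : |(m : ℤ) - n| < 1 := by exact_mod_cast h2
    rw [Int.abs_lt_one_iff] at h3
    exact hzn (by rw [mem_singleton_iff]; exact_mod_cast sub_eq_zero.mp h3)
  rw [logSineLHS_eq hre ha, ← (hasSum_hypTerm_add_gammaTerm hne ha hd b).tsum_eq]
  congr 1
  exact tsum_congr fun k => entireSummand_eq hne ha hd b (by omega)

/-! ### Conditional convergence of the Gamma series and the second identity. -/

theorem norm_cpow_neg_sub_le {w : ℂ} (hw : 0 < w.re) (i : ℕ) :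
    ‖((i + 1 + 1 : ℕ) : ℂ) ^ (-w) - ((i + 1 : ℕ) : ℂ) ^ (-w)‖ ≤
      ‖w‖ * ((i + 1 : ℕ) : ℝ) ^ (-w.re - 1) := by
  have hw0 : w ≠ 0 := fun h => by simp [h] at hw
  have hpos : (0 : ℝ) < (i + 1 : ℕ) := by positivity
  have hderiv : ∀ x ∈ Icc ((i + 1 : ℕ) : ℝ) (i + 1 + 1 : ℕ),
      HasDerivWithinAt (fun y : ℝ => (y : ℂ) ^ (-w)) (-w * (x : ℂ) ^ (-w - 1))
        (Icc ((i + 1 : ℕ) : ℝ) (i + 1 + 1 : ℕ)) x := by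
    intro x hx
    have hx0 : x ≠ 0 := (hpos.trans_le hx.1).ne'
    exact (hasDerivAt_ofReal_cpow_const hx0 (neg_ne_zero.mpr hw0)).hasDerivWithinAt
  have hbound : ∀ x ∈ Ico ((i + 1 : ℕ) : ℝ) (i + 1 + 1 : ℕ),
      ‖-w * (x : ℂ) ^ (-w - 1)‖ ≤ ‖w‖ * ((i + 1 : ℕ) : ℝ) ^ (-w.re - 1) := by
    intro x hx
    rw [norm_mul, norm_neg, Complex.norm_cpow_eq_rpow_re_of_pos (hpos.trans_le hx.1)]
    refine mul_le_mul_of_nonneg_left ?_ (norm_nonneg _)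
    rw [Complex.sub_re, Complex.neg_re, Complex.one_re]
    exact Real.rpow_le_rpow_of_nonpos hpos hx.1 (by linarith)
  have hle : ((i + 1 : ℕ) : ℝ) ≤ (i + 1 + 1 : ℕ) := by exact_mod_cast Nat.le_succ _
  have h := norm_image_sub_le_of_norm_deriv_le_segment' hderiv hbound _ (right_mem_Icc.mpr hle)
  rw [show (((i + 1 + 1 : ℕ) : ℝ) - (i + 1 : ℕ)) = 1 by push_cast; ring, mul_one] at h
  exact_mod_cast h

/-- The series obtained from the Dirichlet series `∑ c k (k + 1) ^ (-w)` by partial summation. -/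
noncomputable def abelTransform (c : ℕ → ℂ) (w : ℂ) : ℂ :=
  ∑' i : ℕ, (((i + 1 : ℕ) : ℂ) ^ (-w) - ((i + 1 + 1 : ℕ) : ℂ) ^ (-w)) * ∑ k ∈ Finset.range (i + 1), c k

theorem norm_abelTerm_le {c : ℕ → ℂ} {C : ℝ} (hc : ∀ N, ‖∑ k ∈ Finset.range N, c k‖ ≤ C) {w : ℂ}
    (hw : 0 < w.re) (i : ℕ) :
    ‖(((i + 1 : ℕ) : ℂ) ^ (-w) - ((i + 1 + 1 : ℕ) : ℂ) ^ (-w)) * ∑ k ∈ Finset.range (i + 1), c k‖ ≤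
      ‖w‖ * ((i + 1 : ℕ) : ℝ) ^ (-w.re - 1) * C := by
  rw [norm_mul, norm_sub_rev]
  exact mul_le_mul (norm_cpow_neg_sub_le hw i) (hc _) (norm_nonneg _) (by positivity)

theorem summable_rpow_succ {q : ℝ} (hq : q < -1) : Summable fun i : ℕ => ((i + 1 : ℕ) : ℝ) ^ q :=
  (summable_nat_add_iff 1).mpr (Real.summable_nat_rpow.mpr hq)

/-- Summation by parts. The boundary term is a bounded sum times `N ^ (-w)` and tends to zero; by
the mean value inequality the transformed series is dominated by the sum of `(i + 1) ^ (-re w - 1)`.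
-/
theorem tendsto_sum_mul_cpow_neg {c : ℕ → ℂ} {C : ℝ} (hc : ∀ N, ‖∑ k ∈ Finset.range N, c k‖ ≤ C)
    {w : ℂ} (hw : 0 < w.re) :
    Tendsto (fun N : ℕ => ∑ k ∈ Finset.range N, ((k + 1 : ℕ) : ℂ) ^ (-w) * c k) atTop
      (𝓝 (abelTransform c w)) := by
  have hsum : Summable fun i : ℕ =>
      (((i + 1 : ℕ) : ℂ) ^ (-w) - ((i + 1 + 1 : ℕ) : ℂ) ^ (-w)) * ∑ k ∈ Finset.range (i + 1), c k :=
    Summable.of_norm_bounded (((summable_rpow_succ (by linarith)).mul_left _).mul_right _)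
      (norm_abelTerm_le hc hw)
  have hlim : Tendsto (fun N : ℕ => ((N + 1 : ℕ) : ℂ) ^ (-w) * ∑ k ∈ Finset.range (N + 1), c k)
      atTop (𝓝 0) := by
    have h0 : Tendsto (fun N : ℕ => ((N + 1 : ℕ) : ℝ) ^ (-w.re) * C) atTop (𝓝 0) := by
      have := ((tendsto_rpow_neg_atTop hw).comp
        (tendsto_natCast_atTop_atTop.comp (tendsto_add_atTop_nat 1))).mul_const C
      simpa using this
    refine squeeze_zero_norm (fun N => ?_) h0
    rw [norm_mul, ← Complex.ofReal_natCast, Complex.norm_cpow_eq_rpow_re_of_pos (by positivity),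
      Complex.neg_re]
    exact mul_le_mul_of_nonneg_left (hc _) (by positivity)
  rw [← tendsto_add_atTop_iff_nat 1]
  have h := hlim.add hsum.hasSum.tendsto_sum_nat
  rw [zero_add] at h
  refine h.congr fun N => ?_
  have hp := Finset.sum_range_by_parts (fun k : ℕ => ((k + 1 : ℕ) : ℂ) ^ (-w)) c (N + 1)
  simp only [smul_eq_mul, Nat.add_sub_cancel] at hp
  rw [hp, sub_eq_add_neg, ← Finset.sum_neg_distrib]
  congr 1
  exact Finset.sum_congr rfl fun i _ => by ring

theorem differentiableOn_abelTransform {c : ℕ → ℂ} {C : ℝ}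
    (hc : ∀ N, ‖∑ k ∈ Finset.range N, c k‖ ≤ C) :
    DifferentiableOn ℂ (abelTransform c) {w | 0 < w.re} := by
  have hC : 0 ≤ C := (norm_nonneg _).trans (hc 0)
  intro w hw
  have hw' : 0 < w.re := hw
  have hopen : IsOpen ({z : ℂ | w.re / 2 < z.re} ∩ Metric.ball 0 (‖w‖ + 1)) :=
    (isOpen_lt continuous_const Complex.continuous_re).inter Metric.isOpen_ball
  have hmem : w ∈ {z : ℂ | w.re / 2 < z.re} ∩ Metric.ball 0 (‖w‖ + 1) :=
    ⟨by change w.re / 2 < w.re; linarith, by simp⟩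
  have h : DifferentiableOn ℂ (abelTransform c)
      ({z : ℂ | w.re / 2 < z.re} ∩ Metric.ball 0 (‖w‖ + 1)) := by
    refine Complex.differentiableOn_tsum_of_summable_norm
      (u := fun i : ℕ => (‖w‖ + 1) * ((i + 1 : ℕ) : ℝ) ^ (-(w.re / 2) - 1) * C)
      (((summable_rpow_succ (by linarith)).mul_left _).mul_right _) (fun i => ?_) hopen ?_
    · have hd : ∀ m : ℕ, Differentiable ℂ fun z : ℂ => ((m + 1 : ℕ) : ℂ) ^ (-z) := fun m z =>
        differentiableAt_id.neg.const_cpow (Or.inl (Nat.cast_ne_zero.mpr (Nat.succ_ne_zero m)))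
      exact (((hd i).sub (hd (i + 1))).mul_const _).differentiableOn
    · rintro i z ⟨hz, hz'⟩
      have hz1 : w.re / 2 < z.re := hz
      refine (norm_abelTerm_le hc (by linarith) i).trans ?_
      refine mul_le_mul_of_nonneg_right (mul_le_mul ?_ ?_ (by positivity) (by positivity)) hC
      · exact (by simpa using hz' : ‖z‖ < ‖w‖ + 1).le
      · exact Real.rpow_le_rpow_of_exponent_le (by push_cast; linarith [i.cast_nonneg (α := ℝ)])
          (by linarith)
  exact (h.differentiableAt (hopen.mem_nhds hmem)).differentiableWithinAt

/-- A geometric sum whose ratio is on the unit circle and differs from `1` because `b` is not an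
integer. -/
theorem norm_sum_exp_le {b : ℝ} (hb : ∀ m : ℤ, b ≠ m) : ∃ C : ℝ, ∀ N : ℕ,
    ‖∑ k ∈ Finset.range N, Complex.exp (2 * Real.pi * b * (k + 1 : ℕ) * Complex.I)‖ ≤ C := by
  set z := Complex.exp (2 * Real.pi * b * Complex.I) with hz
  have hz1 : z ≠ 1 := by
    intro h
    rw [hz, Complex.exp_eq_one_iff] at h
    obtain ⟨m, hm⟩ := h
    refine hb m ?_
    have : ((b : ℝ) : ℂ) = m := by
      refine mul_right_cancel₀ Complex.two_pi_I_ne_zero ?_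
      rw [← hm]
      ring
    exact_mod_cast this
  have hnorm : ‖z‖ = 1 := by
    rw [hz, show (2 * Real.pi * b * Complex.I : ℂ) = ((2 * Real.pi * b : ℝ) : ℂ) * Complex.I by
      push_cast; ring, Complex.norm_exp_ofReal_mul_I]
  refine ⟨2 / ‖z - 1‖, fun N => ?_⟩
  have hterm : ∀ k : ℕ, Complex.exp (2 * Real.pi * b * (k + 1 : ℕ) * Complex.I) = z ^ k * z := by
    intro k
    rw [← pow_succ, hz, ← Complex.exp_nat_mul]
    ring_nf
  rw [Finset.sum_congr rfl fun k _ => hterm k, ← Finset.sum_mul, geom_sum_eq hz1, norm_mul, hnorm,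
    mul_one, norm_div]
  refine div_le_div_of_nonneg_right ?_ (norm_nonneg _)
  refine (norm_sub_le _ _).trans ?_
  rw [norm_pow, hnorm, one_pow, norm_one]
  norm_num

theorem coe_unitAddCircle_ne_zero {b : ℝ} (hb : ∀ m : ℤ, b ≠ m) : (b : UnitAddCircle) ≠ 0 := by
  intro h
  rw [AddCircle.coe_eq_zero_iff] at h
  obtain ⟨m, hm⟩ := h
  exact hb m (by simpa using hm.symm)

/-- The Dirichlet series of the periodic zeta function converges conditionally in `0 < re w`. -/
theorem tendsto_expZeta {b : ℝ} (hb : ∀ m : ℤ, b ≠ m) {w : ℂ} (hw : 0 < w.re) :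
    Tendsto (fun N : ℕ => ∑ k ∈ Finset.range N, ((k + 1 : ℕ) : ℂ) ^ (-w) *
      Complex.exp (2 * Real.pi * b * (k + 1 : ℕ) * Complex.I)) atTop
      (𝓝 (HurwitzZeta.expZeta (b : UnitAddCircle) w)) := by
  obtain ⟨C, hC⟩ := norm_sum_exp_le hb
  have hU : IsOpen {z : ℂ | 0 < z.re} := isOpen_lt continuous_const Complex.continuous_re
  have hV : {z : ℂ | 1 < z.re} ∈ 𝓝 (2 : ℂ) :=
    (isOpen_lt continuous_const Complex.continuous_re).mem_nhds (by simp)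
  have h1 := (differentiableOn_abelTransform hC).analyticOnNhd hU
  have h2 : AnalyticOnNhd ℂ (HurwitzZeta.expZeta (b : UnitAddCircle)) {z : ℂ | 0 < z.re} :=
    DifferentiableOn.analyticOnNhd (fun z _ => (HurwitzZeta.differentiableAt_expZeta _ z
      (Or.inr (coe_unitAddCircle_ne_zero hb))).differentiableWithinAt) hU
  -- Near `w = 2` the series converges absolutely to the periodic zeta function, and both functions
  -- are holomorphic in `0 < re w`.
  have heq := h1.eqOn_of_preconnected_of_eventuallyEq h2
    (convex_halfSpace_re_gt 0).isPreconnected (z₀ := 2) (by simp) (by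
      filter_upwards [hV] with z hz
      have hz' : 1 < z.re := hz
      exact tendsto_nhds_unique (tendsto_sum_mul_cpow_neg hC (by linarith))
        (hasSum_expZeta_succ b hz').tendsto_sum_nat)
  rw [← heq hw]
  exact tendsto_sum_mul_cpow_neg hC hw

theorem gammaTerm_succ_eq (a b : ℝ) (k : ℕ) (s : ℂ) : gammaTerm a b (k + 1) s =
    (2 * (Real.pi : ℂ)) ^ s * Complex.Gamma (-s) * (1 / 2) *
      ((-Complex.I * a) ^ s * (((k + 1 : ℕ) : ℂ) ^ (-(1 - s)) *
        Complex.exp (2 * Real.pi * b * (k + 1 : ℕ) * Complex.I)) +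
      (Complex.I * a) ^ s * (((k + 1 : ℕ) : ℂ) ^ (-(1 - s)) *
        Complex.exp (2 * Real.pi * (-b : ℝ) * (k + 1 : ℕ) * Complex.I))) := by
  rw [gammaTerm, neg_sub]
  push_cast
  rw [show 2 * (Real.pi : ℂ) * -b * (k + 1) * Complex.I = -(2 * Real.pi * b * (k + 1) * Complex.I) by
    ring]
  ring

theorem tendsto_sum_gammaTerm {b : ℝ} (hb : ∀ m : ℤ, b ≠ m) {s : ℂ} (hs : s.re < 1) (a : ℝ) :
    Tendsto (fun N : ℕ => ∑ k ∈ Finset.range N, gammaTerm a b (k + 1) s) atTop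
      (𝓝 (gammaSum a b s)) := by
  have hw : 0 < (1 - s).re := by simp; linarith
  have hb' : ∀ m : ℤ, -b ≠ m := fun m h => hb (-m) (by push_cast; linarith)
  have h := (((tendsto_expZeta hb hw).const_mul ((-Complex.I * a) ^ s)).add
    ((tendsto_expZeta hb' hw).const_mul ((Complex.I * a) ^ s))).const_mul
      ((2 * (Real.pi : ℂ)) ^ s * Complex.Gamma (-s) * (1 / 2))
  refine h.congr fun N => ?_
  simp only [gammaTerm_succ_eq, Finset.mul_sum, ← Finset.sum_add_distrib]

/-- The partial sums of the ₁F₂ terms are those of the full series minus those of the Gamma series,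
so the closed forms `gammaSum` cancel. The conditions on `b` are those under which the Gamma series
is shown to converge: conditionally, or absolutely for `re s < 0`. -/
theorem tendsto_sum_hypTerm {s : ℂ} {a b : ℝ} (ha : a ≠ 0) (hs : s ≠ 0)
    (h : s.re < 1 ∧ (∀ m : ℤ, b ≠ m) ∨ s.re < 0 ∧ ∃ m : ℤ, b = m) :
    Tendsto (fun N : ℕ => ∑ k ∈ Finset.Icc 1 N, hypTerm a b 1 k s) atTop
      (𝓝 (-logSineH a b 1 s)) := by
  have hre : s.re < 1 := by
    rcases h with h | h
    · exact h.1
    · linarith [h.1]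
  have hsn : ∀ n : ℕ, s ≠ n := by
    rintro n rfl
    have : n < 1 := by exact_mod_cast hre
    exact hs (by simp; omega)
  have hgamma : Tendsto (fun N : ℕ => ∑ k ∈ Finset.range N, gammaTerm a b (k + 1) s) atTop
      (𝓝 (gammaSum a b s)) := by
    rcases h with h | h
    · exact tendsto_sum_gammaTerm h.2 h.1 a
    · exact (hasSum_gammaTerm h.1 a b).tendsto_sum_nat
  have hlim := (hasSum_hypTerm_add_gammaTerm hsn ha one_pos b).tendsto_sum_nat.sub hgamma
  rw [sub_sub_cancel_left] at hlim
  refine hlim.congr fun N => ?_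
  rw [← Finset.sum_sub_distrib, Finset.sum_congr rfl fun k _ => add_sub_cancel_right _ _,
    Finset.range_eq_Ico, Finset.sum_Ico_add' (fun k => hypTerm a b 1 k s)]
  rfl

end

/-- In the second part, `F a b d k` is the `k`-th summand of the right-hand side with its removable
singularities at `s = 0, 1, 2, …` removed; the series over `k ≥ 1` is indexed by `k + 1`, `k : ℕ`. -/
theorem theorem1p2 :
    -- the principal identity
    (∀ (s : ℂ) (a b d : ℝ), 1 < s.re → (∀ n : ℕ, s ≠ n) → a ≠ 0 → 0 < d →
      HasSum (fun k : ℕ => -(hypTerm a b d (k + 1) s + gammaTerm a b (k + 1) s))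
        (logSineLHS a b d s)) ∧
    -- the right-hand side
    (∃ F : ℝ → ℝ → ℝ → ℕ → ℂ → ℂ,
      (∀ (a b d : ℝ) (k : ℕ), a ≠ 0 → 0 < d → 1 ≤ k →
        Differentiable ℂ (F a b d k) ∧
        ∀ s : ℂ, (∀ n : ℕ, s ≠ n) → F a b d k s = hypTerm a b d k s + gammaTerm a b k s) ∧
      (∀ a b d : ℝ, a ≠ 0 → 0 < d →
        (∀ s : ℂ, Summable fun k : ℕ => ‖F a b d (k + 1) s‖) ∧
        (Differentiable ℂ fun s : ℂ => ∑' k : ℕ, F a b d (k + 1) s) ∧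
        -- the principal identity at the integers `s = n ≥ 2`, as a limit
        (∀ n : ℕ, 2 ≤ n →
          Filter.Tendsto (logSineLHS a b d) (nhdsWithin (n : ℂ) {(n : ℂ)}ᶜ)
            (nhds (-∑' k : ℕ, F a b d (k + 1) n)))) ∧
      (∀ ε δ B : ℝ, 0 < ε → 0 < δ →
        AbsUniformlyConvergesOn
          (fun (k : ℕ) (p : ℂ × ℝ × ℝ × ℝ) =>
            (p.2.2.2 : ℂ) ^ p.1 * F p.2.1 p.2.2.1 p.2.2.2 (k + 1) p.1)
          {p | ∃ (s : ℂ) (a b d : ℝ), p = (s, a, b, d) ∧ -ε < s.re ∧ |s.im| < ε ∧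
            δ ≤ |a| ∧ |a| ≤ B ∧ δ ≤ d ∧ d ≤ B} ∧
        AbsUniformlyConvergesOn
          (fun (k : ℕ) (p : ℂ × ℝ × ℝ × ℝ) => F p.2.1 p.2.2.1 p.2.2.2 (k + 1) p.1)
          {p | ∃ (s : ℂ) (a b d : ℝ), p = (s, a, b, d) ∧ -ε < s.re ∧ |s.im| < ε ∧
            δ ≤ |a| ∧ |a| ≤ B ∧ δ ≤ d ∧ d ≤ B ∧ (1 ≤ d ∨ s.re ≤ B)})) ∧
    -- the series on the left-hand side, without the factor `1 / (s * (1 - s))`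
    (∀ a b d : ℝ, a ≠ 0 → 0 < d →
      (∀ s : ℂ, (∀ n : ℕ, 2 ≤ n → s ≠ n) → Summable fun K : ℕ => ‖gaussShell a b d s K‖) ∧
      DifferentiableOn ℂ (fun s : ℂ => ∑' K : ℕ, gaussShell a b d s K)
        {s | ∀ n : ℕ, 2 ≤ n → s ≠ n} ∧
      Meromorphic (fun s : ℂ => ∑' K : ℕ, gaussShell a b d s K)) ∧
    -- its uniform convergence
    (∀ ε δ B : ℝ, 0 < ε → 0 < δ →
      AbsUniformlyConvergesOn
        (fun (K : ℕ) (p : ℂ × ℝ × ℝ × ℝ) =>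
          gaussShell p.2.1 p.2.2.1 p.2.2.2 p.1 K / (p.1 * (1 - p.1)))
        {p | ∃ (s : ℂ) (a b d : ℝ), p = (s, a, b, d) ∧ a ≠ 0 ∧ 0 < d ∧ s.re < ε ∧
          (∀ n : ℕ, (n : ℝ) ≤ ε → δ ≤ ‖s - n‖) ∧
          |b| ≤ B ∧ (∀ m : ℤ, δ ≤ |b - m|) ∧
          (∀ m : ℤ, δ ≤ |a * d + b - m|) ∧ |a * d| ≤ B}) ∧
    -- the second identity
    (∀ (s : ℂ) (a b : ℝ), a ≠ 0 → s ≠ 0 →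
      (s.re < 1 ∧ (∀ m : ℤ, b ≠ m) ∨ s.re < 0 ∧ ∃ m : ℤ, b = m) →
      Filter.Tendsto (fun N : ℕ => ∑ k ∈ Finset.Icc 1 N, hypTerm a b 1 k s) Filter.atTop
        (nhds (-logSineH a b 1 s))) := by
  refine ⟨fun s a b d hs hsn ha hd => hasSum_logSineLHS hs hsn ha hd,
    ⟨entireSummand, fun a b d k ha hd hk => ⟨differentiable_entireSummand ha hd b hk,
      fun s hs => entireSummand_eq hs ha hd b hk⟩,
      fun a b d ha hd => ⟨summable_norm_entireSummand ha hd b,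
        differentiable_tsum_entireSummand ha hd b, fun n hn => tendsto_logSineLHS ha hd hn⟩,
      fun ε δ B hε hδ => ⟨absUniformlyConvergesOn_cpow_mul_entireSummand hδ,
        absUniformlyConvergesOn_entireSummand hε hδ⟩⟩,
    fun a b d _ _ => ⟨fun s hs => summable_norm_gaussShell hs a b d,
      differentiableOn_tsum_gaussShell a b d, meromorphic_tsum_gaussShell a b d⟩,
    fun ε δ B _ hδ => absUniformlyConvergesOn_gaussShell hδ,
    fun s a b ha hs h => tendsto_sum_hypTerm ha hs h⟩
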